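/- **Setting.** Let $d\ge1$. Real $d\times d$ matrices carry the Euclidean scalar product $\xi:\eta=\sum_{ij}\xi_{ij}\eta_{ij}$; $\mathbb M_{sym}$ is the space of symmetric $d\times d$ matrices, $\mathbb M_D\subset\mathbb M_{sym}$ the subspace of trace-free ones if $d\ge2$, and $\mathbb M_D=\mathbb M_{sym}=\mathbb R$ if $d=1$; $\xi_D=\xi-\frac1d(\operatorname{tr}\xi)I$ if $d\ge2$ and $\xi_D=\xi$ if $d=1$. $Eu$ is the symmetric part of the gradient of $u$. Brackets $\langle\cdot,\cdot\rangle$ denote $L^2(\Omega)$ scalar products. One of the following two cases is considered. * (DN) $\Omega\subset\mathbb R^d$ is a bounded connected open set with Lipschitz boundary, $\Gamma_0\subset\partial\Omega$ is closed with $\mathcal H^{d-1}(\Gamma_0)>0$, and $\Gamma_1=\partial\Omega\setminus\Gamma_0$. * (DP) $d\ge2$, $\Omega=(-\frac12,\frac12)^d$ and $\Gamma_0=\{x\in\partial\Omega:|x_1|=\frac12\}$. A function $f$ on $\mathbb R^d$ is called $\bar x$-periodic if $f(x+e_i)=f(x)$ for all $x$ and $i=2,\dots,d$. *Data.* (i)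 $K\subset\mathbb M_D\times\mathbb R$ is closed and convex, there are $0<A\le B<\infty$ with $\{|\sigma|^2+\zeta^2\le A^2\}\subset K\subset\{|\sigma|^2+\zeta^2\le B^2\}$, and $(\sigma,\zeta)\in K$ implies $(0,\zeta)\in K$; $[-a_K,b_K]$ is the projection of $K$ onto $\mathbb R$. Let $H(\xi,\theta)=\sup_{(\sigma,\zeta)\in K}(\sigma:\xi+\zeta\theta)$, let $P_K$ be the projection onto $K$, and $N_K^\varepsilon(\sigma,\zeta)=\frac1\varepsilon\big((\sigma,\zeta)-P_K(\sigma,\zeta)\big)$. (ii) $\mathbb C:\mathbb M_{sym}\to\mathbb M_{sym}$ is linear, symmetric and positive definite, and leaves $\mathbb M_D$ and $\mathbb RI$ invariant. (iii) $V\in C^2(\mathbb R)$, $-M\le V''\le0$ for some $M\ge0$, and $-b_K<V'(+\infty)\le V'(-\infty)<a_K$. Set $$\mathcal Q(e)=\int_\Omega\tfrac12\mathbb Ce:e\,dx,\quad \mathcal H(p,z)=\int_\Omega H(p,z)\,dx,\quad \mathcal V(z)=\int_\Omega V(z)\,dx,$$ $$\mathcal K(\Omega)=\{(\sigma,\zeta)\in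 L^2(\Omega;\mathbb M_D)\times L^\infty(\Omega):(\sigma(x),\zeta(x))\in K\text{ for a.e. }x\in\Omega\}.$$ Let $\boldsymbol w\in H^1_{loc}([0,\infty);H^1(\Omega;\mathbb R^d))$, $u_0\in H^1(\Omega;\mathbb R^d)$, $e_0\in L^2(\Omega;\mathbb M_{sym})$, $p_0\in L^2(\Omega;\mathbb M_D)$, $z_0\in L^2(\Omega)$ and $\varepsilon>0$. In case (DP), $u_0$ and every $\boldsymbol w(t)$, $t\ge0$, are assumed to be restrictions to $\Omega$ of $\bar x$-periodic functions in $H^1_{loc}(\mathbb R^d;\mathbb R^d)$. Let $$\boldsymbol u\in H^1_{loc}([0,\infty);H^1(\Omega;\mathbb R^d)),\quad \boldsymbol e\in H^1_{loc}([0,\infty);L^2(\Omega;\mathbb M_{sym})),$$ $$\boldsymbol p\in H^1_{loc}([0,\infty);L^2(\Omega;\mathbb M_D)),\quad \boldsymbol z\in H^1_{loc}([0,\infty);L^2(\Omega)),$$ and put $\boldsymbol\sigma(t)=\mathbb C\boldsymbol e(t)$, $\boldsymbol\zeta(t)=-V'(\boldsymbol z(t))$. Consider the conditions * (ev0) $(\boldsymbol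 u(0),\boldsymbol e(0),\boldsymbol p(0),\boldsymbol z(0))=(u_0,e_0,p_0,z_0)$; * (ev1) for every $t>0$: $E\boldsymbol u(t)=\boldsymbol e(t)+\boldsymbol p(t)$ a.e. in $\Omega$ and $\boldsymbol u(t)=\boldsymbol w(t)$ $\mathcal H^{d-1}$-a.e. on $\Gamma_0$ in the sense of traces; in case (DP), moreover, $\boldsymbol u(t)$ is the restriction to $\Omega$ of an $\bar x$-periodic function in $H^1_{loc}(\mathbb R^d;\mathbb R^d)$; * (ev2) for every $t>0$: in case (DN), $\operatorname{div}\boldsymbol\sigma(t)=0$ in $\Omega$ in the sense of distributions and $[\boldsymbol\sigma(t)n]=0$ on $\Gamma_1$, that is, $\langle\operatorname{div}\boldsymbol\sigma(t),\psi\rangle+\langle\boldsymbol\sigma(t),E\psi\rangle=0$ for every $\psi\in H^1(\Omega;\mathbb R^d)$ with $\psi=0$ $\mathcal H^{d-1}$-a.e. on $\Gamma_0$; in case (DP), $\boldsymbol\sigma(t)$ is the restriction to $\Omega$ of an $\bar x$-periodic function in $L^2_{loc}(\mathbb R^d;\mathbb M_{sym})$ whose distributional divergence on $\mathbb R^d$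 is $0$. The quadruple $(\boldsymbol u,\boldsymbol e,\boldsymbol p,\boldsymbol z)$ is called a solution of the $\varepsilon$-regularized evolution problem with boundary datum $\boldsymbol w$ and initial condition $(u_0,e_0,p_0,z_0)$ if it satisfies (ev0), (ev1), (ev2) and the regularized flow rule: for a.e. $t>0$, $$(\dot{\boldsymbol p}(t),\dot{\boldsymbol z}(t))=N_K^\varepsilon(\boldsymbol\sigma(t)_D,\boldsymbol\zeta(t))\quad\text{a.e. in }\Omega.$$ **Theorem.** $(\boldsymbol u,\boldsymbol e,\boldsymbol p,\boldsymbol z)$ is a solution of the $\varepsilon$-regularized evolution problem with boundary datum $\boldsymbol w$ and initial condition $(u_0,e_0,p_0,z_0)$ if and only if it satisfies (ev0), (ev1), (ev2) and * (ev3) (modified stress constraint) for a.e. $t>0$: $(\boldsymbol\sigma(t)_D-\varepsilon\dot{\boldsymbol p}(t),\boldsymbol\zeta(t)-\varepsilon\dot{\boldsymbol z}(t))\in\mathcal K(\Omega)$; * (ev4) (energy equality) for every $T>0$: $$\mathcal Q(\boldsymbol e(T))+\int_0^T\mathcal H(\dot{\boldsymbol p}(t),\dot{\boldsymbol z}(t))\,dt+\mathcal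 V(\boldsymbol z(T))+\varepsilon\int_0^T\|\dot{\boldsymbol p}(t)\|_2^2\,dt+\varepsilon\int_0^T\|\dot{\boldsymbol z}(t)\|_2^2\,dt$$ $$=\mathcal Q(e_0)+\mathcal V(z_0)+\int_0^T\langle\boldsymbol\sigma(t),E\dot{\boldsymbol w}(t)\rangle\,dt.$$ -/

import Mathlib

open MeasureTheory Set Filter Topology
open scoped ENNReal NNReal ContDiff

noncomputable section

namespace Plasticity

/-! ### Points and matrices -/

/-- Euclidean space of dimension `d`. -/
abbrev Pt (d : ℕ) : Type := EuclideanSpace ℝ (Fin d)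

/-- Real `d × d` matrices with the Euclidean (Frobenius) scalar product `∑ i j, ξ i j * η i j`. -/
abbrev Mat (d : ℕ) : Type := EuclideanSpace ℝ (Fin d × Fin d)

/-- The identity matrix. -/
def idMat (d : ℕ) : Mat d := WithLp.toLp 2 (fun ij => if ij.1 = ij.2 then (1 : ℝ) else 0)

/-- Symmetric matrices. -/
def Msym (d : ℕ) : Submodule ℝ (Mat d) where
  carrier := {ξ | ∀ i j, ξ (i, j) = ξ (j, i)}
  add_mem' := by
    intro a b ha hb i j
    simp [ha i j, hb i j]
  zero_mem' := by
    intro i j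
    simp
  smul_mem' := by
    intro c a ha i j
    simp [ha i j]

/-- Symmetric trace-free matrices if `d ≥ 2`; for `d = 1` all (symmetric) `1 × 1` matrices. -/
def MD (d : ℕ) : Submodule ℝ (Mat d) where
  carrier := {ξ | (∀ i j, ξ (i, j) = ξ (j, i)) ∧ (2 ≤ d → ∑ i, ξ (i, i) = 0)}
  add_mem' := by
    rintro a b ⟨ha, ha'⟩ ⟨hb, hb'⟩
    refine ⟨fun i j => by simp [ha i j, hb i j], fun h => ?_⟩
    simp [Finset.sum_add_distrib, ha' h, hb' h]
  zero_mem' := by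
    refine ⟨fun i j => by simp, fun h => ?_⟩
    simp
  smul_mem' := by
    rintro c a ⟨ha, ha'⟩
    refine ⟨fun i j => by simp [ha i j], fun h => ?_⟩
    simp [← Finset.mul_sum, ha' h]

/-- The symmetric part `(G + Gᵀ) / 2` of a matrix. -/
def symPart (d : ℕ) : Mat d →L[ℝ] Msym d :=
  LinearMap.toContinuousLinearMap
    { toFun := fun G =>
        ⟨WithLp.toLp 2 (fun ij => (G (ij.1, ij.2) + G (ij.2, ij.1)) / 2), by
          intro i j
          simp [add_comm]⟩
      map_add' := by
        intro a b
        ext ij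
        simp
        ring
      map_smul' := by
        intro c a
        ext ij
        simp
        ring }

/-- The deviator `ξ_D = ξ - (tr ξ / d) I` for `d ≥ 2`, and `ξ_D = ξ` for `d = 1`. -/
def dev (d : ℕ) : Msym d →L[ℝ] MD d :=
  LinearMap.toContinuousLinearMap
    { toFun := fun ξ =>
        ⟨(ξ : Mat d) - (if d = 1 then (0 : ℝ) else (∑ i, (ξ : Mat d) (i, i)) / d) • idMat d, by
          refine ⟨fun i j => ?_, fun h => ?_⟩
          · have hs : (ξ : Mat d) (i, j) = (ξ : Mat d) (j, i) := ξ.2 i j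
            have hI : idMat d (i, j) = idMat d (j, i) := by simp [idMat, eq_comm]
            simp only [PiLp.sub_apply, PiLp.smul_apply, hs, hI]
          · have h1 : d ≠ 1 := by omega
            have h0 : (d : ℝ) ≠ 0 := by
              have : d ≠ 0 := by omega
              exact_mod_cast this
            simp [idMat, h1, Finset.sum_sub_distrib]
            field_simp
            ring⟩
      map_add' := by
        intro a b
        ext ij
        by_cases h : d = 1
        · simp [h]
        · simp [h, Finset.sum_add_distrib]
          ring
      map_smul' := by
        intro c a
        ext ij
        by_cases h : d = 1
        · simp [h]
        · simp [h, ← Finset.mul_sum]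
          ring }

/-! ### Weak derivatives -/

/-- Partial derivative of a scalar function in the direction of the `j`-th basis vector. -/
def pderiv {d : ℕ} (j : Fin d) (φ : Pt d → ℝ) (x : Pt d) : ℝ :=
  fderiv ℝ φ x (EuclideanSpace.single j 1)

/-- Scalar test functions: `φ ∈ C_c^∞(U)`. -/
def IsTest {d : ℕ} (U : Set (Pt d)) (φ : Pt d → ℝ) : Prop :=
  ContDiff ℝ ∞ φ ∧ HasCompactSupport φ ∧ tsupport φ ⊆ U

/-- `G i j = D_j u_i` in the sense of distributions on `U`. -/
def HasWeakGrad {d : ℕ} (U : Set (Pt d)) (u : Pt d → Pt d) (G : Pt d → Mat d) : Prop :=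
  ∀ φ : Pt d → ℝ, IsTest U φ → ∀ i j : Fin d,
    ∫ x in U, u x i * pderiv j φ x = - ∫ x in U, G x (i, j) * φ x

/-- `div σ = f`, i.e. `∑ j, D_j σ_ij = f_i` for all `i`, in the sense of distributions on `U`. -/
def HasWeakDiv {d : ℕ} (U : Set (Pt d)) (σ : Pt d → Msym d) (f : Pt d → Pt d) : Prop :=
  ∀ φ : Pt d → ℝ, IsTest U φ → ∀ i : Fin d,
    ∫ x in U, ∑ j, (σ x : Mat d) (i, j) * pderiv j φ x = - ∫ x in U, f x i * φ x

/-! ### Lebesgue and Sobolev spaces on `Ω` -/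

/-- `L²(Ω; F)` with respect to Lebesgue measure. -/
abbrev L2 {d : ℕ} (Ω : Set (Pt d)) (F : Type) [NormedAddCommGroup F] : Type :=
  Lp F 2 ((volume : Measure (Pt d)).restrict Ω)

theorem exists_pairing {d : ℕ} (Ω : Set (Pt d)) {ι : Type} [Fintype ι] [DecidableEq ι] (i : ι)
    (a : Pt d → ℝ) (ha : Continuous a) (hc : HasCompactSupport a) :
    ∃ L : L2 Ω (EuclideanSpace ℝ ι) →L[ℝ] ℝ, ∀ f, L f = ∫ x in Ω, f x i * a x := by
  have hcont : Continuous (fun x => a x • (EuclideanSpace.single i (1 : ℝ))) := by fun_prop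
  have hcs : HasCompactSupport (fun x => a x • (EuclideanSpace.single i (1 : ℝ))) :=
    hc.smul_right
  have hm : MemLp (fun x => a x • (EuclideanSpace.single i (1 : ℝ))) 2
      ((volume : Measure (Pt d)).restrict Ω) :=
    (hcont.memLp_of_hasCompactSupport hcs).restrict Ω
  refine ⟨innerSL ℝ hm.toLp, fun f => ?_⟩
  rw [innerSL_apply_apply, L2.inner_def]
  apply integral_congr_ae
  filter_upwards [hm.coeFn_toLp] with x hx
  rw [hx, real_inner_smul_left, EuclideanSpace.inner_single_left]
  simp [mul_comm]

theorem IsTest.continuous_pderiv {d : ℕ} {U : Set (Pt d)} {φ : Pt d → ℝ} (h : IsTest U φ)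
    (j : Fin d) : Continuous (pderiv j φ) ∧ HasCompactSupport (pderiv j φ) :=
  ⟨(h.1.continuous_fderiv (by simp)).clm_apply continuous_const,
    h.2.1.fderiv_apply ℝ _⟩

/-- `H¹(Ω; ℝᵈ)`, as the space of pairs `(u, ∇u)` of `L²` functions on `Ω` in which the second is
the weak gradient of the first, with the norm `(‖u‖₂² + ‖∇u‖₂²)^(1/2)`. -/
def H1 {d : ℕ} (Ω : Set (Pt d)) : Submodule ℝ (WithLp 2 (L2 Ω (Pt d) × L2 Ω (Mat d))) where
  carrier := {u | HasWeakGrad Ω u.fst u.snd}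
  add_mem' := by
    intro a b ha hb φ hφ i j
    obtain ⟨L, hL⟩ := exists_pairing Ω i (pderiv j φ) (hφ.continuous_pderiv j).1
      (hφ.continuous_pderiv j).2
    obtain ⟨L', hL'⟩ := exists_pairing Ω (i, j) φ hφ.1.continuous hφ.2.1
    have h1 := ha φ hφ i j
    have h2 := hb φ hφ i j
    rw [← hL, ← hL'] at h1 h2 ⊢
    simp only [WithLp.add_fst, WithLp.add_snd, map_add, h1, h2]
    ring
  zero_mem' := by
    intro φ hφ i j
    obtain ⟨L, hL⟩ := exists_pairing Ω i (pderiv j φ) (hφ.continuous_pderiv j).1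
      (hφ.continuous_pderiv j).2
    obtain ⟨L', hL'⟩ := exists_pairing Ω (i, j) φ hφ.1.continuous hφ.2.1
    rw [← hL, ← hL']
    simp
  smul_mem' := by
    intro c a ha φ hφ i j
    obtain ⟨L, hL⟩ := exists_pairing Ω i (pderiv j φ) (hφ.continuous_pderiv j).1
      (hφ.continuous_pderiv j).2
    obtain ⟨L', hL'⟩ := exists_pairing Ω (i, j) φ hφ.1.continuous hφ.2.1
    have h1 := ha φ hφ i j
    rw [← hL, ← hL'] at h1 ⊢
    simp only [WithLp.smul_fst, WithLp.smul_snd, map_smul, h1]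
    simp

theorem isClosed_H1 {d : ℕ} (Ω : Set (Pt d)) :
    IsClosed (H1 Ω : Set (WithLp 2 (L2 Ω (Pt d) × L2 Ω (Mat d)))) := by
  have h : (H1 Ω : Set (WithLp 2 (L2 Ω (Pt d) × L2 Ω (Mat d)))) =
      ⋂ (φ : Pt d → ℝ) (_ : IsTest Ω φ) (i : Fin d) (j : Fin d),
        {u | ∫ x in Ω, u.fst x i * pderiv j φ x = - ∫ x in Ω, u.snd x (i, j) * φ x} := by
    ext u
    simp only [mem_iInter]
    exact Iff.rfl
  rw [h]
  refine isClosed_iInter fun φ => isClosed_iInter fun hφ => isClosed_iInter fun i =>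
    isClosed_iInter fun j => ?_
  obtain ⟨L, hL⟩ := exists_pairing Ω i (pderiv j φ) (hφ.continuous_pderiv j).1
    (hφ.continuous_pderiv j).2
  obtain ⟨L', hL'⟩ := exists_pairing Ω (i, j) φ hφ.1.continuous hφ.2.1
  simp only [← hL, ← hL']
  exact isClosed_eq (L.continuous.comp (WithLp.fstL 2 ℝ _ _).continuous)
    (L'.continuous.comp (WithLp.sndL 2 ℝ _ _).continuous).neg

instance {d : ℕ} (Ω : Set (Pt d)) : CompleteSpace (H1 Ω) :=
  (isClosed_H1 Ω).completeSpace_coe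

/-- The values of `u ∈ H¹(Ω; ℝᵈ)`. -/
def value {d : ℕ} {Ω : Set (Pt d)} (u : H1 Ω) : L2 Ω (Pt d) :=
  (u : WithLp 2 (L2 Ω (Pt d) × L2 Ω (Mat d))).fst

/-- The weak gradient of `u ∈ H¹(Ω; ℝᵈ)`. -/
def grad {d : ℕ} {Ω : Set (Pt d)} (u : H1 Ω) : L2 Ω (Mat d) :=
  (u : WithLp 2 (L2 Ω (Pt d) × L2 Ω (Mat d))).snd

/-- The linearized strain `Eu`, the symmetric part of the weak gradient. -/
def strain {d : ℕ} {Ω : Set (Pt d)} (u : H1 Ω) : L2 Ω (Msym d) :=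
  (symPart d).compLp (grad u)

/-- `f ∈ H¹_loc([0,∞); X)`: on `[0,∞)`, `f` is a primitive of a function that belongs to
`L²([0,T]; X)` for every `T > 0`. (`f` is its continuous representative; the values of `f` at
negative times play no role. For a.e. `t > 0` the time derivative of `f` is `deriv f t`.) -/
def IsH1loc {X : Type} [NormedAddCommGroup X] [NormedSpace ℝ X] (f : ℝ → X) : Prop :=
  ∃ g : ℝ → X, (∀ T : ℝ, 0 < T → MemLp g 2 (volume.restrict (Icc 0 T))) ∧
    ∀ t : ℝ, 0 ≤ t → f t = f 0 + ∫ s in (0 : ℝ)..t, g s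

/-! ### The boundary and traces -/

/-- The `(d-1)`-dimensional Hausdorff measure on `ℝᵈ`. -/
def surf (d : ℕ) : Measure (Pt d) := Measure.hausdorffMeasure ((d : ℝ) - 1)

/-- Near each boundary point, `Ω` is the strict epigraph of a Lipschitz function over a hyperplane
`ν^⊥`. -/
def HasLipschitzBoundary {d : ℕ} (Ω : Set (Pt d)) : Prop :=
  ∀ x ∈ frontier Ω, ∃ ν : Pt d, ‖ν‖ = 1 ∧ ∃ (L : ℝ≥0) (γ : ((ℝ ∙ ν)ᗮ : Submodule ℝ (Pt d)) → ℝ),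
    LipschitzWith L γ ∧ ∃ r > 0, ∀ y ∈ Metric.ball x r,
      (y ∈ Ω ↔ γ (((ℝ ∙ ν)ᗮ).orthogonalProjectionOnto y) < inner ℝ ν y)

/-- The gradient matrix `(D_j φ_i)` of a smooth vector field. -/
def gradMat {d : ℕ} (φ : Pt d → Pt d) (x : Pt d) : Mat d :=
  WithLp.toLp 2 (fun ij => fderiv ℝ φ x (EuclideanSpace.single ij.2 1) ij.1)

/-- `g ∈ L²(∂Ω; ℝᵈ)` is the trace of `u ∈ H¹(Ω; ℝᵈ)` on `∂Ω`: the traces are the continuous extension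
of the restriction operator, i.e. there are smooth `φ k` with `φ k → u` in `H¹(Ω)` and
`φ k → g` in `L²(∂Ω)`. -/
def HasTrace {d : ℕ} (Ω : Set (Pt d)) (u : H1 Ω) (g : Pt d → Pt d) : Prop :=
  MemLp g 2 ((surf d).restrict (frontier Ω)) ∧
  ∃ φ : ℕ → Pt d → Pt d, (∀ k, ContDiff ℝ ∞ (φ k)) ∧
    Tendsto (fun k => eLpNorm (fun x => φ k x - value u x) 2 (volume.restrict Ω)) atTop (𝓝 0) ∧
    Tendsto (fun k => eLpNorm (fun x => gradMat (φ k) x - grad u x) 2 (volume.restrict Ω))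
      atTop (𝓝 0) ∧
    Tendsto (fun k => eLpNorm (fun x => φ k x - g x) 2 ((surf d).restrict (frontier Ω)))
      atTop (𝓝 0)

/-- `u = w` a.e. on `Γ₀` with respect to the surface measure, in the sense of traces. -/
def TraceEqOn {d : ℕ} (Ω Γ₀ : Set (Pt d)) (u w : H1 Ω) : Prop :=
  ∃ gu gw : Pt d → Pt d, HasTrace Ω u gu ∧ HasTrace Ω w gw ∧ gu =ᵐ[(surf d).restrict Γ₀] gw

/-- `ψ = 0` a.e. on `Γ₀` with respect to the surface measure, in the sense of traces. -/
def TraceZeroOn {d : ℕ} (Ω Γ₀ : Set (Pt d)) (ψ : H1 Ω) : Prop :=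
  ∃ g : Pt d → Pt d, HasTrace Ω ψ g ∧ g =ᵐ[(surf d).restrict Γ₀] 0

/-- The duality `⟨[σ n], ψ⟩ = ⟨div σ, ψ⟩ + ⟨σ, Eψ⟩`, where `f = div σ`. -/
def normalTracePairing {d : ℕ} {Ω : Set (Pt d)} (σ : L2 Ω (Msym d)) (f : L2 Ω (Pt d))
    (ψ : H1 Ω) : ℝ :=
  inner ℝ f (value ψ) + inner ℝ σ (strain ψ)

/-! ### The two situations: Dirichlet-Neumann and Dirichlet-Periodic -/

/-- The two kinds of boundary conditions. -/
inductive BoundaryCase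
  | dirichletNeumann
  | dirichletPeriodic

/-- The open unit cube `(-1/2, 1/2)ᵈ`. -/
def cube (d : ℕ) : Set (Pt d) := {x | ∀ i, x i ∈ Ioo (-(1 / 2) : ℝ) (1 / 2)}

/-- The assumptions on the reference configuration `Ω` and the Dirichlet part `Γ₀` of its boundary
(the remaining part is `Γ₁ = ∂Ω \ Γ₀`). The first coordinate has index `0`. -/
def IsReferenceConfiguration {d : ℕ} [NeZero d] (c : BoundaryCase) (Ω Γ₀ : Set (Pt d)) : Prop :=
  match c with
  | .dirichletNeumann =>
      IsOpen Ω ∧ IsConnected Ω ∧ Bornology.IsBounded Ω ∧ HasLipschitzBoundary Ω ∧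
        IsClosed Γ₀ ∧ Γ₀ ⊆ frontier Ω ∧ 0 < surf d Γ₀
  | .dirichletPeriodic =>
      2 ≤ d ∧ Ω = cube d ∧ Γ₀ = {x | x ∈ frontier (cube d) ∧ |x 0| = 1 / 2}

/-- Periodicity with period `1` in all coordinates except the first one. -/
def IsBarPeriodic {d : ℕ} [NeZero d] {F : Type} (f : Pt d → F) : Prop :=
  ∀ i : Fin d, i ≠ 0 → ∀ x, f (x + EuclideanSpace.single i 1) = f x

/-- `f ∈ L²_loc(ℝᵈ; F)`. -/
def IsL2loc {d : ℕ} {F : Type} [NormedAddCommGroup F] (f : Pt d → F) : Prop :=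
  ∀ S : Set (Pt d), IsCompact S → MemLp f 2 ((volume : Measure (Pt d)).restrict S)

/-- `u` is the restriction to `Ω` of a periodic function (in all variables but the first) belonging
to `H¹_loc(ℝᵈ; ℝᵈ)`. -/
def IsPeriodicRestriction {d : ℕ} [NeZero d] {Ω : Set (Pt d)} (u : H1 Ω) : Prop :=
  ∃ (U : Pt d → Pt d) (G : Pt d → Mat d), IsL2loc U ∧ IsL2loc G ∧ HasWeakGrad univ U G ∧
    IsBarPeriodic U ∧ U =ᵐ[volume.restrict Ω] (value u)

/-- `(u, e, p) ∈ A(w)`: kinematic admissibility at a fixed time. -/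
structure IsAdmissible {d : ℕ} [NeZero d] (c : BoundaryCase) (Ω Γ₀ : Set (Pt d)) (w u : H1 Ω)
    (e : L2 Ω (Msym d)) (p : L2 Ω (MD d)) : Prop where
  decomposition : ∀ᵐ x ∂(volume.restrict Ω), (strain u x : Mat d) = (e x : Mat d) + (p x : Mat d)
  boundary : TraceEqOn Ω Γ₀ u w
  periodic : c = .dirichletPeriodic → IsPeriodicRestriction u

/-- Equilibrium of the stress `σ` at a fixed time. In the Dirichlet-Neumann case:
`div σ = 0` in `Ω` and `[σ n] = 0` on `Γ₁`. In the Dirichlet-Periodic case: `σ` is the restriction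
of a periodic function (in all variables but the first) which is divergence free in `ℝᵈ`. -/
def IsEquilibrium {d : ℕ} [NeZero d] (c : BoundaryCase) (Ω Γ₀ : Set (Pt d))
    (σ : L2 Ω (Msym d)) : Prop :=
  match c with
  | .dirichletNeumann =>
      HasWeakDiv Ω σ 0 ∧ ∀ ψ : H1 Ω, TraceZeroOn Ω Γ₀ ψ → normalTracePairing σ 0 ψ = 0
  | .dirichletPeriodic =>
      ∃ S : Pt d → Msym d, IsL2loc S ∧ IsBarPeriodic S ∧ HasWeakDiv univ S 0 ∧
        S =ᵐ[volume.restrict Ω] σ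

/-! ### Constitutive data -/

/-- The product Hilbert space `M_D × ℝ`. -/
abbrev StressSpace (d : ℕ) : Type := WithLp 2 (MD d × ℝ)

/-- The assumptions on the constraint set `K`. -/
structure IsYieldSet {d : ℕ} (K : Set (StressSpace d)) : Prop where
  closed : IsClosed K
  convex : Convex ℝ K
  bounds : ∃ A B : ℝ, 0 < A ∧ A ≤ B ∧
    {k : StressSpace d | ‖k.fst‖ ^ 2 + k.snd ^ 2 ≤ A ^ 2} ⊆ K ∧
    K ⊆ {k : StressSpace d | ‖k.fst‖ ^ 2 + k.snd ^ 2 ≤ B ^ 2}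
  zero_mem : ∀ k ∈ K, WithLp.toLp 2 ((0 : MD d), k.snd) ∈ K

/-- The support function `H` of `K`. -/
def supportH {d : ℕ} (K : Set (StressSpace d)) (q : StressSpace d) : ℝ :=
  ⨆ k : K, inner ℝ (k : StressSpace d) q

/-- `P_K`: the point of `K` nearest to `q` (it exists and is unique if `K` is closed, convex and
non-empty). -/
def projK {d : ℕ} (K : Set (StressSpace d)) (q : StressSpace d) : StressSpace d :=
  Classical.epsilon fun k => k ∈ K ∧ ∀ k' ∈ K, ‖q - k‖ ≤ ‖q - k'‖

/-- `N_K^ε(q) = (q - P_K q) / ε`. -/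
def flowN {d : ℕ} (K : Set (StressSpace d)) (ε : ℝ) (q : StressSpace d) : StressSpace d :=
  (1 / ε) • (q - projK K q)

/-- The assumptions on the elasticity tensor: symmetric, positive definite, and leaving the
deviatoric matrices and the multiples of the identity invariant. -/
structure IsElasticityTensor {d : ℕ} (C : Msym d →L[ℝ] Msym d) : Prop where
  symm : ∀ ξ η : Msym d, inner ℝ (C ξ) η = inner ℝ ξ (C η)
  pos : ∀ ξ : Msym d, ξ ≠ 0 → 0 < inner ℝ (C ξ) ξ
  invariant_dev : ∀ ξ : Msym d, (ξ : Mat d) ∈ MD d → (C ξ : Mat d) ∈ MD d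
  invariant_id : ∀ ξ : Msym d, (ξ : Mat d) ∈ (ℝ ∙ idMat d) → (C ξ : Mat d) ∈ (ℝ ∙ idMat d)

/-- The assumptions on the softening potential `V`, relative to `K`; here `[-a, b]` is the projection
of `K` onto `ℝ`, and `vp`, `vm` are the limits of `V'` at `+∞`, `-∞`. -/
structure IsSofteningPotential {d : ℕ} (K : Set (StressSpace d)) (V : ℝ → ℝ) : Prop where
  smooth : ContDiff ℝ 2 V
  second_deriv : ∃ M : ℝ, 0 ≤ M ∧ ∀ θ, -M ≤ deriv (deriv V) θ ∧ deriv (deriv V) θ ≤ 0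
  limits : ∃ a b vp vm : ℝ, (fun k : StressSpace d => k.snd) '' K = Icc (-a) b ∧
    Tendsto (deriv V) atTop (𝓝 vp) ∧ Tendsto (deriv V) atBot (𝓝 vm) ∧
    -b < vp ∧ vp ≤ vm ∧ vm < a

/-! ### Energies -/

/-- The stress `σ = C e`. -/
def stress {d : ℕ} {Ω : Set (Pt d)} (C : Msym d →L[ℝ] Msym d) (e : L2 Ω (Msym d)) :
    L2 Ω (Msym d) :=
  C.compLp e

/-- Stored elastic energy `∫_Ω (1/2) C e : e`. -/
def elasticEnergy {d : ℕ} {Ω : Set (Pt d)} (C : Msym d →L[ℝ] Msym d) (e : L2 Ω (Msym d)) : ℝ :=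
  ∫ x in Ω, (1 / 2) * inner ℝ (C (e x)) (e x)

/-- Dissipation functional `∫_Ω H(p, z)` on `L²`. -/
def dissipation {d : ℕ} {Ω : Set (Pt d)} (K : Set (StressSpace d)) (p : L2 Ω (MD d))
    (z : L2 Ω ℝ) : ℝ :=
  ∫ x in Ω, supportH K (WithLp.toLp 2 (p x, z x))

/-- Softening energy `∫_Ω V(z)`. -/
def softeningEnergy {d : ℕ} {Ω : Set (Pt d)} (V : ℝ → ℝ) (z : L2 Ω ℝ) : ℝ :=
  ∫ x in Ω, V (z x)

/-- The set `𝒦(Ω)` of pairs `(σ, ζ) ∈ L²(Ω; M_D) × L^∞(Ω)` with values in `K` a.e. -/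
def stressConstraintSet {d : ℕ} (Ω : Set (Pt d)) (K : Set (StressSpace d)) :
    Set ((Pt d → MD d) × (Pt d → ℝ)) :=
  {q | MemLp q.1 2 (volume.restrict Ω) ∧ MemLp q.2 ∞ (volume.restrict Ω) ∧
    ∀ᵐ x ∂(volume.restrict Ω), (WithLp.toLp 2 (q.1 x, q.2 x) : StressSpace d) ∈ K}

/-! ### The conditions on an evolution `(u, e, p, z)` -/

section Evolution

/-- Initial condition. -/
def InitialCondition {d : ℕ} {Ω : Set (Pt d)} (u₀ : H1 Ω) (e₀ : L2 Ω (Msym d)) (p₀ : L2 Ω (MD d))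
    (z₀ : L2 Ω ℝ) (u : ℝ → H1 Ω) (e : ℝ → L2 Ω (Msym d)) (p : ℝ → L2 Ω (MD d))
    (z : ℝ → L2 Ω ℝ) : Prop :=
  u 0 = u₀ ∧ e 0 = e₀ ∧ p 0 = p₀ ∧ z 0 = z₀

/-- Kinematic admissibility for every `t > 0`. -/
def KinematicAdmissibility {d : ℕ} [NeZero d] (c : BoundaryCase) {Ω : Set (Pt d)}
    (Γ₀ : Set (Pt d)) (w u : ℝ → H1 Ω) (e : ℝ → L2 Ω (Msym d)) (p : ℝ → L2 Ω (MD d)) : Prop :=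
  ∀ t : ℝ, 0 < t → IsAdmissible c Ω Γ₀ (w t) (u t) (e t) (p t)

/-- Equilibrium condition for every `t > 0`. -/
def EquilibriumCondition {d : ℕ} [NeZero d] (c : BoundaryCase) {Ω : Set (Pt d)}
    (Γ₀ : Set (Pt d)) (C : Msym d →L[ℝ] Msym d) (e : ℝ → L2 Ω (Msym d)) : Prop :=
  ∀ t : ℝ, 0 < t → IsEquilibrium c Ω Γ₀ (stress C (e t))

/-- Regularized flow rule `(ṗ, ż) = N_K^ε(σ_D, ζ)` with `σ = C e`, `ζ = -V'(z)`. -/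
def RegularizedFlowRule {d : ℕ} {Ω : Set (Pt d)} (K : Set (StressSpace d))
    (C : Msym d →L[ℝ] Msym d) (V : ℝ → ℝ) (ε : ℝ) (e : ℝ → L2 Ω (Msym d)) (p : ℝ → L2 Ω (MD d))
    (z : ℝ → L2 Ω ℝ) : Prop :=
  ∀ᵐ t ∂((volume : Measure ℝ).restrict (Ioi 0)), ∀ᵐ x ∂((volume : Measure (Pt d)).restrict Ω),
    (WithLp.toLp 2 (deriv p t x, deriv z t x) : StressSpace d) =
      flowN K ε (WithLp.toLp 2 (dev d (stress C (e t) x), -deriv V (z t x)))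

/-- Modified stress constraint `(σ_D - ε ṗ, ζ - ε ż) ∈ 𝒦(Ω)` for a.e. `t > 0`. -/
def ModifiedStressConstraint {d : ℕ} {Ω : Set (Pt d)} (K : Set (StressSpace d))
    (C : Msym d →L[ℝ] Msym d) (V : ℝ → ℝ) (ε : ℝ) (e : ℝ → L2 Ω (Msym d)) (p : ℝ → L2 Ω (MD d))
    (z : ℝ → L2 Ω ℝ) : Prop :=
  ∀ᵐ t ∂((volume : Measure ℝ).restrict (Ioi 0)),
    ((fun x => dev d (stress C (e t) x) - ε • deriv p t x,
      fun x => -deriv V (z t x) - ε * deriv z t x) : (Pt d → MD d) × (Pt d → ℝ)) ∈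
      stressConstraintSet Ω K

/-- Energy equality on `[0, T]` for every `T > 0`. -/
def EnergyEquality {d : ℕ} {Ω : Set (Pt d)} (K : Set (StressSpace d))
    (C : Msym d →L[ℝ] Msym d) (V : ℝ → ℝ) (ε : ℝ) (w : ℝ → H1 Ω) (e₀ : L2 Ω (Msym d))
    (z₀ : L2 Ω ℝ) (e : ℝ → L2 Ω (Msym d)) (p : ℝ → L2 Ω (MD d)) (z : ℝ → L2 Ω ℝ) : Prop :=
  ∀ T : ℝ, 0 < T →
    elasticEnergy C (e T) + (∫ t in (0 : ℝ)..T, dissipation K (deriv p t) (deriv z t))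
      + softeningEnergy V (z T)
      + ε * (∫ t in (0 : ℝ)..T, ‖deriv p t‖ ^ 2) + ε * (∫ t in (0 : ℝ)..T, ‖deriv z t‖ ^ 2)
    = elasticEnergy C e₀ + softeningEnergy V z₀
      + ∫ t in (0 : ℝ)..T, inner ℝ (stress C (e t)) (strain (deriv w t))

/-- `(u, e, p, z)` is a solution of the `ε`-regularized evolution problem with boundary datum `w` and
initial condition `(u₀, e₀, p₀, z₀)`. -/
structure IsRegularizedSolution {d : ℕ} [NeZero d] (c : BoundaryCase) {Ω : Set (Pt d)}
    (Γ₀ : Set (Pt d)) (K : Set (StressSpace d)) (C : Msym d →L[ℝ] Msym d) (V : ℝ → ℝ) (ε : ℝ)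
    (w : ℝ → H1 Ω) (u₀ : H1 Ω) (e₀ : L2 Ω (Msym d)) (p₀ : L2 Ω (MD d)) (z₀ : L2 Ω ℝ)
    (u : ℝ → H1 Ω) (e : ℝ → L2 Ω (Msym d)) (p : ℝ → L2 Ω (MD d)) (z : ℝ → L2 Ω ℝ) : Prop where
  regular_u : IsH1loc u
  regular_e : IsH1loc e
  regular_p : IsH1loc p
  regular_z : IsH1loc z
  initial : InitialCondition u₀ e₀ p₀ z₀ u e p z
  kinematic : KinematicAdmissibility c Γ₀ w u e p
  equilibrium : EquilibriumCondition c Γ₀ C e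
  flow : RegularizedFlowRule K C V ε e p z

end Evolution

end Plasticity

end

open Plasticity

/-!
The regularized flow rule is equivalent to the stress constraint together with the energy equality
because the energy equality measures exactly the failure of the flow rule.

*Pointwise.* For a generalized stress `q` and a rate `n`, the characterization of the projection
onto the convex set `K` by variational inequalities says that `n = (q - P_K q) / ε` if and only if
`q - ε n ∈ K` and `H(n) + ε |n|² - q : n = 0` (`eq_flowN_iff`). When `q - ε n ∈ K`, the left-hand
side of this equation, the *gap density*, is nonnegative (`dissipation_gap_nonneg`), since `H` is
the support function of `K`.

*Energy balance.* The elastic energy is a continuous quadratic form and the softening energy is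
Lipschitz and differentiable on `L²(Ω)`, because `V'` is bounded and Lipschitz. So both are
absolutely continuous along `H¹_loc` curves and obey the chain rule (`IsH1loc.integral_fderiv_comp`).
The power identity `⟨σ, ė⟩ = ⟨σ, Eẇ⟩ - ⟨σ_D, ṗ⟩` (`inner_stress_deriv`) then turns the energy
equality on `[0, T]` into the statement that the gap density has zero integral over
`Ω × (0, T)` (`energyEquality_iff`). A nonnegative function with zero integral vanishes almost
everywhere, and the two directions of the equivalence follow (`flow_iff`).

*Orthogonality.* The power identity follows by differentiating `⟨σ, E(u(s) - w(s))⟩ = 0` in `s`; so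
it requires that an equilibrated stress be orthogonal to the strains of admissible variations `ψ`
(`inner_stress_strain_eq_zero`). In the Dirichlet-Neumann case this is the definition of the
boundary condition for the stress. In the Dirichlet-Periodic case it has to be proved, for a stress
that is merely a periodic `L²_loc` field with zero distributional divergence:

* A field `ψ` whose trace vanishes on the faces `|x₀| = 1/2` can be extended by zero across them: the
  truncation of its periodic extension to the strip `|x₀| < 1/2` has the truncated gradient as its weak
  gradient (`integral_strip_mul_pderiv`). Tangential derivatives are handled by cutoffs in `x₀`. The
  derivative in `x₀` is handled by unfolding the integral to the unit cube, and applying the divergence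
  theorem there to the smooth functions that approximate `ψ`. Their boundary integrals tend to zero,
  because Lebesgue measure on a face is dominated by Hausdorff measure (`map_facePt_le`).
* A divergence free `L²_loc` field is orthogonal to the gradient of `θ v`, for a test function `θ` and
  a function `v` of class `H¹_loc` (`integral_divFree_mul_grad`). Neither factor is smooth, so consider
  the correlation `T(t) = ∑ⱼ ∫ ∂ⱼ(θ v)(x) sⱼ(x - t) dx`. It is continuous, and its average against any
  smooth kernel vanishes, because mollification produces a smooth divergence free field; hence
  `T(0) = 0`.
* With `θ` from a partition of unity whose lattice translates in the periodic directions add up to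
  one on the cube, the integral over `ℝᵈ` folds up to the integral over the cube, and the terms with
  derivatives of `θ` cancel (`integral_cube_divFree_mul_grad`).
-/

namespace Plasticity

/-! ### Functions of time in `H¹_loc([0,∞); X)` -/

theorem _root_.AbsolutelyContinuousOnInterval.of_dist_le {X Y : Type*} [PseudoMetricSpace X]
    [PseudoMetricSpace Y] {f : ℝ → X} {F : ℝ → Y} {a b C : ℝ} (hC : 0 < C)
    (hF : AbsolutelyContinuousOnInterval F a b)
    (h : ∀ x ∈ uIcc a b, ∀ y ∈ uIcc a b, dist (f x) (f y) ≤ C * dist (F x) (F y)) :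
    AbsolutelyContinuousOnInterval f a b := by
  rw [absolutelyContinuousOnInterval_iff] at hF ⊢
  intro η hη
  obtain ⟨δ, hδ, H⟩ := hF (η / C) (by positivity)
  refine ⟨δ, hδ, fun E hE hlt => ?_⟩
  have hs := H E hE hlt
  calc _ ≤ ∑ i ∈ Finset.range E.1, C * dist (F (E.2 i).1) (F (E.2 i).2) :=
        Finset.sum_le_sum fun i hi => h _ (hE.left i hi).left _ (hE.left i hi).right
    _ = C * ∑ i ∈ Finset.range E.1, dist (F (E.2 i).1) (F (E.2 i).2) := by
        rw [Finset.mul_sum]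
    _ < η := by rwa [lt_div_iff₀ hC, mul_comm] at hs

theorem integrableOn_of_memLp_two {X : Type*} [NormedAddCommGroup X] {g : ℝ → X} {T : ℝ}
    (hg : MemLp g 2 (volume.restrict (Icc 0 T))) : IntegrableOn g (Icc 0 T) :=
  hg.integrable (by norm_num)

section Time

variable {X : Type} [NormedAddCommGroup X] [NormedSpace ℝ X] {f : ℝ → X}

theorem ae_Ioi_of_forall_Ioo {P : ℝ → Prop}
    (h : ∀ T : ℝ, 0 < T → ∀ᵐ t, t ∈ Ioo 0 T → P t) : ∀ᵐ t ∂(volume.restrict (Ioi (0 : ℝ))), P t := by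
  rw [ae_restrict_iff' measurableSet_Ioi]
  have hn : ∀ᵐ t : ℝ, ∀ n : ℕ, t ∈ Ioo (0 : ℝ) ((n : ℝ) + 1) → P t :=
    ae_all_iff.2 fun n => h _ (by positivity)
  filter_upwards [hn] with t ht h0
  obtain ⟨n, hn⟩ := exists_nat_gt t
  exact ht n ⟨h0, by linarith⟩

theorem ae_Icc_of_ae_Ioi {P : ℝ → Prop} (h : ∀ᵐ t ∂(volume.restrict (Ioi (0 : ℝ))), P t) (T : ℝ) :
    ∀ᵐ t ∂(volume.restrict (Icc (0 : ℝ) T)), P t := by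
  rw [← restrict_Ioc_eq_restrict_Icc]
  exact ae_restrict_of_ae_restrict_of_subset Ioc_subset_Ioi_self h

variable [CompleteSpace X]

theorem IsH1loc.exists_primitive (hf : IsH1loc f) :
    ∃ g : ℝ → X, (∀ T : ℝ, 0 < T → MemLp g 2 (volume.restrict (Icc 0 T))) ∧
      (∀ t : ℝ, 0 ≤ t → f t = f 0 + ∫ s in (0 : ℝ)..t, g s) ∧
      ∀ᵐ t ∂(volume.restrict (Ioi (0 : ℝ))), HasDerivAt f (g t) t := by
  obtain ⟨g, hg, hfg⟩ := hf
  refine ⟨g, hg, hfg, ae_Ioi_of_forall_Ioo fun T hT => ?_⟩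
  have hi : IntervalIntegrable g volume 0 T := by
    rw [intervalIntegrable_iff_integrableOn_Icc_of_le hT.le]
    exact integrableOn_of_memLp_two (hg T hT)
  filter_upwards [hi.ae_hasDerivAt_integral] with t ht htT
  have h1 := ht (by rw [uIcc_of_le hT.le]; exact ⟨htT.1.le, htT.2.le⟩) 0 left_mem_uIcc
  refine (h1.const_add (f 0)).congr_of_eventuallyEq ?_
  filter_upwards [Ioi_mem_nhds htT.1] with s hs
  exact hfg s hs.le

theorem IsH1loc.ae_hasDerivAt (hf : IsH1loc f) :
    ∀ᵐ t ∂(volume.restrict (Ioi (0 : ℝ))), HasDerivAt f (deriv f t) t := by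
  obtain ⟨g, -, -, h⟩ := hf.exists_primitive
  filter_upwards [h] with t ht
  rwa [ht.deriv]

theorem IsH1loc.memLp_deriv (hf : IsH1loc f) (T : ℝ) :
    MemLp (deriv f) 2 (volume.restrict (Icc 0 T)) := by
  obtain ⟨g, hg, -, h⟩ := hf.exists_primitive
  have h2 : MemLp (deriv f) 2 (volume.restrict (Icc 0 (max T 1))) := by
    refine (memLp_congr_ae ?_).2 (hg (max T 1) (by positivity))
    filter_upwards [ae_Icc_of_ae_Ioi h _] with t ht using ht.deriv
  exact h2.mono_measure (Measure.restrict_mono (Icc_subset_Icc_right (le_max_left _ _)) le_rfl)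

theorem IsH1loc.eq_add_integral_deriv (hf : IsH1loc f) {t : ℝ} (ht : 0 ≤ t) :
    f t = f 0 + ∫ s in (0 : ℝ)..t, deriv f s := by
  obtain ⟨g, -, hfg, h⟩ := hf.exists_primitive
  rw [hfg t ht]
  congr 1
  refine intervalIntegral.integral_congr_ae_restrict ?_
  rw [uIoc_of_le ht, restrict_Ioc_eq_restrict_Icc]
  filter_upwards [ae_Icc_of_ae_Ioi h t] with s hs using hs.deriv.symm

theorem IsH1loc.intervalIntegrable_deriv (hf : IsH1loc f) {a b : ℝ} (ha : 0 ≤ a) (hb : 0 ≤ b) :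
    IntervalIntegrable (deriv f) volume a b := by
  have h := integrableOn_of_memLp_two (hf.memLp_deriv (max a b))
  rw [intervalIntegrable_iff]
  refine h.mono_set fun t ht => ?_
  rw [uIoc, mem_Ioc] at ht
  exact ⟨(le_min ha hb).trans ht.1.le, ht.2⟩

theorem IsH1loc.dist_le (hf : IsH1loc f) {s t : ℝ} (hs : 0 ≤ s) (ht : 0 ≤ t) :
    dist (f s) (f t) ≤
      dist (∫ r in (0 : ℝ)..s, ‖deriv f r‖) (∫ r in (0 : ℝ)..t, ‖deriv f r‖) := by
  have h1 := hf.intervalIntegrable_deriv le_rfl hs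
  have h2 := hf.intervalIntegrable_deriv le_rfl ht
  rw [hf.eq_add_integral_deriv hs, hf.eq_add_integral_deriv ht, dist_add_left, dist_eq_norm,
    dist_eq_norm, intervalIntegral.integral_interval_sub_left h1 h2,
    intervalIntegral.integral_interval_sub_left h1.norm h2.norm]
  exact intervalIntegral.norm_integral_le_abs_integral_norm

theorem IsH1loc.continuousOn (hf : IsH1loc f) (T : ℝ) : ContinuousOn f (Icc 0 T) := by
  rcases le_or_gt 0 T with hT | hT
  · have h := (hf.intervalIntegrable_deriv le_rfl hT)
    have hc := intervalIntegral.continuousOn_primitive_interval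
      (μ := volume) (f := deriv f) (a := 0) (b := T)
      ((intervalIntegrable_iff_integrableOn_Icc_of_le hT).1 h |>.mono_set (by rw [uIcc_of_le hT]))
    rw [uIcc_of_le hT] at hc
    exact (continuousOn_const.add hc).congr fun t ht => hf.eq_add_integral_deriv ht.1
  · simp [Icc_eq_empty (not_le.2 hT)]

/-- The chain rule along an `H¹_loc` curve: a function of the curve that is differentiable and
Lipschitz on bounded sets is absolutely continuous in time, hence the integral of its derivative. -/
theorem IsH1loc.integral_fderiv_comp (hf : IsH1loc f) {E : X → ℝ} {E' : X → X →L[ℝ] ℝ}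
    (hE : ∀ x, HasFDerivAt E (E' x) x)
    (hL : ∀ R : ℝ, ∃ L : ℝ, ∀ x y : X, ‖x‖ ≤ R → ‖y‖ ≤ R → |E x - E y| ≤ L * ‖x - y‖)
    {T : ℝ} (hT : 0 ≤ T) :
    IntervalIntegrable (fun t => E' (f t) (deriv f t)) volume 0 T ∧
    ∫ t in (0 : ℝ)..T, E' (f t) (deriv f t) = E (f T) - E (f 0) := by
  obtain ⟨R, hR⟩ := isCompact_Icc.exists_bound_of_continuousOn (hf.continuousOn T)
  obtain ⟨L, hL⟩ := hL R
  have hac : AbsolutelyContinuousOnInterval (fun t => E (f t)) 0 T := by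
    have hF := (hf.intervalIntegrable_deriv le_rfl hT).norm
      |>.absolutelyContinuousOnInterval_intervalIntegral (c := 0) left_mem_uIcc
    refine hF.of_dist_le (C := |L| + 1) (by positivity) fun s hs t ht => ?_
    rw [uIcc_of_le hT] at hs ht
    calc dist (E (f s)) (E (f t)) ≤ L * ‖f s - f t‖ := hL _ _ (hR s hs) (hR t ht)
      _ ≤ (|L| + 1) * dist (f s) (f t) := by
        rw [dist_eq_norm]
        gcongr
        linarith [le_abs_self L]
      _ ≤ _ := by gcongr; exact hf.dist_le hs.1 ht.1
  have hd : ∀ᵐ t ∂(volume.restrict (Icc 0 T)),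
      deriv (fun t => E (f t)) t = E' (f t) (deriv f t) := by
    filter_upwards [ae_Icc_of_ae_Ioi hf.ae_hasDerivAt T] with t ht
    exact ((hE (f t)).comp_hasDerivAt t ht).deriv
  constructor
  · refine hac.intervalIntegrable_deriv.congr_ae ?_
    rw [uIoc_of_le hT, restrict_Ioc_eq_restrict_Icc]
    exact hd
  · rw [← hac.integral_deriv_eq_sub]
    refine intervalIntegral.integral_congr_ae_restrict ?_
    rw [uIoc_of_le hT, restrict_Ioc_eq_restrict_Icc]
    filter_upwards [hd] with t ht using ht.symm

end Time

/-! ### The projection onto `K` and its support function -/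

section Convex

variable {d : ℕ} {K : Set (StressSpace d)}

theorem IsYieldSet.nonempty (hK : IsYieldSet K) : K.Nonempty := by
  obtain ⟨A, B, hA, -, h, -⟩ := hK.bounds
  exact ⟨0, h (by simp [sq_nonneg])⟩

theorem norm_sq_stressSpace (k : StressSpace d) : ‖k‖ ^ 2 = ‖k.fst‖ ^ 2 + k.snd ^ 2 := by
  rw [WithLp.prod_norm_sq_eq_of_L2]
  simp

theorem inner_smul_stressSpace (r : ℝ) (x y : StressSpace d) :
    inner ℝ (r • x) y = r * inner ℝ x y :=
  real_inner_smul_left x y r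

theorem IsYieldSet.exists_bound (hK : IsYieldSet K) : ∃ B : ℝ, 0 < B ∧ ∀ k ∈ K, ‖k‖ ≤ B := by
  obtain ⟨A, B, hA, hAB, -, h⟩ := hK.bounds
  refine ⟨B, hA.trans_le hAB, fun k hk => ?_⟩
  have := h hk
  rw [mem_ofPred_eq, ← norm_sq_stressSpace] at this
  exact le_of_sq_le_sq this (hA.trans_le hAB).le

theorem IsYieldSet.zero_mem' (hK : IsYieldSet K) : (0 : StressSpace d) ∈ K := by
  obtain ⟨A, B, hA, -, h, -⟩ := hK.bounds
  exact h (by simp [sq_nonneg])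

theorem projK_spec (hK : IsYieldSet K) (q : StressSpace d) :
    projK K q ∈ K ∧ ∀ k' ∈ K, ‖q - projK K q‖ ≤ ‖q - k'‖ := by
  refine Classical.epsilon_spec (p := fun k => k ∈ K ∧ ∀ k' ∈ K, ‖q - k‖ ≤ ‖q - k'‖) ?_
  obtain ⟨k, hk, h⟩ := exists_norm_eq_iInf_of_complete_convex hK.nonempty
    hK.closed.isComplete hK.convex q
  refine ⟨k, hk, fun k' hk' => ?_⟩
  rw [h]
  exact ciInf_le ⟨0, by rintro _ ⟨_, rfl⟩; positivity⟩ (⟨k', hk'⟩ : K)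

theorem inner_sub_projK_nonpos (hK : IsYieldSet K) (q : StressSpace d) :
    ∀ k ∈ K, inner ℝ (q - projK K q) (k - projK K q) ≤ 0 := by
  obtain ⟨h1, h2⟩ := projK_spec hK q
  refine (norm_eq_iInf_iff_real_inner_le_zero hK.convex h1).1 ?_
  have : Nonempty K := ⟨⟨_, h1⟩⟩
  refine le_antisymm (le_ciInf fun k => h2 k k.2) ?_
  exact ciInf_le ⟨0, by rintro _ ⟨_, rfl⟩; positivity⟩ (⟨_, h1⟩ : K)

theorem projK_eq_of_inner_nonpos (hK : IsYieldSet K) {q k : StressSpace d} (hk : k ∈ K)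
    (h : ∀ k' ∈ K, inner ℝ (q - k) (k' - k) ≤ 0) : projK K q = k := by
  have h1 := h _ (projK_spec hK q).1
  have h2 := inner_sub_projK_nonpos hK q k hk
  have h3 : inner ℝ (projK K q - k) (projK K q - k) ≤ (0 : ℝ) := by
    have e1 : inner ℝ (q - projK K q) (k - projK K q)
        = - inner ℝ (q - projK K q) (projK K q - k) := by rw [← inner_neg_right, neg_sub]
    have e2 : (projK K q - k : StressSpace d) = (q - k) - (q - projK K q) := by abel
    rw [e1] at h2
    nth_rw 1 [e2]
    rw [inner_sub_left]
    linarith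
  exact sub_eq_zero.1 (real_inner_self_nonpos.1 h3)

theorem bddAbove_supportH (hK : IsYieldSet K) (q : StressSpace d) :
    BddAbove (range fun k : K => inner ℝ (k : StressSpace d) q) := by
  obtain ⟨B, hB, h⟩ := hK.exists_bound
  refine ⟨B * ‖q‖, ?_⟩
  rintro _ ⟨k, rfl⟩
  exact (real_inner_le_norm _ _).trans (by gcongr; exact h k k.2)

theorem inner_le_supportH (hK : IsYieldSet K) {k : StressSpace d} (hk : k ∈ K)
    (q : StressSpace d) : inner ℝ k q ≤ supportH K q :=
  le_ciSup (bddAbove_supportH hK q) (⟨k, hk⟩ : K)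

theorem supportH_le (hK : IsYieldSet K) {q : StressSpace d} {c : ℝ}
    (h : ∀ k ∈ K, inner ℝ k q ≤ c) : supportH K q ≤ c := by
  have : Nonempty K := hK.nonempty.to_subtype
  exact ciSup_le fun k => h k k.2

theorem exists_lipschitzWith_supportH (hK : IsYieldSet K) :
    ∃ B : ℝ≥0, LipschitzWith B (supportH K) := by
  obtain ⟨B, hB, h⟩ := hK.exists_bound
  refine ⟨B.toNNReal, LipschitzWith.of_le_add_mul _ fun q r => ?_⟩
  refine supportH_le hK fun k hk => ?_
  have e : inner ℝ k q = inner ℝ k r + inner ℝ k (q - r) := by rw [← inner_add_right]; simp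
  rw [e, Real.coe_toNNReal _ hB.le, dist_eq_norm]
  refine add_le_add (inner_le_supportH hK hk r) ((real_inner_le_norm _ _).trans ?_)
  gcongr
  exact h k hk

theorem supportH_zero (hK : IsYieldSet K) : supportH K 0 = 0 :=
  le_antisymm (supportH_le hK fun k _ => by simp) (by
    simpa using inner_le_supportH hK hK.zero_mem' 0)

/-- Under the stress constraint the local dissipation inequality holds. -/
theorem dissipation_gap_nonneg (hK : IsYieldSet K) {ε : ℝ} {q n : StressSpace d}
    (h : q - ε • n ∈ K) : 0 ≤ supportH K n + ε * ‖n‖ ^ 2 - inner ℝ q n := by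
  have := inner_le_supportH hK h n
  rw [inner_sub_left, inner_smul_stressSpace, real_inner_self_eq_norm_sq] at this
  linarith

/-- The flow rule holds exactly when the stress constraint holds and `q - εn` maximizes the
dissipation. -/
theorem eq_flowN_iff (hK : IsYieldSet K) {ε : ℝ} (hε : 0 < ε) {q n : StressSpace d} :
    n = flowN K ε q ↔
      q - ε • n ∈ K ∧ supportH K n + ε * ‖n‖ ^ 2 - inner ℝ q n = 0 := by
  constructor
  · intro h
    have hp : q - ε • n = projK K q := by
      rw [h, flowN, smul_smul, mul_one_div_cancel hε.ne', one_smul, sub_sub_cancel]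
    have hk : q - ε • n ∈ K := hp ▸ (projK_spec hK q).1
    refine ⟨hk, le_antisymm ?_ (dissipation_gap_nonneg hK hk)⟩
    have : supportH K n ≤ inner ℝ (q - ε • n) n := by
      refine supportH_le hK fun k hk' => ?_
      have h1 := inner_sub_projK_nonpos hK q k hk'
      rw [← hp, sub_sub_cancel, inner_smul_stressSpace] at h1
      have h2 : inner ℝ n (k - (q - ε • n)) ≤ 0 := nonpos_of_mul_nonpos_right h1 hε
      rw [real_inner_comm, inner_sub_left] at h2
      linarith
    rw [inner_sub_left, inner_smul_stressSpace, real_inner_self_eq_norm_sq] at this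
    linarith
  · rintro ⟨hk, h0⟩
    have hp : projK K q = q - ε • n := by
      refine projK_eq_of_inner_nonpos hK hk fun k hk' => ?_
      have h1 := inner_le_supportH hK hk' n
      rw [sub_sub_cancel, inner_smul_stressSpace]
      refine mul_nonpos_of_nonneg_of_nonpos hε.le ?_
      rw [real_inner_comm, inner_sub_left, inner_sub_left, inner_smul_stressSpace,
        real_inner_self_eq_norm_sq]
      linarith
    rw [flowN, hp, sub_sub_cancel, smul_smul, one_div_mul_cancel hε.ne', one_smul]

end Convex

end Plasticity

noncomputable section

namespace Plasticity

/-! ### The operators of the problem on `L²(Ω)` -/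

section Operators

variable {d : ℕ} {Ω : Set (Pt d)}

/-- Bounded operators between normed spaces, with the module structures read off from the norms.
(On spaces built from `M_sym` and `M_D` these structures agree with the ones that are inferred
directly only after unfolding.) -/
abbrev BoundedOp (X Y : Type) [NormedAddCommGroup X] [NormedSpace ℝ X] [NormedAddCommGroup Y]
    [NormedSpace ℝ Y] : Type :=
  X →L[ℝ] Y

/-- The linearized strain as a bounded operator from `H¹(Ω; ℝᵈ)` to `L²(Ω; M_sym)`. -/
def strainL (Ω : Set (Pt d)) : BoundedOp (H1 Ω) (L2 Ω (Msym d)) :=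
  ContinuousLinearMap.comp (M₂ := L2 Ω (Mat d))
    ((symPart d : BoundedOp (Mat d) (Msym d)).compLpL 2 (volume.restrict Ω))
    ((WithLp.sndL 2 ℝ (L2 Ω (Pt d)) (L2 Ω (Mat d))).comp (H1 Ω).subtypeL)

theorem MD_le_Msym (d : ℕ) : MD d ≤ Msym d := fun _ h => h.1

/-- The inclusion of `M_D` into `M_sym`. -/
def inclMD (d : ℕ) : BoundedOp (MD d) (Msym d) :=
  LinearMap.toContinuousLinearMap (Submodule.inclusion (MD_le_Msym d))

/-- The inclusion of `L²(Ω; M_D)` into `L²(Ω; M_sym)`. -/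
def inclL (Ω : Set (Pt d)) : BoundedOp (L2 Ω (MD d)) (L2 Ω (Msym d)) :=
  (inclMD d).compLpL 2 (volume.restrict Ω)

theorem coeFn_inclL (p : L2 Ω (MD d)) :
    ∀ᵐ x ∂(volume.restrict Ω), ((inclL Ω p x : Msym d) : Mat d) = (p x : Mat d) := by
  filter_upwards [(inclMD d).coeFn_compLp p] with x hx
  exact congrArg (fun ξ : Msym d => (ξ : Mat d)) hx

theorem inner_idMat (q : Mat d) : inner ℝ (idMat d) q = ∑ i, q (i, i) := by
  rw [PiLp.inner_apply, Fintype.sum_prod_type]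
  refine Finset.sum_congr rfl fun i _ => ?_
  simp [idMat]

theorem inner_dev (ξ : Msym d) (q : MD d) :
    inner ℝ (ξ : Mat d) (q : Mat d) = inner ℝ (dev d ξ) q := by
  have h : ((dev d ξ : MD d) : Mat d)
      = (ξ : Mat d) - (if d = 1 then (0 : ℝ) else (∑ i, (ξ : Mat d) (i, i)) / d) • idMat d := rfl
  rw [Submodule.coe_inner, h, inner_sub_left, real_inner_smul_left, inner_idMat]
  rcases Nat.lt_or_ge d 2 with h2 | h2
  · interval_cases d
    · simp
    · simp
  · rw [q.2.2 h2]
    simp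

/-- The deviator as a bounded operator from `L²(Ω; M_sym)` to `L²(Ω; M_D)`. -/
def devL (Ω : Set (Pt d)) : BoundedOp (L2 Ω (Msym d)) (L2 Ω (MD d)) :=
  (dev d : BoundedOp (Msym d) (MD d)).compLpL 2 (volume.restrict Ω)

theorem coeFn_devL (σ : L2 Ω (Msym d)) :
    ∀ᵐ x ∂(volume.restrict Ω), devL Ω σ x = dev d (σ x) := by
  filter_upwards [(dev d).coeFn_compLp σ] with x hx
  exact hx

theorem inner_inclL (σ : L2 Ω (Msym d)) (p : L2 Ω (MD d)) :
    inner ℝ σ (inclL Ω p) = inner ℝ (devL Ω σ) p := by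
  rw [L2.inner_def, L2.inner_def]
  refine integral_congr_ae ?_
  filter_upwards [coeFn_inclL p, coeFn_devL σ] with x h1 h2
  rw [h2, ← inner_dev, ← h1, Submodule.coe_inner]

/-- Additive decomposition of the strain, as an identity in `L²(Ω; M_sym)`. -/
theorem IsAdmissible.strain_eq [NeZero d] {c : BoundaryCase} {Γ₀ : Set (Pt d)} {w u : H1 Ω}
    {e : L2 Ω (Msym d)} {p : L2 Ω (MD d)} (h : IsAdmissible c Ω Γ₀ w u e p) :
    strain u = e + inclL Ω p := by
  refine Lp.ext ?_
  filter_upwards [h.decomposition, Lp.coeFn_add e (inclL Ω p), coeFn_inclL p] with x h1 h2 h3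
  rw [h2, Pi.add_apply, Subtype.ext_iff, h1, Submodule.coe_add, h3]

/-- The stress as a bounded operator on `L²(Ω; M_sym)`. -/
def stressL (Ω : Set (Pt d)) (C : Msym d →L[ℝ] Msym d) :
    BoundedOp (L2 Ω (Msym d)) (L2 Ω (Msym d)) :=
  (C : BoundedOp (Msym d) (Msym d)).compLpL 2 (volume.restrict Ω)

/-- The pairing with a stress field, as a bounded functional on `L²(Ω; M_sym)`. -/
def pairL (σ : L2 Ω (Msym d)) : BoundedOp (L2 Ω (Msym d)) ℝ :=
  innerSL ℝ σ

end Operators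

/-! ### Differentiability of the stored energies -/

section Energies

variable {d : ℕ} {Ω : Set (Pt d)}

/-- A quadratic bound on the remainder gives the Fréchet derivative. -/
theorem hasFDerivAt_of_quadratic_remainder {X : Type*} [NormedAddCommGroup X] [NormedSpace ℝ X]
    {E : X → ℝ} {E' : X →L[ℝ] ℝ} {x : X} {M : ℝ}
    (h : ∀ y, |E (x + y) - E x - E' y| ≤ M * ‖y‖ ^ 2) : HasFDerivAt E E' x := by
  rw [hasFDerivAt_iff_isLittleO_nhds_zero]
  refine Asymptotics.IsBigO.trans_isLittleO (g := fun y : X => ‖y‖ ^ 2) ?_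
    (Asymptotics.isLittleO_norm_pow_id one_lt_two)
  refine Asymptotics.IsBigO.of_bound M (Eventually.of_forall fun y => ?_)
  simpa using h y

/-- The derivative of a quadratic form, and its Lipschitz bound on bounded sets. -/
theorem hasFDerivAt_half_inner {X : Type*} [NormedAddCommGroup X] [InnerProductSpace ℝ X]
    {S : X →L[ℝ] X} (hS : ∀ x y, inner ℝ (S x) y = inner ℝ (S y) x) {E : X → ℝ}
    (hE : ∀ x, E x = (1 / 2) * inner ℝ (S x) x) :
    (∀ x, HasFDerivAt E (innerSL ℝ (S x)) x) ∧
    ∀ R : ℝ, ∃ L : ℝ, ∀ x y : X, ‖x‖ ≤ R → ‖y‖ ≤ R → |E x - E y| ≤ L * ‖x - y‖ := by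
  have hb : ∀ x y, |inner ℝ (S x) y| ≤ ‖S‖ * ‖x‖ * ‖y‖ := fun x y =>
    (abs_real_inner_le_norm _ _).trans (by gcongr; exact S.le_opNorm x)
  constructor
  · intro x
    refine hasFDerivAt_of_quadratic_remainder (M := ‖S‖) fun y => ?_
    have e1 : E (x + y) - E x - innerSL ℝ (S x) y = (1 / 2) * inner ℝ (S y) y := by
      simp only [hE, map_add, inner_add_left, inner_add_right, hS y x, innerSL_apply_apply]
      ring
    rw [e1, abs_mul, abs_of_pos (by norm_num : (0 : ℝ) < 1 / 2)]
    have := hb y y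
    have := abs_nonneg (inner ℝ (S y) y)
    nlinarith
  · intro R
    refine ⟨‖S‖ * R, fun x y hx hy => ?_⟩
    have e1 : E x - E y = (1 / 2) * inner ℝ (S (x + y)) (x - y) := by
      simp only [hE, map_add, inner_add_left, inner_sub_right, hS y x]
      ring
    rw [e1, abs_mul, abs_of_pos (by norm_num : (0 : ℝ) < 1 / 2)]
    have h1 := hb (x + y) (x - y)
    have h2 : ‖x + y‖ ≤ 2 * R := (norm_add_le _ _).trans (by linarith)
    have h3 : ‖S‖ * ‖x + y‖ * ‖x - y‖ ≤ ‖S‖ * (2 * R) * ‖x - y‖ := by gcongr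
    linarith

/-- The chain rule for a quadratic form along an `H¹_loc` curve. -/
theorem IsH1loc.integral_quadratic {X : Type} [NormedAddCommGroup X] [InnerProductSpace ℝ X]
    [CompleteSpace X] {f : ℝ → X} (hf : IsH1loc f)
    {S : X →L[ℝ] X} (hS : ∀ x y, inner ℝ (S x) y = inner ℝ (S y) x) {E : X → ℝ}
    (hE : ∀ x, E x = (1 / 2) * inner ℝ (S x) x) {T : ℝ} (hT : 0 ≤ T) :
    IntervalIntegrable (fun t => inner ℝ (S (f t)) (deriv f t)) volume 0 T ∧
    ∫ t in (0 : ℝ)..T, inner ℝ (S (f t)) (deriv f t) = E (f T) - E (f 0) :=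
  hf.integral_fderiv_comp (hasFDerivAt_half_inner hS hE).1 (hasFDerivAt_half_inner hS hE).2 hT

theorem integral_half_inner_eq {α F : Type} [MeasurableSpace α] {μ : Measure α} [NormedAddCommGroup F]
    [InnerProductSpace ℝ F] (C : F →L[ℝ] F) (e : Lp F 2 μ) :
    ∫ x, (1 / 2) * inner ℝ (C (e x)) (e x) ∂μ = (1 / 2) * inner ℝ (C.compLpL 2 μ e) e := by
  rw [L2.inner_def, ← integral_const_mul]
  refine integral_congr_ae ?_
  filter_upwards [C.coeFn_compLpL e] with x hx
  rw [hx]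

theorem inner_compLpL_comm {α F : Type} [MeasurableSpace α] {μ : Measure α} [NormedAddCommGroup F]
    [InnerProductSpace ℝ F] {C : F →L[ℝ] F} (hC : ∀ ξ η : F, inner ℝ (C ξ) η = inner ℝ ξ (C η))
    (e f : Lp F 2 μ) : inner ℝ (C.compLpL 2 μ e) f = inner ℝ (C.compLpL 2 μ f) e := by
  rw [L2.inner_def, L2.inner_def]
  refine integral_congr_ae ?_
  filter_upwards [C.coeFn_compLpL e, C.coeFn_compLpL f] with x h1 h2
  rw [h1, h2, hC, real_inner_comm]

theorem IsH1loc.integral_compLpL {α F : Type} [MeasurableSpace α] {μ : Measure α}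
    [NormedAddCommGroup F] [InnerProductSpace ℝ F] [CompleteSpace F]
    {C : F →L[ℝ] F} (hC : ∀ ξ η : F, inner ℝ (C ξ) η = inner ℝ ξ (C η))
    {e : ℝ → Lp F 2 μ} (he : IsH1loc e) {T : ℝ} (hT : 0 ≤ T) :
    IntervalIntegrable (fun t => inner ℝ (C.compLp (e t)) (deriv e t)) volume 0 T ∧
    ∫ t in (0 : ℝ)..T, inner ℝ (C.compLp (e t)) (deriv e t)
      = (∫ x, (1 / 2) * inner ℝ (C (e T x)) (e T x) ∂μ)
        - ∫ x, (1 / 2) * inner ℝ (C (e 0 x)) (e 0 x) ∂μ :=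
  he.integral_quadratic (S := C.compLpL 2 μ) (inner_compLpL_comm hC) (integral_half_inner_eq C) hT

theorem IsH1loc.integral_stress {C : Msym d →L[ℝ] Msym d} (hC : IsElasticityTensor C)
    {e : ℝ → L2 Ω (Msym d)} (he : IsH1loc e) {T : ℝ} (hT : 0 ≤ T) :
    IntervalIntegrable (fun t => inner ℝ (stress C (e t)) (deriv e t)) volume 0 T ∧
    ∫ t in (0 : ℝ)..T, inner ℝ (stress C (e t)) (deriv e t)
      = elasticEnergy C (e T) - elasticEnergy C (e 0) :=
  IsH1loc.integral_compLpL (F := Msym d) hC.symm he hT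

variable {K : Set (StressSpace d)} {V : ℝ → ℝ}

theorem IsSofteningPotential.differentiable (hV : IsSofteningPotential K V) :
    Differentiable ℝ V := hV.smooth.differentiable (by norm_num)

theorem IsSofteningPotential.contDiff_deriv (hV : IsSofteningPotential K V) :
    ContDiff ℝ 1 (deriv V) := by
  have h : ContDiff ℝ (1 + 1) V := by
    rw [one_add_one_eq_two]
    exact hV.smooth
  exact (contDiff_succ_iff_deriv.1 h).2.2

theorem IsSofteningPotential.exists_bound_deriv (hV : IsSofteningPotential K V) :
    ∃ B : ℝ, 0 ≤ B ∧ ∀ θ, |deriv V θ| ≤ B := by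
  obtain ⟨M, hM, h2⟩ := hV.second_deriv
  obtain ⟨a, b, vp, vm, -, hp, hm, -⟩ := hV.limits
  have hanti : Antitone (deriv V) :=
    antitone_of_deriv_nonpos (hV.contDiff_deriv.differentiable (by norm_num)) fun x => (h2 x).2
  refine ⟨max |vp| |vm|, by positivity, fun θ => ?_⟩
  have h3 := hanti.le_of_tendsto hp θ
  have h4 := hanti.ge_of_tendsto hm θ
  rw [max_comm]
  exact abs_le_max_abs_abs h3 h4 |>.trans (max_comm _ _).le

theorem IsSofteningPotential.exists_lipschitz_deriv (hV : IsSofteningPotential K V) :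
    ∃ M : ℝ, 0 ≤ M ∧ ∀ θ θ', |deriv V θ' - deriv V θ| ≤ M * |θ' - θ| := by
  obtain ⟨M, hM, h2⟩ := hV.second_deriv
  refine ⟨M, hM, fun θ θ' => ?_⟩
  refine convex_univ.norm_image_sub_le_of_norm_deriv_le (𝕜 := ℝ)
    (fun x _ => hV.contDiff_deriv.differentiable (by norm_num) x) (fun x _ => ?_)
    (mem_univ θ) (mem_univ θ')
  rw [Real.norm_eq_abs, abs_le]
  exact ⟨(h2 x).1, (h2 x).2.trans hM⟩

theorem IsSofteningPotential.exists_taylor (hV : IsSofteningPotential K V) :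
    ∃ M : ℝ, 0 ≤ M ∧ ∀ θ h, |V (θ + h) - V θ - deriv V θ * h| ≤ M * h ^ 2 := by
  obtain ⟨M, hM, hL⟩ := hV.exists_lipschitz_deriv
  refine ⟨M, hM, fun θ h => ?_⟩
  -- the mean value inequality for `s ↦ V s - V' θ * s` on the segment from `θ` to `θ + h`
  have hd : ∀ s, HasDerivAt (fun s => V s - deriv V θ * s) (deriv V s - deriv V θ) s := fun s => by
    have := (hasDerivAt_id s).const_mul (deriv V θ)
    rw [mul_one] at this
    exact (hV.differentiable s).hasDerivAt.sub this
  have hb := (convex_uIcc θ (θ + h)).norm_image_sub_le_of_norm_hasDerivWithin_le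
    (C := M * |h|) (fun s _ => (hd s).hasDerivWithinAt) (fun s hs => by
      have := abs_sub_left_of_mem_uIcc hs
      rw [add_sub_cancel_left] at this
      exact (hL θ s).trans (mul_le_mul_of_nonneg_left this hM)) left_mem_uIcc right_mem_uIcc
  rw [Real.norm_eq_abs, Real.norm_eq_abs, add_sub_cancel_left, mul_assoc, ← abs_mul,
    abs_mul_self] at hb
  calc _ = |V (θ + h) - deriv V θ * (θ + h) - (V θ - deriv V θ * θ)| := by congr 1; ring
    _ ≤ _ := by rwa [sq]

theorem IsSofteningPotential.abs_sub_le (hV : IsSofteningPotential K V) :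
    ∃ B : ℝ, 0 ≤ B ∧ ∀ θ θ', |V θ' - V θ| ≤ B * |θ' - θ| := by
  obtain ⟨B, hB, h⟩ := hV.exists_bound_deriv
  exact ⟨B, hB, fun θ θ' => convex_univ.norm_image_sub_le_of_norm_deriv_le (𝕜 := ℝ)
    (fun x _ => hV.differentiable x) (fun x _ => h x) (mem_univ θ) (mem_univ θ')⟩

theorem norm_stressSpace_le (a : MD d) (b : ℝ) :
    ‖(WithLp.toLp 2 (a, b) : StressSpace d)‖ ≤ ‖a‖ + ‖b‖ := by
  refine le_of_sq_le_sq ?_ (by positivity)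
  have := norm_sq_stressSpace (WithLp.toLp 2 (a, b) : StressSpace d)
  change _ = ‖a‖ ^ 2 + b ^ 2 at this
  rw [this, ← sq_abs b, ← Real.norm_eq_abs]
  nlinarith [norm_nonneg a, norm_nonneg b]

theorem memLp_pair (p : L2 Ω (MD d)) (z : L2 Ω ℝ) :
    MemLp (fun x => (WithLp.toLp 2 (p x, z x) : StressSpace d)) 2 (volume.restrict Ω) := by
  refine MemLp.of_le_mul (g := fun x => ‖p x‖ + ‖z x‖) (c := 1)
    ((Lp.memLp p).norm.add (Lp.memLp z).norm) ?_ (Eventually.of_forall fun x => ?_)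
  · exact (WithLp.prod_continuous_toLp 2 (MD d) ℝ).comp_aestronglyMeasurable
      ((Lp.aestronglyMeasurable p).prodMk (Lp.aestronglyMeasurable z))
  · rw [one_mul, Real.norm_of_nonneg (by positivity)]
    exact norm_stressSpace_le _ _

theorem dissipation_zero (hK : IsYieldSet K) :
    dissipation K (0 : L2 Ω (MD d)) (0 : L2 Ω ℝ) = 0 := by
  rw [dissipation]
  refine integral_eq_zero_of_ae ?_
  filter_upwards [Lp.coeFn_zero (MD d) 2 ((volume : Measure (Pt d)).restrict Ω),
    Lp.coeFn_zero ℝ 2 ((volume : Measure (Pt d)).restrict Ω)] with x h1 h2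
  rw [h1, h2]
  exact supportH_zero hK

variable [IsFiniteMeasure ((volume : Measure (Pt d)).restrict Ω)]

theorem memLp_deriv_potential (hV : IsSofteningPotential K V) (z : L2 Ω ℝ) (q : ℝ≥0∞) :
    MemLp (fun x => deriv V (z x)) q (volume.restrict Ω) := by
  obtain ⟨B, hB, h⟩ := hV.exists_bound_deriv
  exact MemLp.of_bound (hV.contDiff_deriv.continuous.comp_aestronglyMeasurable
    (Lp.aestronglyMeasurable z)) B (Eventually.of_forall fun x => h _)

/-- The element `V'(z)` of `L²(Ω)`. -/
def potentialDeriv (hV : IsSofteningPotential K V) (z : L2 Ω ℝ) : L2 Ω ℝ :=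
  (memLp_deriv_potential hV z 2).toLp

theorem coeFn_potentialDeriv (hV : IsSofteningPotential K V) (z : L2 Ω ℝ) :
    ∀ᵐ x ∂(volume.restrict Ω), potentialDeriv hV z x = deriv V (z x) :=
  (memLp_deriv_potential hV z 2).coeFn_toLp

theorem integrable_of_L2 {F : Type} [NormedAddCommGroup F] (f : L2 Ω F) :
    Integrable f (volume.restrict Ω) :=
  (Lp.memLp f).integrable (by norm_num)

theorem integrable_potential (hV : IsSofteningPotential K V) (z : L2 Ω ℝ) :
    Integrable (fun x => V (z x)) (volume.restrict Ω) := by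
  obtain ⟨B, hB, h⟩ := hV.abs_sub_le
  refine Integrable.mono' ((integrable_const |V 0|).add ((integrable_of_L2 z).norm.const_mul B))
    (hV.differentiable.continuous.comp_aestronglyMeasurable (Lp.aestronglyMeasurable z))
    (Eventually.of_forall fun x => ?_)
  have := h 0 (z x)
  have h2 := abs_sub_abs_le_abs_sub (V (z x)) (V 0)
  simp only [Pi.add_apply, Real.norm_eq_abs, sub_zero] at this ⊢
  linarith

theorem exists_integral_norm_le (Ω : Set (Pt d))
    [IsFiniteMeasure ((volume : Measure (Pt d)).restrict Ω)] :
    ∃ c : ℝ, 0 ≤ c ∧ ∀ (F : Type) [NormedAddCommGroup F] (f : L2 Ω F),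
      ∫ x in Ω, ‖f x‖ ≤ c * ‖f‖ := by
  have h1 : MemLp (fun _ : Pt d => (1 : ℝ)) 2 (volume.restrict Ω) := memLp_const 1
  refine ⟨‖h1.toLp‖, norm_nonneg _, fun F _ f => ?_⟩
  have h2 : MemLp (fun x => ‖f x‖) 2 (volume.restrict Ω) := (Lp.memLp f).norm
  have h3 : ∫ x in Ω, ‖f x‖ = inner ℝ h1.toLp h2.toLp := by
    rw [L2.inner_def]
    refine integral_congr_ae ?_
    filter_upwards [h1.coeFn_toLp, h2.coeFn_toLp] with x e1 e2
    rw [e1, e2]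
    simp
  have h4 : ‖h2.toLp‖ = ‖f‖ := by
    rw [Lp.norm_toLp, Lp.norm_def, eLpNorm_norm]
  rw [h3, ← h4]
  exact real_inner_le_norm _ _

theorem hasFDerivAt_softeningEnergy (hV : IsSofteningPotential K V) (z : L2 Ω ℝ) :
    HasFDerivAt (softeningEnergy V) (innerSL ℝ (potentialDeriv hV z)) z := by
  obtain ⟨M, hM, h⟩ := hV.exists_taylor
  refine hasFDerivAt_of_quadratic_remainder (M := M) fun y => ?_
  have hsq : ∫ x in Ω, y x ^ 2 = ‖y‖ ^ 2 := by
    rw [← real_inner_self_eq_norm_sq, L2.inner_def]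
    refine integral_congr_ae (Eventually.of_forall fun x => ?_)
    simp [sq]
  have hsi : Integrable (fun x => y x ^ 2) (volume.restrict Ω) := (Lp.memLp y).integrable_sq
  rw [innerSL_apply_apply, L2.inner_def, softeningEnergy, softeningEnergy,
    ← integral_sub (integrable_potential hV _) (integrable_potential hV _),
    ← integral_sub (f := fun x => V ((z + y) x) - V (z x))
      ((integrable_potential hV _).sub (integrable_potential hV _))
      (L2.integrable_inner (𝕜 := ℝ) _ _), ← hsq, ← integral_const_mul]
  rw [← Real.norm_eq_abs]
  refine norm_integral_le_of_norm_le (hsi.const_mul M) ?_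
  filter_upwards [Lp.coeFn_add z y, coeFn_potentialDeriv hV z] with x h1 h2
  rw [h1, h2, Pi.add_apply, Real.norm_eq_abs]
  refine le_trans (le_of_eq ?_) (h (z x) (y x))
  congr 1
  simp [mul_comm]

theorem softeningEnergy_lipschitz (hV : IsSofteningPotential K V) :
    ∃ L : ℝ, ∀ y z : L2 Ω ℝ, |softeningEnergy V y - softeningEnergy V z| ≤ L * ‖y - z‖ := by
  obtain ⟨B, hB, h⟩ := hV.abs_sub_le
  obtain ⟨c, hc, hc'⟩ := exists_integral_norm_le Ω
  refine ⟨B * c, fun y z => ?_⟩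
  rw [softeningEnergy, softeningEnergy,
    ← integral_sub (integrable_potential hV _) (integrable_potential hV _), mul_assoc]
  refine le_trans ?_ (mul_le_mul_of_nonneg_left (hc' ℝ (y - z)) hB)
  rw [← integral_const_mul]
  rw [← Real.norm_eq_abs]
  refine norm_integral_le_of_norm_le ((integrable_of_L2 (y - z)).norm.const_mul B) ?_
  filter_upwards [Lp.coeFn_sub y z] with x h1
  rw [h1, Pi.sub_apply]
  exact h _ _

/-! ### The dissipation functional -/

theorem integrable_supportH (hK : IsYieldSet K) (p : L2 Ω (MD d)) (z : L2 Ω ℝ) :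
    Integrable (fun x => supportH K (WithLp.toLp 2 (p x, z x))) (volume.restrict Ω) := by
  obtain ⟨B, hB⟩ := exists_lipschitzWith_supportH hK
  have hm := memLp_pair p z
  refine (hm.integrable (by norm_num)).norm.const_mul (B : ℝ) |>.mono'
    (hB.continuous.comp_aestronglyMeasurable hm.aestronglyMeasurable)
    (Eventually.of_forall fun x => ?_)
  have := hB.norm_sub_le (WithLp.toLp 2 (p x, z x)) 0
  simpa [supportH_zero hK] using this

theorem exists_dissipation_sub_le (hK : IsYieldSet K) :
    ∃ L : ℝ, 0 ≤ L ∧ ∀ (p q : L2 Ω (MD d)) (y z : L2 Ω ℝ),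
      |dissipation K p y - dissipation K q z| ≤ L * (‖p - q‖ + ‖y - z‖) := by
  obtain ⟨B, hB⟩ := exists_lipschitzWith_supportH hK
  obtain ⟨c, hc, hc'⟩ := exists_integral_norm_le Ω
  refine ⟨B * c, by positivity, fun p q y z => ?_⟩
  rw [dissipation, dissipation,
    ← integral_sub (integrable_supportH hK _ _) (integrable_supportH hK _ _)]
  have h1 : ∫ x in Ω, (B : ℝ) * (‖(p - q) x‖ + ‖(y - z) x‖) ≤ B * c * (‖p - q‖ + ‖y - z‖) := by
    rw [integral_const_mul, integral_add (integrable_of_L2 _).norm (integrable_of_L2 _).norm,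
      mul_assoc, mul_add c]
    exact mul_le_mul_of_nonneg_left (add_le_add (hc' _ _) (hc' _ _)) B.2
  rw [← Real.norm_eq_abs]
  refine le_trans (norm_integral_le_of_norm_le
    (g := fun x => (B : ℝ) * (‖(p - q) x‖ + ‖(y - z) x‖))
    (((integrable_of_L2 (p - q)).norm.add (integrable_of_L2 (y - z)).norm).const_mul _) ?_) h1
  filter_upwards [Lp.coeFn_sub p q, Lp.coeFn_sub y z] with x h2 h3
  refine (hB.norm_sub_le _ _).trans ?_
  gcongr
  rw [h2, h3]
  exact norm_stressSpace_le (p x - q x) (y x - z x)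

/-- A function of two variables that is Lipschitz and vanishes at the origin is integrable along
square integrable curves. -/
theorem intervalIntegrable_of_lipschitz {Y Z : Type*} [NormedAddCommGroup Y] [NormedAddCommGroup Z]
    {Φ : Y → Z → ℝ} {L : ℝ} (hL : 0 ≤ L)
    (h : ∀ p q y z, |Φ p y - Φ q z| ≤ L * (‖p - q‖ + ‖y - z‖)) (h0 : Φ 0 0 = 0)
    {p : ℝ → Y} {z : ℝ → Z} {T : ℝ} (hT : 0 ≤ T) (hp : MemLp p 2 (volume.restrict (Icc 0 T)))
    (hz : MemLp z 2 (volume.restrict (Icc 0 T))) :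
    IntervalIntegrable (fun t => Φ (p t) (z t)) volume 0 T := by
  have hc : LipschitzWith (L * 2).toNNReal fun q : Y × Z => Φ q.1 q.2 := by
    refine LipschitzWith.of_dist_le_mul (f := fun q : Y × Z => Φ q.1 q.2) fun q r => ?_
    rw [Real.coe_toNNReal _ (by positivity), Real.dist_eq]
    refine (h _ _ _ _).trans ?_
    have h1 : ‖q.1 - r.1‖ ≤ dist q r := (dist_eq_norm q.1 r.1).symm.le.trans (le_max_left _ _)
    have h2 : ‖q.2 - r.2‖ ≤ dist q r := (dist_eq_norm q.2 r.2).symm.le.trans (le_max_right _ _)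
    rw [mul_assoc]
    gcongr
    linarith
  rw [intervalIntegrable_iff_integrableOn_Icc_of_le hT]
  refine Integrable.mono' (((integrableOn_of_memLp_two hp).norm.add
    (integrableOn_of_memLp_two hz).norm).const_mul L)
    (hc.continuous.comp_aestronglyMeasurable (hp.1.prodMk hz.1)) (ae_of_all _ fun t => ?_)
  simpa [h0] using h (p t) 0 (z t) 0

theorem intervalIntegrable_dissipation (hK : IsYieldSet K) {p : ℝ → L2 Ω (MD d)}
    {z : ℝ → L2 Ω ℝ} {T : ℝ} (hT : 0 ≤ T) (hp : MemLp p 2 (volume.restrict (Icc 0 T)))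
    (hz : MemLp z 2 (volume.restrict (Icc 0 T))) :
    IntervalIntegrable (fun t => dissipation K (p t) (z t)) volume 0 T := by
  obtain ⟨L, hL, h⟩ := exists_dissipation_sub_le (Ω := Ω) hK
  have h0 : dissipation K (0 : L2 Ω (MD d)) (0 : L2 Ω ℝ) = 0 := dissipation_zero hK
  exact @intervalIntegrable_of_lipschitz (L2 Ω (MD d)) (L2 Ω ℝ) inferInstance inferInstance
    (dissipation K) L hL h h0 p z T hT hp hz

end Energies

end Plasticity

end

noncomputable section

namespace Plasticity

/-! ### Locally square integrable functions and mollification -/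

section Mollification

open scoped Pointwise

variable {d : ℕ}

theorem IsL2loc.sub {F : Type} [NormedAddCommGroup F] {f g : Pt d → F} (hf : IsL2loc f)
    (hg : IsL2loc g) : IsL2loc (fun x => f x - g x) :=
  fun S hS => (hf S hS).sub (hg S hS)

/-- The product of a locally square integrable function and a continuous function of compact support
is integrable. -/
theorem IsL2loc.integrable_mul {f : Pt d → ℝ} (hf : IsL2loc f) {a : Pt d → ℝ} (ha : Continuous a)
    (hc : HasCompactSupport a) : Integrable (fun x => f x * a x) volume := by
  have h2 : MemLp a 2 (volume.restrict (tsupport a)) :=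
    (ha.memLp_of_hasCompactSupport hc).restrict _
  have h3 : IntegrableOn (fun x => f x * a x) (tsupport a) := (hf _ hc).integrable_mul h2
  refine (integrableOn_iff_integrable_of_support_subset fun x hx => ?_).1 h3
  exact subset_tsupport a fun h0 => hx (by simp [h0])

theorem IsL2loc.coord {ι : Type} [Fintype ι] {f : Pt d → EuclideanSpace ℝ ι}
    (hf : IsL2loc f) (i : ι) : IsL2loc (fun x => f x i) := fun S hS =>
  (hf S hS).of_le ((PiLp.continuous_apply 2 _ i).comp_aestronglyMeasurable (hf S hS).1)
    (ae_of_all _ fun x => PiLp.norm_apply_le (f x) i)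

theorem IsL2loc.locallyIntegrable {f : Pt d → ℝ} (hf : IsL2loc f) : LocallyIntegrable f := by
  refine locallyIntegrable_iff.2 fun k hk => ?_
  have : IsFiniteMeasure ((volume : Measure (Pt d)).restrict k) :=
    ⟨by simpa using hk.measure_lt_top⟩
  exact (hf k hk).integrable (by norm_num)

/-- The correlation of two square integrable functions is continuous, because translations act
continuously on `L²`. -/
theorem continuous_correlation {f g : Pt d → ℝ} (hf : MemLp f 2 volume) (hg : MemLp g 2 volume) :
    Continuous fun t => ∫ x, f x * g (x - t) := by
  have : Fact ((2 : ℝ≥0∞) ≠ ⊤) := ⟨ENNReal.ofNat_ne_top⟩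
  have hc : Continuous fun t : Pt d =>
      inner ℝ hf.toLp ((DomAddAct.mk (-t) +ᵥ hg.toLp : Lp ℝ 2 (volume : Measure (Pt d)))) := by
    have h1 : Continuous fun t : Pt d => (DomAddAct.mk (-t) : (Pt d)ᵈᵃᵃ) :=
      DomAddAct.continuous_mk.comp continuous_neg
    have h2 : Continuous fun t : Pt d =>
        (DomAddAct.mk (-t) +ᵥ hg.toLp : Lp ℝ 2 (volume : Measure (Pt d))) :=
      h1.vadd continuous_const
    exact continuous_const.inner h2
  refine hc.congr fun t => ?_
  rw [L2.inner_def]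
  refine integral_congr_ae ?_
  have h3 : ∀ᵐ x ∂(volume : Measure (Pt d)), hg.toLp g (-t +ᵥ x) = g (-t +ᵥ x) :=
    (measurePreserving_vadd (-t) (volume : Measure (Pt d))).quasiMeasurePreserving.ae
      hg.coeFn_toLp
  filter_upwards [hf.coeFn_toLp, DomAddAct.vadd_Lp_ae_eq (DomAddAct.mk (-t)) hg.toLp, h3]
    with x h1 h2 h3
  rw [h1, h2]
  simp only [Equiv.symm_apply_apply, h3]
  simp [mul_comm, sub_eq_neg_add]

/-- The mollification `∫ s(y) ρ(x - y) dy`. -/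
def mollify (s ρ : Pt d → ℝ) : Pt d → ℝ := fun x => ∫ y, s y * ρ (x - y)

theorem mollify_eq_convolution (s ρ : Pt d → ℝ) :
    mollify s ρ = convolution s ρ (ContinuousLinearMap.mul ℝ ℝ) volume := rfl

theorem contDiff_mollify {s ρ : Pt d → ℝ} (hs : IsL2loc s) (hρ : IsTest univ ρ) :
    ContDiff ℝ ∞ (mollify s ρ) := by
  rw [mollify_eq_convolution]
  exact hρ.2.1.contDiff_convolution_right _ hs.locallyIntegrable hρ.1

theorem pderiv_mollify {s ρ : Pt d → ℝ} (hs : IsL2loc s) (hρ : IsTest univ ρ) (j : Fin d)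
    (x : Pt d) : pderiv j (mollify s ρ) x = mollify s (pderiv j ρ) x := by
  have h1 : ContDiff ℝ 1 ρ := hρ.1.of_le (by simp)
  have h := hρ.2.1.hasFDerivAt_convolution_right (ContinuousLinearMap.mul ℝ ℝ)
    hs.locallyIntegrable h1 x
  rw [pderiv, mollify_eq_convolution, h.fderiv, convolution_precompR_apply _ hs.locallyIntegrable
    (hρ.2.1.fderiv ℝ) (hρ.1.continuous_fderiv (by simp))]
  rfl

theorem pderiv_comp_sub_left (ρ : Pt d → ℝ) (hρ : Differentiable ℝ ρ) (j : Fin d) (x y : Pt d) :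
    pderiv j (fun y => ρ (x - y)) y = - pderiv j ρ (x - y) := by
  have h1 : HasFDerivAt (fun y : Pt d => x - y) (-ContinuousLinearMap.id ℝ (Pt d)) y :=
    (hasFDerivAt_id y).const_sub x
  have h2 := (hρ (x - y)).hasFDerivAt.comp y h1
  rw [pderiv, pderiv]
  have h3 : fderiv ℝ (fun y => ρ (x - y)) y
      = (fderiv ℝ ρ (x - y)).comp (-ContinuousLinearMap.id ℝ (Pt d)) := h2.fderiv
  rw [h3]
  simp

theorem IsTest.comp_sub_left {ρ : Pt d → ℝ} (hρ : IsTest univ ρ) (x : Pt d) :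
    IsTest univ fun y => ρ (x - y) :=
  ⟨hρ.1.comp (contDiff_const.sub contDiff_id),
    hρ.2.1.comp_homeomorph (Homeomorph.subLeft x), subset_univ _⟩

theorem IsTest.mul {U : Set (Pt d)} {θ φ : Pt d → ℝ} (hθ : IsTest U θ) (hφ : ContDiff ℝ ∞ φ) :
    IsTest U fun x => θ x * φ x :=
  ⟨hθ.1.mul hφ, hθ.2.1.mul_right, (tsupport_mul_subset_left).trans hθ.2.2⟩

theorem pderiv_mul {θ φ : Pt d → ℝ} (hθ : Differentiable ℝ θ) (hφ : Differentiable ℝ φ)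
    (j : Fin d) (x : Pt d) :
    pderiv j (fun x => θ x * φ x) x = pderiv j θ x * φ x + θ x * pderiv j φ x := by
  rw [pderiv, fderiv_fun_mul (hθ x) (hφ x)]
  simp [pderiv]
  ring

/-- A mollified divergence free field is divergence free. -/
theorem sum_pderiv_mollify {s : Fin d → Pt d → ℝ} (hs : ∀ j, IsL2loc (s j))
    (hdiv : ∀ φ : Pt d → ℝ, IsTest univ φ → ∫ x, ∑ j, s j x * pderiv j φ x = 0)
    {ρ : Pt d → ℝ} (hρ : IsTest univ ρ) (x : Pt d) :
    ∑ j, pderiv j (mollify (s j) ρ) x = 0 := by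
  have hφ := hρ.comp_sub_left x
  have h := hdiv _ hφ
  rw [integral_finsetSum _ fun j _ => (hs j).integrable_mul (hφ.continuous_pderiv j).1
    (hφ.continuous_pderiv j).2] at h
  simp only [pderiv_comp_sub_left ρ (hρ.1.differentiable (by simp)), mul_neg, integral_neg,
    Finset.sum_neg_distrib, neg_eq_zero] at h
  rw [← h]
  exact Finset.sum_congr rfl fun j _ => pderiv_mollify (hs j) hρ j x

theorem IsL2loc.memLp_indicator {f : Pt d → ℝ} (hf : IsL2loc f) {B : Set (Pt d)}
    (hB : IsCompact B) : MemLp (B.indicator f) 2 volume :=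
  (memLp_indicator_iff_restrict hB.measurableSet).2 (hf B hB)

theorem integrable_of_memLp_two_of_compact {f : Pt d → ℝ} (hf : MemLp f 2 volume)
    {B : Set (Pt d)} (hB : IsCompact B) (h : ∀ x ∉ B, f x = 0) : Integrable f := by
  have : IsFiniteMeasure ((volume : Measure (Pt d)).restrict B) :=
    ⟨by simpa using hB.measure_lt_top⟩
  refine (integrableOn_iff_integrable_of_support_subset (s := B) fun x hx => ?_).1
    ((hf.restrict B).integrable (by norm_num))
  by_contra hxB
  exact hx (h x hxB)

/-- Testing with a mollification amounts to averaging correlations. -/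
theorem integral_mul_mollify {a s ρ : Pt d → ℝ} (ha : MemLp a 2 volume) {k : Set (Pt d)}
    (hk : IsCompact k) (hak : ∀ x ∉ k, a x = 0) (hs : IsL2loc s) (hρ : IsTest univ ρ)
    (hρ1 : ∀ t, ρ t ≠ 0 → t ∈ Metric.closedBall (0 : Pt d) 1) :
    ∫ x, a x * mollify s ρ x =
      ∫ t, ρ t * ∫ x, a x * (k + Metric.closedBall (0 : Pt d) 1).indicator s (x - t) := by
  set B := k + Metric.closedBall (0 : Pt d) 1 with hBdef
  have hB : IsCompact B := hk.add (isCompact_closedBall 0 1)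
  have hpt : ∀ x, a x * mollify s ρ x = ∫ t, ρ t * (a x * B.indicator s (x - t)) := by
    intro x
    have e : mollify s ρ x = ∫ t, s (x - t) * ρ t := by
      rw [mollify, ← integral_sub_left_eq_self _ _ x]
      simp
    rw [e, ← integral_const_mul]
    refine integral_congr_ae (ae_of_all _ fun t => ?_)
    by_cases hx : x ∈ k
    · by_cases ht : ρ t = 0
      · simp [ht]
      · have hm : x - t ∈ B := by
          rw [sub_eq_add_neg]
          exact add_mem_add hx (by simpa using hρ1 t ht)
        simp only [indicator_of_mem hm]
        ring
    · simp [hak x hx]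
  have hai := integrable_of_memLp_two_of_compact ha hk hak
  have hsi : Integrable (B.indicator s) :=
    integrable_of_memLp_two_of_compact (hs.memLp_indicator hB) hB
      fun x hx => indicator_of_notMem hx s
  have hint : Integrable (fun q : Pt d × Pt d => ρ q.2 * (a q.1 * B.indicator s (q.1 - q.2)))
      (volume.prod volume) := by
    have h1 := (hai.convolution_integrand (ContinuousLinearMap.mul ℝ ℝ) hsi.comp_neg).swap
    obtain ⟨M, hM⟩ := hρ.2.1.exists_bound_of_continuous hρ.1.continuous
    refine Integrable.bdd_mul (c := M) (f := fun q : Pt d × Pt d => ρ q.2)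
      (g := fun q : Pt d × Pt d => a q.1 * B.indicator s (q.1 - q.2)) ?_ ?_ ?_
    · refine h1.congr (ae_of_all _ fun q => ?_)
      simp
    · exact (hρ.1.continuous.comp continuous_snd).aestronglyMeasurable
    · exact ae_of_all _ fun q => hM q.2
  simp only [hpt]
  rw [integral_integral_swap hint]
  simp only [integral_const_mul]

/-- A divergence free, locally square integrable field `s` is orthogonal to the gradient of every
compactly supported product `θ v`, where `v` has locally square integrable weak gradient `g` on the
support of `θ`. -/
theorem integral_divFree_mul_grad {s g : Fin d → Pt d → ℝ} {v θ : Pt d → ℝ}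
    (hs : ∀ j, IsL2loc (s j))
    (hdiv : ∀ φ : Pt d → ℝ, IsTest univ φ → ∫ x, ∑ j, s j x * pderiv j φ x = 0)
    (hv : IsL2loc v) (hg : ∀ j, IsL2loc (g j))
    (hθ : IsTest univ θ)
    (hgrad : ∀ φ : Pt d → ℝ, IsTest (tsupport θ) φ → ∀ j,
      ∫ x, v x * pderiv j φ x = - ∫ x, g j x * φ x) :
    ∫ x, ∑ j, (v x * pderiv j θ x + g j x * θ x) * s j x = 0 := by
  set k := tsupport θ with hkdef
  have hk : IsCompact k := hθ.2.1
  set a : Fin d → Pt d → ℝ := fun j x => v x * pderiv j θ x + g j x * θ x with hadef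
  have hθ0 : ∀ x ∉ k, θ x = 0 := fun x hx => image_eq_zero_of_notMem_tsupport hx
  have hdθ0 : ∀ j, ∀ x ∉ k, pderiv j θ x = 0 := fun j x hx => by
    have : fderiv ℝ θ x = 0 := image_eq_zero_of_notMem_tsupport
      fun h => hx (tsupport_fderiv_subset ℝ h)
    simp [pderiv, this]
  have hak : ∀ j, ∀ x ∉ k, a j x = 0 := fun j x hx => by
    simp [hadef, hθ0 x hx, hdθ0 j x hx]
  have hmul : ∀ {f b : Pt d → ℝ}, IsL2loc f → Continuous b → (∀ x ∉ k, b x = 0) →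
      MemLp (fun x => f x * b x) 2 volume := by
    intro f b hf hb hb0
    obtain ⟨M, hM⟩ := (HasCompactSupport.intro hk hb0).exists_bound_of_continuous hb
    refine MemLp.of_le_mul (c := M) (hf.memLp_indicator hk) ?_ (ae_of_all _ fun x => ?_)
    · exact hf.locallyIntegrable.aestronglyMeasurable.mul hb.aestronglyMeasurable
    · by_cases hx : x ∈ k
      · rw [indicator_of_mem hx, norm_mul, mul_comm]
        gcongr
        exact hM x
      · simp [hb0 x hx, indicator_of_notMem hx]
  have ha : ∀ j, MemLp (a j) 2 volume := fun j =>
    (hmul hv (hθ.continuous_pderiv j).1 (hdθ0 j)).add (hmul (hg j) hθ.1.continuous hθ0)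
  set B := k + Metric.closedBall (0 : Pt d) 1 with hBdef
  have hB : IsCompact B := hk.add (isCompact_closedBall 0 1)
  set T : Pt d → ℝ := fun t => ∑ j, ∫ x, a j x * B.indicator (s j) (x - t) with hTdef
  have hTc : Continuous T :=
    continuous_finsetSum _ fun j _ => continuous_correlation (ha j) ((hs j).memLp_indicator hB)
  -- the weighted averages of `T` vanish: use `θ` times the mollified field as a test function
  have hav : ∀ ρ : Pt d → ℝ, ContDiff ℝ ∞ ρ → HasCompactSupport ρ →
      tsupport ρ ⊆ Metric.ball (0 : Pt d) 1 → ∫ t, ρ t • T t = 0 := by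
    intro ρ h1 h2 h3
    have hρ : IsTest univ ρ := ⟨h1, h2, subset_univ _⟩
    have hρ1 : ∀ t, ρ t ≠ 0 → t ∈ Metric.closedBall (0 : Pt d) 1 := fun t ht =>
      Metric.ball_subset_closedBall (h3 (subset_tsupport ρ ht))
    have hm : ∀ j, ContDiff ℝ ∞ (mollify (s j) ρ) := fun j => contDiff_mollify (hs j) hρ
    have e1 : ∫ t, ρ t • T t = ∑ j, ∫ x, a j x * mollify (s j) ρ x := by
      simp only [smul_eq_mul, hTdef, Finset.mul_sum]
      rw [integral_finsetSum _ fun j _ => ?_]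
      · exact Finset.sum_congr rfl fun j _ =>
          (integral_mul_mollify (ha j) hk (hak j) (hs j) hρ hρ1).symm
      · exact (h1.continuous.mul (continuous_correlation (ha j)
          ((hs j).memLp_indicator hB))).integrable_of_hasCompactSupport h2.mul_right
    have i1 : ∀ j, Integrable (fun x => v x * (pderiv j θ x * mollify (s j) ρ x)) := fun j =>
      hv.integrable_mul ((hθ.continuous_pderiv j).1.mul (hm j).continuous)
        (hθ.continuous_pderiv j).2.mul_right
    have i2 : ∀ j, Integrable (fun x => g j x * (θ x * mollify (s j) ρ x)) := fun j =>
      (hg j).integrable_mul (hθ.1.continuous.mul (hm j).continuous) hθ.2.1.mul_right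
    have hpc : ∀ j, Continuous (pderiv j (mollify (s j) ρ)) := fun j =>
      ((hm j).continuous_fderiv (by simp)).clm_apply continuous_const
    have i3 : ∀ j, Integrable (fun x => v x * (θ x * pderiv j (mollify (s j) ρ) x)) := fun j =>
      hv.integrable_mul (hθ.1.continuous.mul (hpc j)) hθ.2.1.mul_right
    have e2 : ∀ j, ∫ x, a j x * mollify (s j) ρ x
        = - ∫ x, v x * (θ x * pderiv j (mollify (s j) ρ) x) := by
      intro j
      have h4 := hgrad _ (IsTest.mul ⟨hθ.1, hθ.2.1, subset_rfl⟩ (hm j)) j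
      simp only [pderiv_mul (hθ.1.differentiable (by simp)) ((hm j).differentiable (by simp)),
        mul_add] at h4
      rw [integral_add (i1 j) (i3 j)] at h4
      have h5 : ∫ x, a j x * mollify (s j) ρ x
          = (∫ x, v x * (pderiv j θ x * mollify (s j) ρ x))
            + ∫ x, g j x * (θ x * mollify (s j) ρ x) := by
        rw [← integral_add (i1 j) (i2 j)]
        refine integral_congr_ae (ae_of_all _ fun x => ?_)
        simp only [hadef]
        ring
      linarith
    rw [e1, Finset.sum_congr rfl fun j _ => e2 j, Finset.sum_neg_distrib,
      ← integral_finsetSum _ fun j _ => i3 j]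
    simp only [← Finset.mul_sum, sum_pderiv_mollify hs hdiv hρ]
    simp
  -- a continuous function whose averages near `0` vanish is zero at `0`
  have hT0 : T 0 = 0 := by
    have hae := Metric.isOpen_ball.ae_eq_zero_of_integral_contDiff_smul_eq_zero
      (hTc.locallyIntegrable.locallyIntegrableOn _) hav
    by_contra hne
    have hopen : IsOpen (Metric.ball (0 : Pt d) 1 ∩ {t | T t ≠ 0}) :=
      Metric.isOpen_ball.inter (isOpen_ne_fun hTc continuous_const)
    have hpos := hopen.measure_pos volume ⟨0, by simp, hne⟩
    refine hpos.ne' (measure_mono_null (fun t ht => ?_) hae)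
    exact fun h => ht.2 (h ht.1)
  -- the indicator function of `B` has no effect on the support of `a j`
  have e3 : ∀ j x, a j x * B.indicator (s j) (x - 0) = a j x * s j x := by
    intro j x
    by_cases hx : x ∈ k
    · have : x + 0 ∈ B := add_mem_add hx (Metric.mem_closedBall_self zero_le_one)
      rw [add_zero] at this
      simp [this]
    · simp [hak j x hx]
  have i4 : ∀ j, Integrable (fun x => a j x * s j x) := fun j => by
    refine ((ha j).integrable_mul ((hs j).memLp_indicator hB)).congr (ae_of_all _ fun x => ?_)
    simpa using e3 j x
  rw [integral_finsetSum _ fun j _ => i4 j]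
  simpa only [hTdef, e3] using hT0

end Mollification

end Plasticity

end

noncomputable section

namespace Plasticity

/-! ### Unfolding integrals of periodic functions -/

section Unfolding

variable {d : ℕ}

theorem ae_apply_ne (i : Fin d) (c : ℝ) : ∀ᵐ x ∂(volume : Measure (Pt d)), x i ≠ c :=
  (PiLp.volume_preserving_ofLp (Fin d)).quasiMeasurePreserving.ae (p := fun y => y i ≠ c)
    (Measure.ae_eval_ne (fun _ => (volume : Measure ℝ)) i c)

theorem mem_closedBall_of_abs_le {x : Pt d} (h : ∀ i, |x i| ≤ 2) :
    x ∈ Metric.closedBall (0 : Pt d) (√(∑ _i : Fin d, (2 : ℝ) ^ 2)) := by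
  rw [mem_closedBall_zero_iff, EuclideanSpace.norm_eq]
  refine Real.sqrt_le_sqrt (Finset.sum_le_sum fun i _ => ?_)
  rw [Real.norm_eq_abs]
  exact pow_le_pow_left₀ (abs_nonneg _) (h i) 2

theorem isOpen_cube (d : ℕ) : IsOpen (cube d) := by
  have : cube d = ⋂ i : Fin d, {x : Pt d | x i ∈ Ioo (-(1 / 2) : ℝ) (1 / 2)} := by
    ext x
    simp [cube]
  rw [this]
  exact isOpen_iInter_of_finite fun i =>
    isOpen_Ioo.preimage (PiLp.continuous_apply 2 (fun _ : Fin d => ℝ) i)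

theorem pderiv_comp_add_right (φ : Pt d → ℝ) (j : Fin d) (a x : Pt d) :
    pderiv j (fun x => φ (x + a)) x = pderiv j φ (x + a) := by
  rw [pderiv, fderiv_comp_add_right]
  rfl

theorem isBounded_cube (d : ℕ) : Bornology.IsBounded (cube d) :=
  (Metric.isBounded_closedBall (x := (0 : Pt d))
    (r := √(∑ _i : Fin d, (2 : ℝ) ^ 2))).subset fun x hx => mem_closedBall_of_abs_le fun i =>
      abs_le.2 ⟨by linarith [(hx i).1], by linarith [(hx i).2]⟩

theorem IsL2loc.integrable_mul_mul {f g a : Pt d → ℝ} (hf : IsL2loc f) (hg : IsL2loc g)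
    (ha : Continuous a) (hc : HasCompactSupport a) : Integrable (fun x => f x * g x * a x) := by
  obtain ⟨M, hM⟩ := hc.exists_bound_of_continuous ha
  have h3 : IntegrableOn (fun x => f x * g x * a x) (tsupport a) :=
    ((hf _ hc).integrable_mul (hg _ hc)).mul_bdd (c := M) ha.aestronglyMeasurable (ae_of_all _ hM)
  refine (integrableOn_iff_integrable_of_support_subset fun x hx => ?_).1 h3
  exact subset_tsupport a fun h0 => hx (by simp [h0])

/-- The point of `ℝᵈ` with integer coordinates `k`. -/
def latticeVec (k : Fin d → ℤ) : Pt d := WithLp.toLp 2 fun i => (k i : ℝ)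

variable [NeZero d]

/-- The values of the `i`-th coordinate of the lattice shifts that are needed to cover the support of
the partition of unity: none in the first coordinate, and neighbouring cells in the others. -/
def shiftRange (i : Fin d) : Finset ℤ := if i = 0 then {0} else {-1, 0, 1}

/-- The lattice shifts to neighbouring cells that leave the first coordinate fixed. -/
def shifts (d : ℕ) [NeZero d] : Finset (Fin d → ℤ) := Fintype.piFinset shiftRange

theorem shifts_zero {k : Fin d → ℤ} (hk : k ∈ shifts d) : k 0 = 0 := by
  have := Fintype.mem_piFinset.1 hk 0
  simpa [shiftRange] using this

theorem IsBarPeriodic.add_latticeVec {F : Type} {f : Pt d → F} (hf : IsBarPeriodic f)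
    {k : Fin d → ℤ} (hk : k ∈ shifts d) (x : Pt d) : f (x + latticeVec k) = f x := by
  let P : AddSubgroup (Pt d) :=
    { carrier := {v | ∀ x, f (x + v) = f x}
      add_mem' := fun {a b} ha hb x => by rw [← add_assoc, hb, ha]
      zero_mem' := fun x => by rw [add_zero]
      neg_mem' := fun {a} ha x => by
        have := ha (x + -a)
        rw [neg_add_cancel_right] at this
        exact this.symm }
  have h1 : latticeVec k = ∑ i, k i • EuclideanSpace.single i (1 : ℝ) := by
    ext j
    simp only [latticeVec]
    rw [WithLp.ofLp_sum, Finset.sum_apply]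
    simp
  have h2 : latticeVec k ∈ P := by
    rw [h1]
    refine sum_mem fun i _ => ?_
    by_cases hi : i = 0
    · rw [hi, shifts_zero hk, zero_smul]
      exact zero_mem _
    · exact zsmul_mem (show EuclideanSpace.single i (1 : ℝ) ∈ P from hf i hi) _
  exact h2 x

theorem sum_shifts_prod (h : Fin d → ℤ → ℝ) :
    ∑ k ∈ shifts d, ∏ i, h i (k i) = ∏ i, ∑ m ∈ shiftRange i, h i m :=
  (Finset.prod_univ_sum shiftRange h).symm

/-- The integral over `ℝᵈ` of a function supported in the cells next to the unit cube is the sum of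
integrals over the cube of its lattice translates. -/
theorem integral_eq_sum_cube {f : Pt d → ℝ} (hf : Integrable f)
    (h0 : ∀ x, f x ≠ 0 → |x 0| ≤ 1 / 2 ∧ ∀ i, i ≠ 0 → |x i| ≤ 1) :
    ∫ x, f x = ∑ k ∈ shifts d, ∫ x in cube d, f (x + latticeVec k) := by
  set h : ℝ → ℝ := (Ioo (-(1 / 2) : ℝ) (1 / 2)).indicator 1 with hdef
  have hind : ∀ x : Pt d, (cube d).indicator (1 : Pt d → ℝ) x = ∏ i, h (x i) := by
    intro x
    by_cases hx : x ∈ cube d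
    · rw [indicator_of_mem hx, Finset.prod_eq_one fun i _ => indicator_of_mem (hx i) _]
      rfl
    · have : ∃ i, x i ∉ Ioo (-(1 / 2) : ℝ) (1 / 2) := by simpa [cube] using hx
      obtain ⟨i, hi⟩ := this
      rw [indicator_of_notMem hx, Finset.prod_eq_zero (Finset.mem_univ i)]
      exact indicator_of_notMem hi _
  have e1 : ∀ k : Fin d → ℤ, ∫ x in cube d, f (x + latticeVec k)
      = ∫ x, (∏ i, h (x i - k i)) * f x := by
    intro k
    rw [← integral_indicator (isOpen_cube d).measurableSet,
      ← integral_add_right_eq_self (fun x => (∏ i, h (x i - k i)) * f x) (latticeVec k)]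
    refine integral_congr_ae (ae_of_all _ fun x => ?_)
    have : (cube d).indicator (fun x => f (x + latticeVec k)) x
        = (cube d).indicator (1 : Pt d → ℝ) x * f (x + latticeVec k) := by
      by_cases hx : x ∈ cube d <;> simp [hx]
    simp only [this, hind]
    simp [latticeVec]
  have i1 : ∀ k : Fin d → ℤ, Integrable (fun x => (∏ i, h (x i - k i)) * f x) := by
    intro k
    refine hf.bdd_mul (c := 1) ?_ (ae_of_all _ fun x => ?_)
    · refine Measurable.aestronglyMeasurable (Finset.measurable_fun_prod _ fun i _ => ?_)
      refine (measurable_one.indicator measurableSet_Ioo).comp ?_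
      exact (PiLp.continuous_apply 2 (fun _ : Fin d => ℝ) i).measurable.sub_const _
    · rw [norm_prod]
      refine Finset.prod_le_one (fun _ _ => norm_nonneg _) fun i _ => ?_
      rw [hdef]
      refine (norm_indicator_le_norm_self _ _).trans ?_
      simp
  simp only [e1]
  rw [← integral_finsetSum _ fun k _ => i1 k]
  refine integral_congr_ae ?_
  -- the translated open cubes cover the support of `f` up to the null set of their faces
  have hne : ∀ᵐ x ∂(volume : Measure (Pt d)), ∀ i, x i ≠ 1 / 2 ∧ x i ≠ -(1 / 2) :=
    ae_all_iff.2 fun i => (ae_apply_ne i _).and (ae_apply_ne i _)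
  filter_upwards [hne] with x hx
  rw [← Finset.sum_mul, sum_shifts_prod fun i m => h (x i - m)]
  by_cases hfx : f x = 0
  · simp [hfx]
  obtain ⟨h1, h2⟩ := h0 x hfx
  rw [Finset.prod_eq_one, one_mul]
  intro i _
  by_cases hi : i = 0
  · subst hi
    simp only [shiftRange, if_true, Finset.sum_singleton, Int.cast_zero, sub_zero]
    have h6 : x 0 ∈ Ioo (-(1 / 2) : ℝ) (1 / 2) :=
      ⟨lt_of_le_of_ne (abs_le.1 h1).1 (hx 0).2.symm, lt_of_le_of_ne (abs_le.1 h1).2 (hx 0).1⟩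
    exact indicator_of_mem h6 _
  · have hs : shiftRange i = {-1, 0, 1} := by simp [shiftRange, hi]
    rw [hs, Finset.sum_insert (by decide), Finset.sum_insert (by decide), Finset.sum_singleton]
    obtain ⟨h3, h4⟩ := hx i
    have h5 := abs_le.1 (h2 i hi)
    simp only [hdef, indicator, mem_Ioo, Pi.one_apply]
    push_cast
    rcases lt_or_gt_of_ne h3 with h6 | h6
    · rcases lt_or_gt_of_ne h4 with h7 | h7
      · rw [if_pos ⟨by linarith, by linarith⟩, if_neg (by intro h; linarith [h.1]),
          if_neg (by intro h; linarith [h.1])]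
        norm_num
      · rw [if_neg (by intro h; linarith [h.2]), if_pos ⟨by linarith, by linarith⟩,
          if_neg (by intro h; linarith [h.1])]
        norm_num
    · rw [if_neg (by intro h; linarith [h.2]), if_neg (by intro h; linarith [h.2]),
        if_pos ⟨by linarith, by linarith⟩]
      norm_num

/-! ### A partition of unity -/

/-- A smooth bump on the line, supported in `[-1, 1]`, whose integer translates add up to one. -/
def cellBump (s : ℝ) : ℝ := Real.smoothTransition (s + 1) - Real.smoothTransition s

theorem contDiff_cellBump : ContDiff ℝ ∞ cellBump :=
  (Real.smoothTransition.contDiff.comp (contDiff_id.add contDiff_const)).sub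
    Real.smoothTransition.contDiff

theorem abs_le_of_cellBump_ne_zero {s : ℝ} (h : cellBump s ≠ 0) : |s| ≤ 1 := by
  by_contra hs
  refine h ?_
  rcases lt_abs.1 (not_le.1 hs) with h1 | h1
  · rw [cellBump, Real.smoothTransition.one_of_one_le (by linarith),
      Real.smoothTransition.one_of_one_le h1.le, sub_self]
  · rw [cellBump, Real.smoothTransition.zero_of_nonpos (by linarith),
      Real.smoothTransition.zero_of_nonpos (by linarith), sub_self]

theorem sum_cellBump {s : ℝ} (hs : s ∈ Ioo (-(1 / 2) : ℝ) (1 / 2)) :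
    ∑ m ∈ ({-1, 0, 1} : Finset ℤ), cellBump (s + m) = 1 := by
  rw [Finset.sum_insert (by decide), Finset.sum_insert (by decide), Finset.sum_singleton]
  simp only [cellBump]
  push_cast
  rw [Real.smoothTransition.one_of_one_le (x := s + 1 + 1) (by linarith [hs.1]),
    Real.smoothTransition.zero_of_nonpos (x := s + -1) (by linarith [hs.2])]
  simp

/-- A smooth function on the line that is `1` on `[-1, 1]` and `0` outside `[-2, 2]`. -/
def plateau (s : ℝ) : ℝ := Real.smoothTransition (2 - s) * Real.smoothTransition (2 + s)

theorem contDiff_plateau : ContDiff ℝ ∞ plateau :=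
  (Real.smoothTransition.contDiff.comp (contDiff_const.sub contDiff_id)).mul
    (Real.smoothTransition.contDiff.comp (contDiff_const.add contDiff_id))

theorem plateau_of_abs_le {s : ℝ} (hs : |s| ≤ 1) : plateau s = 1 := by
  have h := abs_le.1 hs
  rw [plateau, Real.smoothTransition.one_of_one_le (by linarith),
    Real.smoothTransition.one_of_one_le (by linarith), one_mul]

theorem abs_le_of_plateau_ne_zero {s : ℝ} (h : plateau s ≠ 0) : |s| ≤ 2 := by
  by_contra hs
  refine h ?_
  rcases lt_abs.1 (not_le.1 hs) with h1 | h1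
  · rw [plateau, Real.smoothTransition.zero_of_nonpos (x := 2 - s) (by linarith), zero_mul]
  · rw [plateau, Real.smoothTransition.zero_of_nonpos (x := 2 + s) (by linarith), mul_zero]

/-- The test function `α(x₀) ∏_{i ≠ 0} β(xᵢ)`, with `α = plateau` and `β = cellBump`. -/
def cellTest (x : Pt d) : ℝ := ∏ i, (if i = 0 then plateau else cellBump) (x i)

theorem contDiff_cellTest : ContDiff ℝ ∞ (cellTest : Pt d → ℝ) := by
  refine contDiff_prod fun i _ => ?_
  have h1 : ContDiff ℝ ∞ fun x : Pt d => x i := (EuclideanSpace.proj (𝕜 := ℝ) i).contDiff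
  split_ifs
  · exact contDiff_plateau.comp h1
  · exact contDiff_cellBump.comp h1

theorem abs_le_of_cellTest_ne_zero {x : Pt d} (hx : cellTest x ≠ 0) :
    |x 0| ≤ 2 ∧ ∀ i, i ≠ 0 → |x i| ≤ 1 := by
  have h := Finset.prod_ne_zero_iff.1 hx
  refine ⟨abs_le_of_plateau_ne_zero (by simpa using h 0 (Finset.mem_univ 0)), fun i hi => ?_⟩
  exact abs_le_of_cellBump_ne_zero (by simpa [hi] using h i (Finset.mem_univ i))

theorem isTest_cellTest : IsTest univ (cellTest : Pt d → ℝ) := by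
  refine ⟨contDiff_cellTest, HasCompactSupport.intro
    (isCompact_closedBall (0 : Pt d) (√(∑ _i : Fin d, (2 : ℝ) ^ 2))) fun x hx => ?_, subset_univ _⟩
  by_contra h
  refine hx (mem_closedBall_of_abs_le fun i => ?_)
  obtain ⟨h1, h2⟩ := abs_le_of_cellTest_ne_zero h
  by_cases hi : i = 0
  · rwa [hi]
  · exact (h2 i hi).trans one_le_two

theorem abs_le_of_mem_tsupport_cellTest {x : Pt d} (hx : x ∈ tsupport (cellTest : Pt d → ℝ))
    (i : Fin d) (hi : i ≠ 0) : |x i| ≤ 1 := by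
  have hcl : IsClosed {x : Pt d | |x i| ≤ 1} :=
    isClosed_le (PiLp.continuous_apply 2 (fun _ : Fin d => ℝ) i).abs continuous_const
  exact closure_minimal (fun x hx => (abs_le_of_cellTest_ne_zero hx).2 i hi) hcl hx

theorem sum_cellTest {x : Pt d} (hx : x ∈ cube d) :
    ∑ k ∈ shifts d, cellTest (x + latticeVec k) = 1 := by
  have e : ∀ k : Fin d → ℤ, cellTest (x + latticeVec k)
      = ∏ i, (fun (i : Fin d) (m : ℤ) =>
          (if i = 0 then plateau else cellBump) (x i + m)) i (k i) :=
    fun k => by simp [cellTest, latticeVec]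
  rw [Finset.sum_congr rfl fun k _ => e k,
    sum_shifts_prod fun i m => (if i = 0 then plateau else cellBump) (x i + m)]
  refine Finset.prod_eq_one fun i _ => ?_
  by_cases hi : i = 0
  · have h1 : |x i| ≤ 1 := abs_le.2 ⟨by linarith [(hx i).1], by linarith [(hx i).2]⟩
    subst hi
    simpa [shiftRange] using plateau_of_abs_le h1
  · simp only [shiftRange, hi, if_false]
    exact sum_cellBump (hx i)

theorem pderiv_sum_comp_add_right {φ : Pt d → ℝ} (hφ : Differentiable ℝ φ) (j : Fin d) (x : Pt d) :
    pderiv j (fun y : Pt d => ∑ k ∈ shifts d, φ (y + latticeVec k)) x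
      = ∑ k ∈ shifts d, pderiv j φ (x + latticeVec k) := by
  have hd : ∀ k : Fin d → ℤ, DifferentiableAt ℝ (fun x : Pt d => φ (x + latticeVec k)) x :=
    fun k => (hφ.comp (differentiable_id.add_const _)) x
  simp only [← pderiv_comp_add_right]
  simp only [pderiv]
  rw [fderiv_fun_sum fun k _ => hd k]
  simp

theorem sum_pderiv_cellTest (j : Fin d) {x : Pt d} (hx : x ∈ cube d) :
    ∑ k ∈ shifts d, pderiv j cellTest (x + latticeVec k) = 0 := by
  have h1 : (fun y : Pt d => ∑ k ∈ shifts d, cellTest (y + latticeVec k)) =ᶠ[𝓝 x] fun _ => 1 := by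
    filter_upwards [(isOpen_cube d).mem_nhds hx] with y hy using sum_cellTest hy
  rw [← pderiv_sum_comp_add_right (contDiff_cellTest.differentiable (by simp)), pderiv,
    h1.fderiv_eq]
  simp

/-- A divergence free field `s`, periodic in all directions but the first, is orthogonal on the unit
cube to a gradient `g` that is periodic in the same directions and vanishes for `|x₀| > 1/2`. -/
theorem integral_cube_divFree_mul_grad {s g : Fin d → Pt d → ℝ} {v : Pt d → ℝ}
    (hs : ∀ j, IsL2loc (s j))
    (hdiv : ∀ φ : Pt d → ℝ, IsTest univ φ → ∫ x, ∑ j, s j x * pderiv j φ x = 0)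
    (hv : IsL2loc v) (hg : ∀ j, IsL2loc (g j))
    (hgrad : ∀ φ : Pt d → ℝ, IsTest (tsupport cellTest) φ → ∀ j,
      ∫ x, v x * pderiv j φ x = - ∫ x, g j x * φ x)
    (hsp : ∀ j, ∀ k ∈ shifts d, ∀ x, s j (x + latticeVec k) = s j x)
    (hvp : ∀ k ∈ shifts d, ∀ x, v (x + latticeVec k) = v x)
    (hgp : ∀ j, ∀ k ∈ shifts d, ∀ᵐ x, g j (x + latticeVec k) = g j x)
    (hv0 : ∀ x, v x ≠ 0 → |x 0| ≤ 1 / 2) (hg0 : ∀ j x, g j x ≠ 0 → |x 0| ≤ 1 / 2) :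
    ∫ x in cube d, ∑ j, g j x * s j x = 0 := by
  have hθ := isTest_cellTest (d := d)
  set θ : Pt d → ℝ := cellTest with hθdef
  have h := integral_divFree_mul_grad hs hdiv hv hg hθ hgrad
  set F : Pt d → ℝ := fun x => ∑ j, (v x * pderiv j θ x + g j x * θ x) * s j x with hF
  have hFi : Integrable F := by
    refine integrable_finsetSum _ fun j _ => ?_
    refine ((hv.integrable_mul_mul (hs j) (hθ.continuous_pderiv j).1
      (hθ.continuous_pderiv j).2).add ((hg j).integrable_mul_mul (hs j) hθ.1.continuous
        hθ.2.1)).congr (ae_of_all _ fun x => ?_)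
    simp only [Pi.add_apply]
    ring
  have hF0 : ∀ x, F x ≠ 0 → |x 0| ≤ 1 / 2 ∧ ∀ i, i ≠ 0 → |x i| ≤ 1 := by
    intro x hx
    refine ⟨?_, fun i hi => ?_⟩
    · by_contra hn
      have h1 : v x = 0 := by_contra fun h1 => hn (hv0 x h1)
      have h2 : ∀ j, g j x = 0 := fun j => by_contra fun h2 => hn (hg0 j x h2)
      exact hx (by simp [hF, h1, h2])
    · by_contra hn
      have h1 : x ∉ tsupport θ := fun hm => hn (abs_le_of_mem_tsupport_cellTest hm i hi)
      have h2 : θ x = 0 := image_eq_zero_of_notMem_tsupport h1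
      have h3 : fderiv ℝ θ x = 0 :=
        image_eq_zero_of_notMem_tsupport fun hm => h1 (tsupport_fderiv_subset ℝ hm)
      exact hx (by simp [hF, h2, pderiv, h3])
  rw [integral_eq_sum_cube hFi hF0, ← integral_finsetSum _ fun k _ =>
    (hFi.comp_add_right (latticeVec k)).integrableOn] at h
  rw [← h]
  refine integral_congr_ae ?_
  have hgp' : ∀ᵐ x ∂(volume : Measure (Pt d)), ∀ j, ∀ k ∈ shifts d,
      g j (x + latticeVec k) = g j x :=
    ae_all_iff.2 fun j => (Finset.eventually_all _).2 (hgp j)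
  filter_upwards [ae_restrict_of_ae hgp', ae_restrict_mem (isOpen_cube d).measurableSet]
    with x hx hxc
  have e : ∑ k ∈ shifts d, F (x + latticeVec k)
      = ∑ j, (v x * (∑ k ∈ shifts d, pderiv j θ (x + latticeVec k))
          + g j x * ∑ k ∈ shifts d, θ (x + latticeVec k)) * s j x := by
    simp only [hF]
    rw [Finset.sum_comm]
    refine Finset.sum_congr rfl fun j _ => ?_
    rw [Finset.mul_sum, Finset.mul_sum, ← Finset.sum_add_distrib, Finset.sum_mul]
    refine Finset.sum_congr rfl fun k hk => ?_
    rw [hvp k hk, hx j k hk, hsp j k hk]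
  simp only [e, hθdef, sum_cellTest hxc, sum_pderiv_cellTest _ hxc]
  simp

end Unfolding

end Plasticity

end

noncomputable section

namespace Plasticity

/-! ### Traces on the faces of the cube -/

section FaceTrace

/-- Strong convergence in `L²` implies convergence of the integrals against a function in `L²`. -/
theorem tendsto_integral_mul_of_eLpNorm {X : Type*} [MeasurableSpace X] {μ : Measure X}
    {F : ℕ → X → ℝ} {f a : X → ℝ} (hF : ∀ k, MemLp (F k) 2 μ) (hf : MemLp f 2 μ)
    (ha : MemLp a 2 μ) (hlim : Tendsto (fun k => eLpNorm (fun x => F k x - f x) 2 μ) atTop (𝓝 0)) :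
    Tendsto (fun k => ∫ x, F k x * a x ∂μ) atTop (𝓝 (∫ x, f x * a x ∂μ)) := by
  refine tendsto_integral_of_L1' _ (hf.1.mul ha.1)
    (Eventually.of_forall fun k => (hF k).integrable_mul ha) ?_
  have h0 : Tendsto (fun k => eLpNorm a 2 μ * eLpNorm (fun x => F k x - f x) 2 μ) atTop (𝓝 0) := by
    simpa using ENNReal.Tendsto.const_mul hlim (Or.inr ha.2.ne)
  refine tendsto_of_tendsto_of_tendsto_of_le_of_le tendsto_const_nhds h0 (fun k => zero_le) fun k => ?_
  have h1 := eLpNorm_smul_le_mul_eLpNorm (p := 2) (q := 2) (r := 1) ((hF k).sub hf).1 ha.1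
  refine (eLpNorm_congr_ae (ae_of_all _ fun x => ?_)).trans_le h1
  simp only [Pi.sub_apply, Pi.mul_apply, Pi.smul_apply', smul_eq_mul]
  ring

variable {d n : ℕ}

theorem isL2loc_of_continuous {F : Type} [NormedAddCommGroup F] [SecondCountableTopology F]
    {f : Pt d → F} (hf : Continuous f) : IsL2loc f := by
  intro S hS
  have : IsFiniteMeasure ((volume : Measure (Pt d)).restrict S) :=
    ⟨by simpa using hS.measure_lt_top⟩
  obtain ⟨M, hM⟩ := hS.exists_bound_of_continuousOn hf.continuousOn
  exact MemLp.of_bound hf.aestronglyMeasurable M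
    ((ae_restrict_iff' hS.measurableSet).2 (ae_of_all _ hM))

theorem IsL2loc.memLp_cube {F : Type} [NormedAddCommGroup F] {f : Pt d → F} (hf : IsL2loc f) :
    MemLp f 2 (volume.restrict (cube d)) :=
  (hf _ (isBounded_cube d).isCompact_closure).mono_measure
    (Measure.restrict_mono subset_closure le_rfl)

theorem memLp_coord {Ω : Set (Pt d)} {ι : Type} [Fintype ι] (u : L2 Ω (EuclideanSpace ℝ ι))
    (j : ι) : MemLp (fun x => u x j) 2 (volume.restrict Ω) :=
  (Lp.memLp u).of_le ((PiLp.continuous_apply 2 _ j).comp_aestronglyMeasurable (Lp.memLp u).1)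
    (ae_of_all _ fun x => PiLp.norm_apply_le (u x) j)

/-- The closed unit cube in the coordinate space of a face. -/
abbrev faceBox (n : ℕ) : Set (Fin n → ℝ) := Icc (fun _ => -(1 / 2)) (fun _ => 1 / 2)

/-- The point with first coordinate `c` and the remaining coordinates `y`. -/
def facePt (c : ℝ) (y : Fin n → ℝ) : Pt (n + 1) := WithLp.toLp 2 (Fin.insertNth 0 c y)

theorem continuous_facePt (c : ℝ) : Continuous (facePt c : (Fin n → ℝ) → Pt (n + 1)) :=
  (PiLp.continuous_toLp 2 _).comp (continuous_const.finInsertNth 0 continuous_id)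

theorem facePt_mem {c : ℝ} (hc : |c| = 1 / 2) {y : Fin n → ℝ} (hy : y ∈ faceBox n) :
    facePt c y ∈ {x | x ∈ frontier (cube (n + 1)) ∧ |x 0| = 1 / 2} := by
  have h0 : facePt c y 0 = c := by simp [facePt]
  refine ⟨?_, by rw [h0, hc]⟩
  rw [(isOpen_cube _).frontier_eq]
  refine ⟨?_, fun h => ?_⟩
  · have habs : ∀ i, |facePt c y i| ≤ 1 / 2 := by
      refine Fin.cases (by rw [h0, hc]) fun j => ?_
      have : facePt c y j.succ = y j := by simp [facePt]
      rw [this]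
      exact abs_le.2 ⟨hy.1 j, hy.2 j⟩
    have ht : Tendsto (fun m : ℕ => (1 - 1 / ((m : ℝ) + 1)) • facePt c y) atTop
        (𝓝 ((1 - 0 : ℝ) • facePt c y)) :=
      (tendsto_const_nhds.sub tendsto_one_div_add_atTop_nhds_zero_nat).smul_const _
    rw [sub_zero, one_smul] at ht
    refine mem_closure_of_tendsto ht (Eventually.of_forall fun m i => ?_)
    have hm : (0 : ℝ) < 1 / ((m : ℝ) + 1) := by positivity
    have hm1 : 1 / ((m : ℝ) + 1) ≤ 1 := by
      rw [div_le_one (by positivity)]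
      linarith [(Nat.cast_nonneg m : (0 : ℝ) ≤ m)]
    refine abs_lt.1 ?_
    rw [PiLp.smul_apply, smul_eq_mul, abs_mul, abs_of_nonneg (by linarith)]
    nlinarith [habs i, abs_nonneg (facePt c y i)]
  · have := abs_lt.2 (h 0)
    rw [h0, hc] at this
    exact lt_irrefl _ this

/-- Lebesgue measure on the coordinates of a face is bounded by the surface measure, because the
coordinate projection is `1`-Lipschitz for the sup norm. -/
theorem map_facePt_le {c : ℝ} (hc : |c| = 1 / 2) :
    (volume.restrict (faceBox n)).map (facePt c) ≤
      (surf (n + 1)).restrict {x | x ∈ frontier (cube (n + 1)) ∧ |x 0| = 1 / 2} := by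
  refine Measure.le_iff.2 fun A hA => ?_
  have hm := (continuous_facePt (n := n) c).measurable
  rw [Measure.map_apply hm hA, Measure.restrict_apply (hm hA), Measure.restrict_apply hA]
  set π : Pt (n + 1) → (Fin n → ℝ) := fun x j => x j.succ with hπ
  have hL : LipschitzWith 1 π := by
    refine LipschitzWith.of_dist_le_mul fun x y => ?_
    rw [NNReal.coe_one, one_mul, dist_pi_le_iff dist_nonneg]
    intro j
    rw [dist_eq_norm, dist_eq_norm]
    exact PiLp.norm_apply_le (x - y) j.succ
  have hsub : facePt c ⁻¹' A ∩ faceBox n ⊆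
      π '' (A ∩ {x | x ∈ frontier (cube (n + 1)) ∧ |x 0| = 1 / 2}) := by
    rintro y ⟨hy1, hy2⟩
    refine ⟨facePt c y, ⟨hy1, facePt_mem hc hy2⟩, ?_⟩
    ext j
    simp [hπ, facePt]
  have h1 := hL.hausdorffMeasure_image_le (d := (n : ℝ)) (Nat.cast_nonneg n)
    (A ∩ {x | x ∈ frontier (cube (n + 1)) ∧ |x 0| = 1 / 2})
  have h2 : (volume : Measure (Fin n → ℝ)) = Measure.hausdorffMeasure (n : ℝ) := by
    rw [← hausdorffMeasure_pi_real, Fintype.card_fin]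
  have h3 : surf (n + 1) = Measure.hausdorffMeasure (n : ℝ) := by
    rw [surf]
    congr 1
    push_cast
    ring
  rw [h2, h3]
  refine (measure_mono hsub).trans (h1.trans ?_)
  simp

/-- The integral over the cube of a derivative in the first coordinate direction. -/
theorem integral_cube_pderiv_zero {f : Pt (n + 1) → ℝ} (hf : ContDiff ℝ ∞ f) :
    ∫ x in cube (n + 1), pderiv 0 f x =
      (∫ y in faceBox n, f (facePt (1 / 2) y)) - ∫ y in faceBox n, f (facePt (-(1 / 2)) y) := by
  set e : (Fin (n + 1) → ℝ) ≃L[ℝ] Pt (n + 1) :=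
    (PiLp.continuousLinearEquiv 2 ℝ fun _ : Fin (n + 1) => ℝ).symm with he
  have hd : Differentiable ℝ f := hf.differentiable (by simp)
  have hpc : Continuous (pderiv 0 f) := (hf.continuous_fderiv (by simp)).clm_apply continuous_const
  have e1 : ∫ x in cube (n + 1), pderiv 0 f x
      = ∫ y in Icc (fun _ : Fin (n + 1) => (-(1 / 2) : ℝ)) (fun _ => 1 / 2), pderiv 0 f (e y) := by
    rw [volume_pi, ← setIntegral_congr_set Measure.univ_pi_Ioo_ae_eq_Icc, ← volume_pi,
      ← (PiLp.volume_preserving_toLp (Fin (n + 1))).setIntegral_preimage_emb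
        (MeasurableEquiv.toLp 2 (Fin (n + 1) → ℝ)).measurableEmbedding]
    congr 2
    ext y
    simp [cube]
  have hF : ∀ y, HasFDerivAt (fun y => f (e y))
      ((fderiv ℝ f (e y)).comp (e : (Fin (n + 1) → ℝ) →L[ℝ] Pt (n + 1))) y :=
    fun y => (hd (e y)).hasFDerivAt.comp y e.hasFDerivAt
  have h := integral_divergence_of_hasFDerivAt_off_countable'
    (fun _ : Fin (n + 1) => (-(1 / 2) : ℝ)) (fun _ => 1 / 2) (fun _ => by norm_num)
    -- the vector field whose only nonzero component is the first one
    (fun i => if i = 0 then fun y => f (e y) else 0)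
    (fun i y => if i = 0 then
      (fderiv ℝ f (e y)).comp (e : (Fin (n + 1) → ℝ) →L[ℝ] Pt (n + 1)) else 0)
    ∅ countable_empty ?_ ?_ ?_
  · rw [e1]
    refine Eq.trans ?_ (h.trans ?_)
    · refine integral_congr_ae (ae_of_all _ fun y => ?_)
      simp only
      rw [Finset.sum_eq_single 0 (fun j _ hj => by simp [hj]) (by simp)]
      simp [pderiv, he]
    · rw [Finset.sum_eq_single 0 (fun j _ hj => by simp [hj]) (by simp)]
      simp only [if_true]
      rfl
  · intro i
    split_ifs
    · exact (hf.continuous.comp e.continuous).continuousOn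
    · exact continuousOn_const
  · intro y _ i
    by_cases hi : i = 0
    · simpa [hi] using hF y
    · simp only [hi, if_false]
      exact hasFDerivAt_const (0 : ℝ) y
  · refine Continuous.integrableOn_Icc ?_
    refine continuous_finsetSum _ fun i _ => ?_
    by_cases hi : i = 0
    · simp only [hi, if_true]
      exact ((hf.continuous_fderiv (by simp)).comp e.continuous).clm_apply continuous_const
    · simp only [hi, if_false]
      exact continuous_const

/-- Integration by parts in the first coordinate direction on the cube, for a function whose trace
vanishes on the two faces orthogonal to this direction. -/
theorem integral_cube_of_traceZeroOn {ψ : H1 (cube (n + 1))}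
    (hψ : TraceZeroOn (cube (n + 1)) {x | x ∈ frontier (cube (n + 1)) ∧ |x 0| = 1 / 2} ψ)
    {a : Pt (n + 1) → ℝ} (ha : ContDiff ℝ ∞ a) (i : Fin (n + 1)) :
    ∫ x in cube (n + 1), value ψ x i * pderiv 0 a x =
      - ∫ x in cube (n + 1), grad ψ x (i, 0) * a x := by
  obtain ⟨g, ⟨_, φ, hφ, hv, hg, hb⟩, hg0⟩ := hψ
  have hda : Continuous (pderiv 0 a) := (ha.continuous_fderiv (by simp)).clm_apply continuous_const
  have hφi : ∀ k, ContDiff ℝ ∞ fun x => φ k x i := fun k =>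
    (EuclideanSpace.proj (𝕜 := ℝ) i).contDiff.comp (hφ k)
  have hgm : ∀ k x, gradMat (φ k) x (i, 0) = pderiv 0 (fun x => φ k x i) x := by
    intro k x
    have h1 := ((EuclideanSpace.proj (𝕜 := ℝ) i).hasFDerivAt (x := φ k x)).comp x
      ((hφ k).differentiable (by simp) x).hasFDerivAt
    have h2 : fderiv ℝ (fun x => φ k x i) x = _ := h1.fderiv
    rw [pderiv, h2]
    rfl
  have hmono : ∀ {ι : Type} [Fintype ι] {X : Type} [MeasurableSpace X] {μ : Measure X}
      (u w : X → EuclideanSpace ℝ ι) (j : ι),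
      eLpNorm (fun x => u x j - w x j) 2 μ ≤ eLpNorm (fun x => u x - w x) 2 μ :=
    fun u w j => eLpNorm_mono fun x => PiLp.norm_apply_le (u x - w x) j
  have hdc : ∀ k, Continuous (pderiv 0 fun x => φ k x i) := fun k =>
    ((hφi k).continuous_fderiv (by simp)).clm_apply continuous_const
  have t1 : Tendsto (fun k => ∫ x in cube (n + 1), φ k x i * pderiv 0 a x) atTop
      (𝓝 (∫ x in cube (n + 1), value ψ x i * pderiv 0 a x)) :=
    tendsto_integral_mul_of_eLpNorm
      (fun k => (isL2loc_of_continuous (hφi k).continuous).memLp_cube) (memLp_coord _ i)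
      (isL2loc_of_continuous hda).memLp_cube
      (tendsto_of_tendsto_of_tendsto_of_le_of_le tendsto_const_nhds hv (fun _ => zero_le)
        fun k => hmono (φ k) _ i)
  have t2 : Tendsto (fun k => ∫ x in cube (n + 1), pderiv 0 (fun x => φ k x i) x * a x) atTop
      (𝓝 (∫ x in cube (n + 1), grad ψ x (i, 0) * a x)) := by
    simp only [← hgm]
    refine tendsto_integral_mul_of_eLpNorm
      (fun k => ?_) (memLp_coord _ (i, 0)) (isL2loc_of_continuous ha.continuous).memLp_cube
      (tendsto_of_tendsto_of_tendsto_of_le_of_le tendsto_const_nhds hg (fun _ => zero_le)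
        fun k => hmono (gradMat (φ k)) _ (i, 0))
    simp only [hgm]
    exact (isL2loc_of_continuous (hdc k)).memLp_cube
  -- the boundary terms tend to zero, as the trace vanishes on both faces
  have t3 : ∀ c : ℝ, |c| = 1 / 2 →
      Tendsto (fun k => ∫ y in faceBox n, φ k (facePt c y) i * a (facePt c y)) atTop (𝓝 0) := by
    intro c hc
    have hfc := continuous_facePt (n := n) c
    have hbox : ∀ {h : (Fin n → ℝ) → ℝ}, Continuous h → MemLp h 2 (volume.restrict (faceBox n)) :=
      fun {h} hh => by
        have : IsFiniteMeasure ((volume : Measure (Fin n → ℝ)).restrict (faceBox n)) :=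
          ⟨by simpa using isCompact_Icc.measure_lt_top⟩
        obtain ⟨M, hM⟩ := (isCompact_Icc (a := fun _ : Fin n => (-(1 / 2) : ℝ))
          (b := fun _ => 1 / 2)).exists_bound_of_continuousOn hh.continuousOn
        exact MemLp.of_bound hh.aestronglyMeasurable M
          ((ae_restrict_iff' measurableSet_Icc).2 (ae_of_all _ hM))
    have h0 : ∫ y in faceBox n, (0 : ℝ) * a (facePt c y) = 0 := by simp
    rw [← h0]
    refine tendsto_integral_mul_of_eLpNorm (f := fun _ => 0)
      (fun k => hbox ((hφi k).continuous.comp hfc)) MemLp.zero' (hbox (ha.continuous.comp hfc)) ?_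
    refine tendsto_of_tendsto_of_tendsto_of_le_of_le tendsto_const_nhds hb (fun _ => zero_le)
      fun k => ?_
    calc eLpNorm (fun y => φ k (facePt c y) i - 0) 2 (volume.restrict (faceBox n))
        ≤ eLpNorm (φ k ∘ facePt c) 2 (volume.restrict (faceBox n)) :=
          eLpNorm_mono fun y => by
            rw [sub_zero]
            exact PiLp.norm_apply_le (φ k (facePt c y)) i
      _ = eLpNorm (φ k) 2 ((volume.restrict (faceBox n)).map (facePt c)) :=
          (eLpNorm_map_measure (hφ k).continuous.aestronglyMeasurable hfc.aemeasurable).symm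
      _ ≤ eLpNorm (φ k) 2
            ((surf (n + 1)).restrict {x | x ∈ frontier (cube (n + 1)) ∧ |x 0| = 1 / 2}) :=
          eLpNorm_mono_measure _ (map_facePt_le hc)
      _ = eLpNorm (fun x => φ k x - g x) 2
            ((surf (n + 1)).restrict {x | x ∈ frontier (cube (n + 1)) ∧ |x 0| = 1 / 2}) := by
          refine eLpNorm_congr_ae ?_
          filter_upwards [hg0] with x hx
          simp [hx]
      _ ≤ eLpNorm (fun x => φ k x - g x) 2 ((surf (n + 1)).restrict (frontier (cube (n + 1)))) :=
          eLpNorm_mono_measure _ (Measure.restrict_mono (fun x hx => hx.1) le_rfl)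
  have hI : ∀ k, (∫ x in cube (n + 1), φ k x i * pderiv 0 a x)
      + ∫ x in cube (n + 1), pderiv 0 (fun x => φ k x i) x * a x
      = (∫ y in faceBox n, φ k (facePt (1 / 2) y) i * a (facePt (1 / 2) y))
        - ∫ y in faceBox n, φ k (facePt (-(1 / 2)) y) i * a (facePt (-(1 / 2)) y) := by
    intro k
    rw [← integral_cube_pderiv_zero ((hφi k).mul ha), ← integral_add]
    · refine integral_congr_ae (ae_of_all _ fun x => ?_)
      simp only
      rw [pderiv_mul ((hφi k).differentiable (by simp)) (ha.differentiable (by simp))]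
      ring
    · exact (isL2loc_of_continuous (hφi k).continuous).memLp_cube.integrable_mul
        (isL2loc_of_continuous hda).memLp_cube
    · exact (isL2loc_of_continuous (hdc k)).memLp_cube.integrable_mul
        (isL2loc_of_continuous ha.continuous).memLp_cube
  have t4 := (t3 (1 / 2) (by norm_num)).sub (t3 (-(1 / 2)) (by norm_num))
  simp only [← hI, sub_self] at t4
  linarith [tendsto_nhds_unique (t1.add t2) t4]

end FaceTrace

end Plasticity

end

noncomputable section

namespace Plasticity

/-! ### Orthogonality of stresses and admissible strain rates -/

section Orthogonality

variable {d : ℕ}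

/-- The fundamental lemma of the calculus of variations. -/
theorem ae_eq_of_integral_test_eq {U : Set (Pt d)} (hU : IsOpen U) {f g : Pt d → ℝ}
    (hf : LocallyIntegrable f (volume.restrict U)) (hg : LocallyIntegrable g (volume.restrict U))
    (h : ∀ φ : Pt d → ℝ, IsTest U φ → ∫ x in U, f x * φ x = ∫ x in U, g x * φ x) :
    f =ᵐ[volume.restrict U] g := by
  have h0 := hU.ae_eq_zero_of_integral_contDiff_smul_eq_zero
    ((hf.sub hg).locallyIntegrableOn U) fun φ h1 h2 h3 => by
      have hfi := hf.integrable_smul_left_of_hasCompactSupport h1.continuous h2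
      have hgi := hg.integrable_smul_left_of_hasCompactSupport h1.continuous h2
      have h4 := h φ ⟨h1, h2, h3⟩
      simp only [Pi.sub_apply, smul_sub]
      rw [integral_sub hfi hgi, sub_eq_zero]
      simpa only [smul_eq_mul, mul_comm] using h4
  filter_upwards [h0, ae_restrict_mem hU.measurableSet] with x hx hxU
  simpa [sub_eq_zero] using hx hxU

theorem IsTest.comp_add_right {φ : Pt d → ℝ} (hφ : IsTest univ φ) (a : Pt d) :
    IsTest univ fun x => φ (x + a) :=
  ⟨hφ.1.comp (contDiff_id.add contDiff_const),
    hφ.2.1.comp_homeomorph (Homeomorph.addRight a), subset_univ _⟩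

/-- The weak gradient of a periodic function is periodic. -/
theorem ae_apply_add_eq_of_weakGrad {v : Pt d → ℝ} {g : Pt d → ℝ} {j : Fin d} {a : Pt d}
    (hg : IsL2loc g) (hgrad : ∀ φ : Pt d → ℝ, IsTest univ φ →
      ∫ x, v x * pderiv j φ x = - ∫ x, g x * φ x)
    (hv : ∀ x, v (x + a) = v x) : ∀ᵐ x, g (x + a) = g x := by
  have hga : LocallyIntegrable (fun x => g (x + a)) := by
    refine locallyIntegrable_iff.2 fun k hk => ?_
    have h1 : IsCompact ((fun x => x + a) '' k) := hk.image (continuous_id.add continuous_const)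
    have h2 := hg.locallyIntegrable.integrableOn_isCompact h1
    exact ((measurePreserving_add_right volume a).integrableOn_image
      (MeasurableEquiv.addRight a).measurableEmbedding).1 h2
  have h := ae_eq_of_integral_test_eq (U := univ) isOpen_univ (f := fun x => g (x + a)) (g := g)
    (by simpa using hga) (by simpa using hg.locallyIntegrable) fun φ hφ => by
      simp only [Measure.restrict_univ]
      have h1 := hgrad _ (hφ.comp_add_right (-a))
      simp only [pderiv_comp_add_right] at h1
      rw [← integral_add_right_eq_self (fun x => v x * pderiv j φ (x + -a)) a,
        ← integral_add_right_eq_self (fun x => g x * φ (x + -a)) a] at h1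
      simp only [add_neg_cancel_right, hv] at h1
      linarith [hgrad φ hφ]
  rwa [Measure.restrict_univ] at h

theorem pderiv_comp_apply_of_ne [NeZero d] {χ : ℝ → ℝ} (hχ : Differentiable ℝ χ) {j : Fin d}
    (hj : j ≠ 0) (x : Pt d) : pderiv j (fun x : Pt d => χ (x 0)) x = 0 := by
  have h1 : HasFDerivAt (fun x : Pt d => x 0) (EuclideanSpace.proj (𝕜 := ℝ) 0) x :=
    (EuclideanSpace.proj (𝕜 := ℝ) (0 : Fin d)).hasFDerivAt
  have h2 := (hχ (x 0)).hasDerivAt.comp_hasFDerivAt x h1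
  have h3 : fderiv ℝ (fun x : Pt d => χ (x 0)) x = _ := h2.fderiv
  rw [pderiv, h3]
  simp [Ne.symm hj]

/-- Smooth functions on the line that converge to the indicator function of `(-1/2, 1/2)`. -/
def cutoff (m : ℕ) (s : ℝ) : ℝ :=
  Real.smoothTransition (m * (1 / 2 - s)) * Real.smoothTransition (m * (1 / 2 + s))

theorem contDiff_cutoff (m : ℕ) : ContDiff ℝ ∞ (cutoff m) :=
  (Real.smoothTransition.contDiff.comp (contDiff_const.mul (contDiff_const.sub contDiff_id))).mul
    (Real.smoothTransition.contDiff.comp (contDiff_const.mul (contDiff_const.add contDiff_id)))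

theorem abs_cutoff_le (m : ℕ) (s : ℝ) : |cutoff m s| ≤ 1 := by
  rw [cutoff, abs_of_nonneg (mul_nonneg (Real.smoothTransition.nonneg _)
    (Real.smoothTransition.nonneg _))]
  exact mul_le_one₀ (Real.smoothTransition.le_one _) (Real.smoothTransition.nonneg _)
    (Real.smoothTransition.le_one _)

theorem tendsto_cutoff (s : ℝ) : Tendsto (fun m => cutoff m s) atTop
    (𝓝 ((Ioo (-(1 / 2) : ℝ) (1 / 2)).indicator 1 s)) := by
  refine tendsto_const_nhds.congr' ?_
  by_cases hs : s ∈ Ioo (-(1 / 2) : ℝ) (1 / 2)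
  · have hev : ∀ r : ℝ, 0 < r → ∀ᶠ m : ℕ in atTop, 1 ≤ (m : ℝ) * r := fun r hr =>
      (tendsto_natCast_atTop_atTop.atTop_mul_const hr).eventually_ge_atTop 1
    filter_upwards [hev (1 / 2 - s) (by linarith [hs.2]), hev (1 / 2 + s) (by linarith [hs.1])]
      with m h1 h2
    rw [indicator_of_mem hs, cutoff, Real.smoothTransition.one_of_one_le h1,
      Real.smoothTransition.one_of_one_le h2, one_mul, Pi.one_apply]
  · refine Eventually.of_forall fun m => ?_
    rw [indicator_of_notMem hs]
    simp only [cutoff]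
    rcases le_or_gt (1 / 2) s with h | h
    · rw [Real.smoothTransition.zero_of_nonpos (x := m * (1 / 2 - s))
        (mul_nonpos_of_nonneg_of_nonpos (Nat.cast_nonneg m) (by linarith)), zero_mul]
    · have h' : s ≤ -(1 / 2) := not_lt.1 fun h1 => hs ⟨h1, h⟩
      rw [Real.smoothTransition.zero_of_nonpos (x := m * (1 / 2 + s))
        (mul_nonpos_of_nonneg_of_nonpos (Nat.cast_nonneg m) (by linarith)), mul_zero]

/-- The skew-symmetric part of a matrix is orthogonal to symmetric matrices. -/
theorem inner_symPart {σ : Msym d} {A : Mat d} :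
    inner ℝ σ (symPart d A) = ∑ i, ∑ j, A (i, j) * (σ : Mat d) (i, j) := by
  have h1 : inner ℝ σ (symPart d A)
      = ∑ i, ∑ j, (A (i, j) + A (j, i)) / 2 * (σ : Mat d) (i, j) := by
    rw [Submodule.coe_inner, PiLp.inner_apply, Fintype.sum_prod_type]
    rfl
  have h2 : ∑ i, ∑ j, A (j, i) * (σ : Mat d) (i, j) = ∑ i, ∑ j, A (i, j) * (σ : Mat d) (i, j) := by
    rw [Finset.sum_comm]
    exact Finset.sum_congr rfl fun i _ => Finset.sum_congr rfl fun j _ => by rw [σ.2 j i]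
  have h3 : ∑ i, ∑ j, (A (i, j) + A (j, i)) / 2 * (σ : Mat d) (i, j)
      = (∑ i, ∑ j, A (i, j) * (σ : Mat d) (i, j) + ∑ i, ∑ j, A (j, i) * (σ : Mat d) (i, j)) / 2 := by
    rw [← Finset.sum_add_distrib, Finset.sum_div]
    refine Finset.sum_congr rfl fun i _ => ?_
    rw [← Finset.sum_add_distrib, Finset.sum_div]
    exact Finset.sum_congr rfl fun j _ => by ring
  rw [h1, h3, h2]
  ring

variable [NeZero d]

/-- The strip `|x₀| < 1/2`. -/
def strip (d : ℕ) [NeZero d] : Set (Pt d) := {x | x 0 ∈ Ioo (-(1 / 2) : ℝ) (1 / 2)}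

theorem measurableSet_strip : MeasurableSet (strip d) :=
  (isOpen_Ioo.preimage (PiLp.continuous_apply 2 (fun _ : Fin d => ℝ) 0)).measurableSet

theorem IsL2loc.indicator_strip {f : Pt d → ℝ} (hf : IsL2loc f) :
    IsL2loc ((strip d).indicator f) :=
  fun S hS => (hf S hS).indicator measurableSet_strip

theorem abs_le_of_indicator_strip_ne_zero {f : Pt d → ℝ} {x : Pt d}
    (hx : (strip d).indicator f x ≠ 0) : |x 0| ≤ 1 / 2 := by
  have h : x ∈ strip d := by_contra fun h => hx (indicator_of_notMem h f)
  exact (abs_lt.2 h).le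

theorem add_latticeVec_mem_strip {k : Fin d → ℤ} (hk : k ∈ shifts d) {x : Pt d} :
    x + latticeVec k ∈ strip d ↔ x ∈ strip d := by
  simp [strip, latticeVec, shifts_zero hk]

theorem indicator_strip_add_latticeVec {k : Fin d → ℤ} (hk : k ∈ shifts d) (f : Pt d → ℝ)
    (x : Pt d) : (strip d).indicator f (x + latticeVec k)
      = (strip d).indicator (fun _ => f (x + latticeVec k)) x := by
  by_cases hx : x ∈ strip d
  · rw [indicator_of_mem hx, indicator_of_mem ((add_latticeVec_mem_strip hk).2 hx)]
  · rw [indicator_of_notMem hx,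
      indicator_of_notMem fun h => hx ((add_latticeVec_mem_strip hk).1 h)]

theorem tendsto_integral_cutoff {f b : Pt d → ℝ} (hf : IsL2loc f) (hb : Continuous b)
    (hbc : HasCompactSupport b) :
    Tendsto (fun m => ∫ x, f x * (b x * cutoff m (x 0))) atTop
      (𝓝 (∫ x, (strip d).indicator f x * b x)) := by
  have hi := hf.integrable_mul hb hbc
  have hc : ∀ m, Continuous fun x : Pt d => cutoff m (x 0) := fun m =>
    (contDiff_cutoff m).continuous.comp (PiLp.continuous_apply 2 (fun _ : Fin d => ℝ) 0)
  refine tendsto_integral_of_dominated_convergence (fun x => ‖f x * b x‖) (fun m => ?_) hi.norm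
    (fun m => ae_of_all _ fun x => ?_) (ae_of_all _ fun x => ?_)
  · exact (hf.integrable_mul (hb.mul (hc m)) hbc.mul_right).1
  · rw [← mul_assoc, norm_mul]
    exact mul_le_of_le_one_right (norm_nonneg _) (abs_cutoff_le m (x 0))
  · have h1 := (tendsto_cutoff (x 0)).const_mul (f x * b x)
    have e : (strip d).indicator f x * b x
        = f x * b x * (Ioo (-(1 / 2) : ℝ) (1 / 2)).indicator 1 (x 0) := by
      by_cases hx : x ∈ strip d
      · rw [indicator_of_mem hx, indicator_of_mem (show x 0 ∈ Ioo (-(1 / 2) : ℝ) (1 / 2) from hx)]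
        simp
      · rw [indicator_of_notMem hx,
          indicator_of_notMem (show x 0 ∉ Ioo (-(1 / 2) : ℝ) (1 / 2) from hx)]
        simp
    rw [e]
    simpa only [mul_assoc] using h1

/-- Truncation to the strip does not affect weak derivatives tangential to its boundary. -/
theorem integral_strip_mul_pderiv_of_ne {v g : Pt d → ℝ} (hv : IsL2loc v) (hg : IsL2loc g)
    {j : Fin d} (hj : j ≠ 0) (hgrad : ∀ φ : Pt d → ℝ, IsTest univ φ →
      ∫ x, v x * pderiv j φ x = - ∫ x, g x * φ x)
    {φ : Pt d → ℝ} (hφ : IsTest univ φ) :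
    ∫ x, (strip d).indicator v x * pderiv j φ x = - ∫ x, (strip d).indicator g x * φ x := by
  have hc : ∀ m, ContDiff ℝ ∞ fun x : Pt d => cutoff m (x 0) := fun m =>
    (contDiff_cutoff m).comp (EuclideanSpace.proj (𝕜 := ℝ) (0 : Fin d)).contDiff
  have h1 := tendsto_integral_cutoff hv (hφ.continuous_pderiv j).1 (hφ.continuous_pderiv j).2
  have h2 := (tendsto_integral_cutoff hg hφ.1.continuous hφ.2.1).neg
  -- `cutoff m (x 0) * φ` is a test function, and `∂ⱼ` does not see the cutoff
  refine tendsto_nhds_unique h1 (h2.congr fun m => ?_)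
  rw [← hgrad _ (hφ.mul (hc m))]
  refine integral_congr_ae (ae_of_all _ fun x => ?_)
  simp only
  rw [pderiv_mul (hφ.1.differentiable (by simp)) ((hc m).differentiable (by simp)),
    pderiv_comp_apply_of_ne ((contDiff_cutoff m).differentiable (by simp)) hj, mul_zero, add_zero]

/-- Unfolding of the integral over the strip of a periodic function times a test function. -/
theorem integral_strip_mul_eq {f b : Pt d → ℝ} (hf : IsL2loc f)
    (hfp : ∀ k ∈ shifts d, ∀ᵐ x, f (x + latticeVec k) = f x) (hb : Continuous b)
    (hbc : HasCompactSupport b) (hb0 : ∀ x, b x ≠ 0 → ∀ i, i ≠ 0 → |x i| ≤ 1) :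
    ∫ x, (strip d).indicator f x * b x
      = ∫ x in cube d, f x * ∑ k ∈ shifts d, b (x + latticeVec k) := by
  have hi := hf.indicator_strip.integrable_mul hb hbc
  rw [integral_eq_sum_cube hi fun x hx => ⟨abs_le_of_indicator_strip_ne_zero (left_ne_zero_of_mul hx),
    hb0 x (right_ne_zero_of_mul hx)⟩, ← integral_finsetSum _ fun k _ =>
    (hi.comp_add_right (latticeVec k)).integrableOn]
  refine integral_congr_ae ?_
  filter_upwards [ae_restrict_of_ae ((Finset.eventually_all _).2 hfp),
    ae_restrict_mem (isOpen_cube d).measurableSet] with x hx hxc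
  rw [Finset.mul_sum]
  refine Finset.sum_congr rfl fun k hk => ?_
  rw [indicator_of_mem ((add_latticeVec_mem_strip hk).2 (hxc 0)), hx k hk]

/-- In the Dirichlet-Periodic case, a displacement whose trace vanishes on the two faces may be
extended by zero across them; so its periodic extension, truncated to the strip, has the truncated
gradient as its weak gradient. -/
theorem integral_strip_mul_pderiv {n : ℕ} {ψ : H1 (cube (n + 1))}
    (hψ : TraceZeroOn (cube (n + 1)) {x | x ∈ frontier (cube (n + 1)) ∧ |x 0| = 1 / 2} ψ)
    {U : Pt (n + 1) → Pt (n + 1)} {G : Pt (n + 1) → Mat (n + 1)} (hU : IsL2loc U)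
    (hG : IsL2loc G) (hUG : HasWeakGrad univ U G) (hUp : IsBarPeriodic U)
    (hUψ : U =ᵐ[volume.restrict (cube (n + 1))] value ψ)
    (hGp : ∀ i j, ∀ k ∈ shifts (n + 1), ∀ᵐ x, G (x + latticeVec k) (i, j) = G x (i, j))
    (hGψ : ∀ i j, (fun x => G x (i, j)) =ᵐ[volume.restrict (cube (n + 1))] fun x => grad ψ x (i, j))
    {φ : Pt (n + 1) → ℝ} (hφ : IsTest (tsupport cellTest) φ) (i j : Fin (n + 1)) :
    ∫ x, (strip (n + 1)).indicator (fun x => U x i) x * pderiv j φ x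
      = - ∫ x, (strip (n + 1)).indicator (fun x => G x (i, j)) x * φ x := by
  have hφ' : IsTest univ φ := ⟨hφ.1, hφ.2.1, subset_univ _⟩
  by_cases hj : j = 0
  · subst hj
    have hdφ := hφ'.continuous_pderiv 0
    set a : Pt (n + 1) → ℝ := fun x => ∑ k ∈ shifts (n + 1), φ (x + latticeVec k) with ha
    have hac : ContDiff ℝ ∞ a :=
      ContDiff.sum fun k _ => hφ.1.comp (contDiff_id.add contDiff_const)
    have h0 : ∀ x, x ∈ tsupport φ → ∀ l, l ≠ 0 → |x l| ≤ 1 := fun x hx =>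
      abs_le_of_mem_tsupport_cellTest (hφ.2.2 hx)
    rw [integral_strip_mul_eq (hU.coord i)
        (fun k hk => ae_of_all _ fun x => by rw [hUp.add_latticeVec hk]) hdφ.1 hdφ.2
        fun x hx => h0 x (by_contra fun hn => hx (by
          have : fderiv ℝ φ x = 0 :=
            image_eq_zero_of_notMem_tsupport fun hm => hn (tsupport_fderiv_subset ℝ hm)
          simp [pderiv, this])),
      integral_strip_mul_eq (hG.coord (i, 0)) (hGp i 0) hφ.1.continuous hφ.2.1
        fun x hx => h0 x (subset_tsupport φ hx)]
    simp only [← pderiv_sum_comp_add_right (hφ.1.differentiable (by simp))]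
    have h1 := integral_cube_of_traceZeroOn hψ hac i
    have e1 : ∫ x in cube (n + 1), U x i * pderiv 0 a x
        = ∫ x in cube (n + 1), value ψ x i * pderiv 0 a x :=
      integral_congr_ae (by filter_upwards [hUψ] with x hx; rw [hx])
    have e2 : ∫ x in cube (n + 1), G x (i, 0) * a x
        = ∫ x in cube (n + 1), grad ψ x (i, 0) * a x :=
      integral_congr_ae (by filter_upwards [hGψ i 0] with x hx; rw [hx])
    exact e1.trans (h1.trans (congrArg Neg.neg e2.symm))
  · exact integral_strip_mul_pderiv_of_ne (hU.coord i) (hG.coord (i, j)) hj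
      (fun φ hφ => by simpa using hUG φ hφ i j) hφ'

/-- On the unit cube, a periodic divergence free stress is orthogonal to the strains of periodic
displacements whose trace vanishes on the two remaining faces. -/
theorem inner_stress_strain_eq_zero_of_periodic {n : ℕ} {σ : L2 (cube (n + 1)) (Msym (n + 1))}
    {S : Pt (n + 1) → Msym (n + 1)} (hS : IsL2loc S) (hSp : IsBarPeriodic S)
    (hSdiv : HasWeakDiv univ S 0) (hSσ : S =ᵐ[volume.restrict (cube (n + 1))] σ)
    {ψ : H1 (cube (n + 1))}
    (hψ : TraceZeroOn (cube (n + 1)) {x | x ∈ frontier (cube (n + 1)) ∧ |x 0| = 1 / 2} ψ)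
    (hper : IsPeriodicRestriction ψ) : inner ℝ σ (strain ψ) = 0 := by
  obtain ⟨U, G, hU, hG, hUG, hUp, hUψ⟩ := hper
  -- `G` is determined by `U`: it is periodic, and it agrees with the gradient of `ψ` on the cube
  have hgrad : ∀ i j, ∀ φ : Pt (n + 1) → ℝ, IsTest univ φ →
      ∫ x, U x i * pderiv j φ x = - ∫ x, G x (i, j) * φ x :=
    fun i j φ hφ => by simpa using hUG φ hφ i j
  have hGp : ∀ i j, ∀ k ∈ shifts (n + 1), ∀ᵐ x, G (x + latticeVec k) (i, j) = G x (i, j) :=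
    fun i j k hk => ae_apply_add_eq_of_weakGrad (hG.coord (i, j)) (hgrad i j)
      fun x => by rw [hUp.add_latticeVec hk]
  have hGψ : ∀ i j, (fun x => G x (i, j)) =ᵐ[volume.restrict (cube (n + 1))]
      fun x => grad ψ x (i, j) := by
    intro i j
    have hfin : IsFiniteMeasure ((volume : Measure (Pt (n + 1))).restrict (cube (n + 1))) :=
      isFiniteMeasure_restrict.2 (isBounded_cube _).measure_lt_top.ne
    refine ae_eq_of_integral_test_eq (isOpen_cube _)
      ((hG.coord (i, j)).memLp_cube.integrable (by norm_num)).locallyIntegrable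
      ((memLp_coord (grad ψ) (i, j)).integrable (by norm_num)).locallyIntegrable fun φ hφ => ?_
    have hφ' : IsTest univ φ := ⟨hφ.1, hφ.2.1, subset_univ _⟩
    have h1 : ∫ x in cube (n + 1), G x (i, j) * φ x = ∫ x, G x (i, j) * φ x :=
      setIntegral_eq_integral_of_forall_compl_eq_zero fun x hx => by
        rw [image_eq_zero_of_notMem_tsupport fun hm => hx (hφ.2.2 hm), mul_zero]
    have h2 : ∫ x in cube (n + 1), U x i * pderiv j φ x = ∫ x, U x i * pderiv j φ x :=
      setIntegral_eq_integral_of_forall_compl_eq_zero fun x hx => by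
        have : fderiv ℝ φ x = 0 := image_eq_zero_of_notMem_tsupport
          fun hm => hx (hφ.2.2 (tsupport_fderiv_subset ℝ hm))
        simp [pderiv, this]
    have h3 : ∫ x in cube (n + 1), U x i * pderiv j φ x
        = ∫ x in cube (n + 1), value ψ x i * pderiv j φ x :=
      integral_congr_ae (by filter_upwards [hUψ] with x hx; rw [hx])
    have h4 : ∫ x in cube (n + 1), value ψ x i * pderiv j φ x
        = - ∫ x in cube (n + 1), grad ψ x (i, j) * φ x := ψ.2 φ hφ i j
    linarith [hgrad i j φ hφ']
  have hS' : ∀ i j, IsL2loc fun x => (S x : Mat (n + 1)) (i, j) := fun i j =>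
    IsL2loc.coord (f := fun x => (S x : Mat (n + 1))) (fun K hK => (hS K hK).of_le
      (continuous_subtype_val.comp_aestronglyMeasurable (hS K hK).1) (ae_of_all _ fun x => le_rfl))
      (i, j)
  have horth : ∀ i, ∫ x in cube (n + 1), ∑ j, G x (i, j) * (S x : Mat (n + 1)) (i, j) = 0 := by
    intro i
    have h := integral_cube_divFree_mul_grad (fun j => hS' i j)
      (fun φ hφ => by simpa using hSdiv φ hφ i) (hU.coord i).indicator_strip
      (fun j => (hG.coord (i, j)).indicator_strip)
      (fun φ hφ j => integral_strip_mul_pderiv hψ hU hG hUG hUp hUψ hGp hGψ hφ i j)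
      (fun j k hk x => by rw [hSp.add_latticeVec hk])
      (fun k hk x => by
        rw [indicator_strip_add_latticeVec hk, hUp.add_latticeVec hk]
        rfl)
      (fun j k hk => by
        filter_upwards [hGp i j k hk] with x hx
        rw [indicator_strip_add_latticeVec hk, hx]
        rfl)
      (fun x => abs_le_of_indicator_strip_ne_zero) (fun j x => abs_le_of_indicator_strip_ne_zero)
    rw [← h]
    refine integral_congr_ae ?_
    filter_upwards [ae_restrict_mem (isOpen_cube (n + 1)).measurableSet] with x hx
    exact Finset.sum_congr rfl fun j _ => by rw [indicator_of_mem (show x ∈ strip _ from hx 0)]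
  have hfinal : inner ℝ σ (strain ψ)
      = ∫ x in cube (n + 1), ∑ i, ∑ j, G x (i, j) * (S x : Mat (n + 1)) (i, j) := by
    rw [L2.inner_def]
    refine integral_congr_ae ?_
    have h1 : ∀ᵐ x ∂(volume.restrict (cube (n + 1))), strain ψ x = symPart (n + 1) (grad ψ x) :=
      (symPart (n + 1)).coeFn_compLp (grad ψ)
    filter_upwards [h1, hSσ, ae_all_iff.2 fun i => ae_all_iff.2 fun j => hGψ i j] with x h1 h2 h3
    rw [h1, ← h2, inner_symPart]
    simp only [h3]
  have hint : ∀ i, Integrable (fun x => ∑ j, G x (i, j) * (S x : Mat (n + 1)) (i, j))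
      (volume.restrict (cube (n + 1))) := fun i => integrable_finsetSum _ fun j _ =>
    (hG.coord (i, j)).memLp_cube.integrable_mul (hS' i j).memLp_cube
  rw [hfinal, integral_finsetSum _ fun i _ => hint i]
  exact Finset.sum_eq_zero fun i _ => horth i

/-- An equilibrated stress is orthogonal to the strains of all displacements that vanish on the
Dirichlet part of the boundary (and are periodic, in the Dirichlet-Periodic case). -/
theorem inner_stress_strain_eq_zero {c : BoundaryCase} {Ω Γ₀ : Set (Pt d)}
    (hΩ : IsReferenceConfiguration c Ω Γ₀) {σ : L2 Ω (Msym d)} (hσ : IsEquilibrium c Ω Γ₀ σ)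
    {ψ : H1 Ω} (hψ : TraceZeroOn Ω Γ₀ ψ)
    (hper : c = .dirichletPeriodic → IsPeriodicRestriction ψ) : inner ℝ σ (strain ψ) = 0 := by
  cases c with
  | dirichletNeumann =>
    have h := hσ.2 ψ hψ
    rw [normalTracePairing] at h
    have h0 : inner ℝ (0 : L2 Ω (Pt d)) (value ψ) = 0 := inner_zero_left _
    rw [h0, zero_add] at h
    exact h
  | dirichletPeriodic =>
    obtain ⟨n, rfl⟩ := Nat.exists_eq_succ_of_ne_zero (NeZero.ne d)
    obtain ⟨_, rfl, rfl⟩ := hΩ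
    obtain ⟨S, hS, hSp, hSdiv, hSσ⟩ := hσ
    exact inner_stress_strain_eq_zero_of_periodic hS hSp hSdiv hSσ hψ (hper rfl)

end Orthogonality

end Plasticity

end

noncomputable section

namespace Plasticity

/-! ### Differences of admissible displacements -/

section Traces

variable {d : ℕ} {Ω Γ₀ : Set (Pt d)}

theorem gradMat_continuous {φ : Pt d → Pt d} (h : ContDiff ℝ ∞ φ) : Continuous (gradMat φ) := by
  refine (PiLp.continuous_toLp 2 _).comp (continuous_pi fun ij => ?_)
  exact (PiLp.continuous_apply 2 _ ij.1).comp
    ((h.continuous_fderiv (by simp)).clm_apply continuous_const)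

theorem gradMat_sub {φ ψ : Pt d → Pt d} (hφ : ContDiff ℝ ∞ φ) (hψ : ContDiff ℝ ∞ ψ) (x : Pt d) :
    gradMat (fun y => φ y - ψ y) x = gradMat φ x - gradMat ψ x := by
  ext ij
  simp only [gradMat, PiLp.sub_apply]
  rw [fderiv_fun_sub (hφ.differentiable (by simp) x) (hψ.differentiable (by simp) x)]
  simp

theorem tendsto_eLpNorm_sub_sub {α F : Type*} [MeasurableSpace α] [NormedAddCommGroup F]
    {μ : Measure α} {f g : ℕ → α → F} {a b : α → F}
    (hf : ∀ k, AEStronglyMeasurable (f k) μ) (hg : ∀ k, AEStronglyMeasurable (g k) μ)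
    (ha : AEStronglyMeasurable a μ) (hb : AEStronglyMeasurable b μ)
    (h1 : Tendsto (fun k => eLpNorm (fun x => f k x - a x) 2 μ) atTop (𝓝 0))
    (h2 : Tendsto (fun k => eLpNorm (fun x => g k x - b x) 2 μ) atTop (𝓝 0)) :
    Tendsto (fun k => eLpNorm (fun x => (f k x - g k x) - (a x - b x)) 2 μ) atTop (𝓝 0) := by
  have h3 := h1.add h2
  rw [add_zero] at h3
  refine tendsto_of_tendsto_of_tendsto_of_le_of_le tendsto_const_nhds h3 (fun _ => zero_le)
    fun k => ?_
  have e : (fun x => (f k x - g k x) - (a x - b x))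
      = (fun x => f k x - a x) - fun x => g k x - b x := by
    funext x
    simp only [Pi.sub_apply]
    abel
  simp only [e]
  exact eLpNorm_sub_le ((hf k).sub ha) ((hg k).sub hb) (by norm_num)

theorem HasTrace.sub {u w : H1 Ω} {g h : Pt d → Pt d} (hu : HasTrace Ω u g)
    (hw : HasTrace Ω w h) : HasTrace Ω (u - w) (fun x => g x - h x) := by
  obtain ⟨hg, φ, hφ, h1, h2, h3⟩ := hu
  obtain ⟨hh, χ, hχ, k1, k2, k3⟩ := hw
  refine ⟨hg.sub hh, fun k x => φ k x - χ k x, fun k => (hφ k).sub (hχ k), ?_, ?_, ?_⟩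
  · refine (tendsto_eLpNorm_sub_sub (fun k => (hφ k).continuous.aestronglyMeasurable)
      (fun k => (hχ k).continuous.aestronglyMeasurable) (Lp.aestronglyMeasurable _)
      (Lp.aestronglyMeasurable _) h1 k1).congr fun k => eLpNorm_congr_ae ?_
    filter_upwards [Lp.coeFn_sub (value u) (value w)] with x hx
    have : value (u - w) = value u - value w := rfl
    rw [this, hx, Pi.sub_apply]
  · refine (tendsto_eLpNorm_sub_sub (fun k => (gradMat_continuous (hφ k)).aestronglyMeasurable)
      (fun k => (gradMat_continuous (hχ k)).aestronglyMeasurable) (Lp.aestronglyMeasurable _)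
      (Lp.aestronglyMeasurable _) h2 k2).congr fun k => eLpNorm_congr_ae ?_
    filter_upwards [Lp.coeFn_sub (grad u) (grad w)] with x hx
    have : grad (u - w) = grad u - grad w := rfl
    rw [this, hx, Pi.sub_apply, gradMat_sub (hφ k) (hχ k)]
  · exact tendsto_eLpNorm_sub_sub (fun k => (hφ k).continuous.aestronglyMeasurable)
      (fun k => (hχ k).continuous.aestronglyMeasurable) hg.1 hh.1 h3 k3

theorem TraceEqOn.traceZeroOn_sub {u w : H1 Ω} (h : TraceEqOn Ω Γ₀ u w) :
    TraceZeroOn Ω Γ₀ (u - w) := by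
  obtain ⟨gu, gw, hu, hw, he⟩ := h
  refine ⟨_, hu.sub hw, ?_⟩
  filter_upwards [he] with x hx
  simp [hx]

theorem IsPeriodicRestriction.sub [NeZero d] {u w : H1 Ω} (hu : IsPeriodicRestriction u)
    (hw : IsPeriodicRestriction w) : IsPeriodicRestriction (u - w) := by
  obtain ⟨U, G, hU, hG, hUG, hUp, hUu⟩ := hu
  obtain ⟨W, J, hW, hJ, hWJ, hWp, hWw⟩ := hw
  refine ⟨fun x => U x - W x, fun x => G x - J x, hU.sub hW, hG.sub hJ, ?_, ?_, ?_⟩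
  · intro φ hφ i j
    have hc := hφ.continuous_pderiv j
    have e1 := hUG φ hφ i j
    have e2 := hWJ φ hφ i j
    simp only [Measure.restrict_univ] at e1 e2 ⊢
    simp only [PiLp.sub_apply, sub_mul]
    rw [integral_sub ((hU.coord i).integrable_mul hc.1 hc.2)
      ((hW.coord i).integrable_mul hc.1 hc.2),
      integral_sub ((hG.coord (i, j)).integrable_mul hφ.1.continuous hφ.2.1)
      ((hJ.coord (i, j)).integrable_mul hφ.1.continuous hφ.2.1), e1, e2]
    ring
  · intro i hi x
    simp only [hUp i hi x, hWp i hi x]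
  · filter_upwards [hUu, hWw, Lp.coeFn_sub (value u) (value w)] with x h1 h2 h3
    have : value (u - w) = value u - value w := rfl
    rw [this, h3, h1, h2, Pi.sub_apply]

end Traces

/-! ### The power of the stress -/

/-- If the strain of `u` splits as `e + p` and the functional `ℓ` vanishes on the strain of `u - w`
near the time `t`, then `ℓ ė` is determined by the rates of `w` and `p`. -/
theorem apply_deriv_eq_of_orthogonal {H X Y : Type*} [NormedAddCommGroup H] [NormedSpace ℝ H]
    [NormedAddCommGroup X] [NormedSpace ℝ X] [NormedAddCommGroup Y] [NormedSpace ℝ Y]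
    {A : H →L[ℝ] X} {I : Y →L[ℝ] X} {u w : ℝ → H} {e : ℝ → X} {p : ℝ → Y} {u' w' : H} {e' : X}
    {p' : Y} {t : ℝ} (ℓ : X →L[ℝ] ℝ) (hu : HasDerivAt u u' t) (hw : HasDerivAt w w' t)
    (he : HasDerivAt e e' t) (hp : HasDerivAt p p' t)
    (h1 : ∀ᶠ s in 𝓝 t, A (u s) = e s + I (p s)) (h2 : ∀ᶠ s in 𝓝 t, ℓ (A (u s - w s)) = 0) :
    ℓ e' = ℓ (A w') - ℓ (I p') := by
  have d1 : HasDerivAt (fun s => A (u s)) (A u') t := A.hasFDerivAt.comp_hasDerivAt t hu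
  have d2 : HasDerivAt (fun s => e s + I (p s)) (e' + I p') t :=
    he.add (I.hasFDerivAt.comp_hasDerivAt t hp)
  have e1 : A u' = e' + I p' := d1.unique (d2.congr_of_eventuallyEq h1)
  have d3 : HasDerivAt (fun s => ℓ (A (u s - w s))) (ℓ (A (u' - w'))) t :=
    (ℓ.comp A).hasFDerivAt.comp_hasDerivAt t (hu.sub hw)
  have e2 : ℓ (A (u' - w')) = 0 :=
    d3.unique ((hasDerivAt_const t (0 : ℝ)).congr_of_eventuallyEq h2)
  rw [map_sub, e1, map_sub, map_add] at e2
  linarith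

/-- The power identity: an equilibrated stress does no work on the strain of `u - w`. -/
theorem inner_stress_deriv {d : ℕ} [NeZero d] {c : BoundaryCase} {Ω Γ₀ : Set (Pt d)}
    (hΩ : IsReferenceConfiguration c Ω Γ₀) {C : Msym d →L[ℝ] Msym d}
    {w : ℝ → H1 Ω} (hw : IsH1loc w)
    (hw_per : c = BoundaryCase.dirichletPeriodic → ∀ t : ℝ, 0 ≤ t → IsPeriodicRestriction (w t))
    {u : ℝ → H1 Ω} {e : ℝ → L2 Ω (Msym d)} {p : ℝ → L2 Ω (MD d)}
    (hu : IsH1loc u) (he : IsH1loc e) (hp : IsH1loc p)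
    (hkin : KinematicAdmissibility c Γ₀ w u e p) (heq : EquilibriumCondition c Γ₀ C e) :
    ∀ᵐ t ∂(volume.restrict (Ioi (0 : ℝ))), inner ℝ (stress C (e t)) (deriv e t) =
      inner ℝ (stress C (e t)) (strain (deriv w t))
        - inner ℝ (devL Ω (stress C (e t))) (deriv p t) := by
  filter_upwards [hu.ae_hasDerivAt, hw.ae_hasDerivAt, he.ae_hasDerivAt, hp.ae_hasDerivAt,
    ae_restrict_mem measurableSet_Ioi] with t h1 h2 h3 h4 ht
  rw [← inner_inclL]
  refine apply_deriv_eq_of_orthogonal (X := L2 Ω (Msym d)) (Y := L2 Ω (MD d)) (A := strainL Ω)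
    (I := inclL Ω) (ℓ := pairL (d := d) (Ω := Ω) (stress C (e t))) h1 h2 h3 h4 ?_ ?_
  · filter_upwards [Ioi_mem_nhds ht] with s hs
    exact (hkin s hs).strain_eq
  · filter_upwards [Ioi_mem_nhds ht] with s hs
    have h0 : inner ℝ (stress C (e t)) (strain (u s - w s)) = 0 :=
      inner_stress_strain_eq_zero hΩ (heq t ht) (hkin s hs).boundary.traceZeroOn_sub
        fun hc => ((hkin s hs).periodic hc).sub (hw_per hc s (le_of_lt hs))
    exact h0

/-! ### The dissipation gap -/

section Gap

variable {d : ℕ} {Ω : Set (Pt d)} {K : Set (StressSpace d)}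

/-- The density `H(n) + ε |n|² - q : n`, with `q` the generalized stress and `n` the rate of the
internal variables; it measures the failure of the flow rule. -/
def gapDensity (K : Set (StressSpace d)) (ε : ℝ) (q n : StressSpace d) : ℝ :=
  supportH K n + ε * ‖n‖ ^ 2 - inner ℝ q n

theorem integral_sq_norm {F : Type} [NormedAddCommGroup F] [InnerProductSpace ℝ F] (f : L2 Ω F) :
    Integrable (fun x => ‖f x‖ ^ 2) (volume.restrict Ω) ∧ ∫ x in Ω, ‖f x‖ ^ 2 = ‖f‖ ^ 2 := by
  refine ⟨(Lp.memLp f).integrable_norm_pow (by norm_num), ?_⟩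
  rw [← real_inner_self_eq_norm_sq f, L2.inner_def]
  exact integral_congr_ae (ae_of_all _ fun x => (real_inner_self_eq_norm_sq (f x)).symm)

theorem gapDensity_eq (ε : ℝ) (a a' : MD d) (b b' : ℝ) :
    gapDensity K ε (WithLp.toLp 2 (a, b)) (WithLp.toLp 2 (a', b')) =
      supportH K (WithLp.toLp 2 (a', b')) + ε * ‖a'‖ ^ 2 + ε * ‖b'‖ ^ 2 - inner ℝ a a'
        - inner ℝ b b' := by
  have h := norm_sq_stressSpace (WithLp.toLp 2 (a', b') : StressSpace d)
  change _ = ‖a'‖ ^ 2 + b' ^ 2 at h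
  rw [gapDensity, h, WithLp.prod_inner_apply, Real.norm_eq_abs, sq_abs]
  ring

variable [IsFiniteMeasure ((volume : Measure (Pt d)).restrict Ω)]

theorem integral_gapDensity (hK : IsYieldSet K) (ε : ℝ) (σ p : L2 Ω (MD d)) (ζ z : L2 Ω ℝ) :
    Integrable (fun x => gapDensity K ε (WithLp.toLp 2 (σ x, ζ x)) (WithLp.toLp 2 (p x, z x)))
      (volume.restrict Ω) ∧
    ∫ x in Ω, gapDensity K ε (WithLp.toLp 2 (σ x, ζ x)) (WithLp.toLp 2 (p x, z x)) =
      dissipation K p z + ε * ‖p‖ ^ 2 + ε * ‖z‖ ^ 2 - inner ℝ σ p - inner ℝ ζ z := by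
  have i1 := integrable_supportH hK p z
  have i2 := (integral_sq_norm p).1.const_mul ε
  have i3 := (integral_sq_norm z).1.const_mul ε
  have i4 := L2.integrable_inner (𝕜 := ℝ) σ p
  have i5 := L2.integrable_inner (𝕜 := ℝ) ζ z
  simp only [gapDensity_eq]
  refine ⟨(((i1.add i2).add i3).sub i4).sub i5, ?_⟩
  rw [integral_sub (by exact ((i1.add i2).add i3).sub i4) i5,
    integral_sub (by exact (i1.add i2).add i3) i4,
    integral_add (by exact i1.add i2) i3, integral_add i1 i2, integral_const_mul, integral_const_mul,
    (integral_sq_norm p).2, (integral_sq_norm z).2, ← L2.inner_def, ← L2.inner_def]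
  rfl

theorem ae_neg_potentialDeriv {V : ℝ → ℝ} (hV : IsSofteningPotential K V) (z : L2 Ω ℝ) :
    ∀ᵐ x ∂(volume.restrict Ω), (-potentialDeriv hV z : L2 Ω ℝ) x = -deriv V (z x) := by
  filter_upwards [Lp.coeFn_neg (potentialDeriv hV z), coeFn_potentialDeriv hV z] with x h1 h2
  rw [h1, Pi.neg_apply, h2]

/-- A pair of measurable fields satisfies the stress constraint as soon as it takes its values in
`K` almost everywhere: integrability is automatic, because `K` is bounded. -/
theorem mem_stressConstraintSet_iff (hK : IsYieldSet K) {ε : ℝ} {V : ℝ → ℝ}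
    (hV : IsSofteningPotential K V) (σ : L2 Ω (Msym d)) (p : L2 Ω (MD d)) (y z : L2 Ω ℝ) :
    ((fun x => dev d (σ x) - ε • p x, fun x => -deriv V (y x) - ε * z x) :
      (Pt d → MD d) × (Pt d → ℝ)) ∈ stressConstraintSet Ω K ↔
    ∀ᵐ x ∂(volume.restrict Ω), (WithLp.toLp 2 (dev d (σ x), -deriv V (y x)) : StressSpace d)
      - ε • (WithLp.toLp 2 (p x, z x) : StressSpace d) ∈ K := by
  refine ⟨fun h => h.2.2, fun h => ?_⟩
  obtain ⟨B, hB, hB'⟩ := hK.exists_bound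
  have m1 : MemLp (fun x => dev d (σ x)) 2 (volume.restrict Ω) :=
    (Lp.memLp (devL Ω σ)).ae_eq (coeFn_devL σ)
  have m2 : AEStronglyMeasurable (fun x => -deriv V (y x) - ε * z x) (volume.restrict Ω) :=
    (memLp_deriv_potential hV y 2).1.neg.sub ((Lp.aestronglyMeasurable z).const_mul ε)
  refine ⟨m1.sub ((Lp.memLp p).const_smul ε), MemLp.of_bound m2 B ?_, h⟩
  filter_upwards [h] with x hx
  refine le_trans ?_ (hB' _ hx)
  refine le_of_sq_le_sq ?_ (norm_nonneg _)
  rw [norm_sq_stressSpace, Real.norm_eq_abs, sq_abs]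
  change _ ≤ _ + (-deriv V (y x) - ε * z x) ^ 2
  linarith [sq_nonneg ‖((WithLp.toLp 2 (dev d (σ x), -deriv V (y x)) : StressSpace d)
      - ε • (WithLp.toLp 2 (p x, z x) : StressSpace d)).fst‖]

end Gap

theorem isFiniteMeasure_of_isReferenceConfiguration {d : ℕ} [NeZero d] {c : BoundaryCase}
    {Ω Γ₀ : Set (Pt d)} (hΩ : IsReferenceConfiguration c Ω Γ₀) :
    IsFiniteMeasure ((volume : Measure (Pt d)).restrict Ω) := by
  have hb : Bornology.IsBounded Ω := by
    cases c with
    | dirichletNeumann => exact hΩ.2.2.1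
    | dirichletPeriodic =>
      rw [hΩ.2.1]
      exact isBounded_cube d
  exact ⟨by simpa using hb.measure_lt_top⟩

/-! ### The energy balance and the equivalence -/

section Evolution

variable {d : ℕ} {Ω : Set (Pt d)}

theorem intervalIntegrable_inner_of_continuousOn {X : Type*} [NormedAddCommGroup X]
    [InnerProductSpace ℝ X] {f g : ℝ → X} {T : ℝ} (hT : 0 ≤ T) (hf : ContinuousOn f (Icc 0 T))
    (hg : IntegrableOn g (Icc 0 T)) :
    IntervalIntegrable (fun t => inner ℝ (f t) (g t)) volume 0 T := by
  rw [intervalIntegrable_iff_integrableOn_Icc_of_le hT]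
  obtain ⟨R, hR⟩ := isCompact_Icc.exists_bound_of_continuousOn hf
  refine Integrable.mono' (hg.norm.const_mul R)
    ((hf.aestronglyMeasurable measurableSet_Icc).inner hg.1) ?_
  filter_upwards [ae_restrict_mem measurableSet_Icc] with t ht
  exact (norm_inner_le_norm _ _).trans (by gcongr; exact hR t ht)

theorem integrable_strain {α : Type*} [MeasurableSpace α] {μ : Measure α} {f : α → H1 Ω}
    (hf : Integrable f μ) : Integrable (fun t => strain (f t)) μ :=
  (strainL Ω).integrable_comp hf

theorem intervalIntegrable_power (C : Msym d →L[ℝ] Msym d) {e : ℝ → L2 Ω (Msym d)}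
    {w : ℝ → H1 Ω} (he : IsH1loc e) (hw : IsH1loc w) {T : ℝ} (hT : 0 ≤ T) :
    IntervalIntegrable (fun t => inner ℝ (stress C (e t)) (strain (deriv w t))) volume 0 T :=
  intervalIntegrable_inner_of_continuousOn (X := L2 Ω (Msym d)) hT
    ((stressL Ω C).continuous.comp_continuousOn (he.continuousOn T))
    (integrable_strain (integrableOn_of_memLp_two (hw.memLp_deriv T)))

variable {K : Set (StressSpace d)} {C : Msym d →L[ℝ] Msym d} {V : ℝ → ℝ}
  [IsFiniteMeasure ((volume : Measure (Pt d)).restrict Ω)]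

theorem IsH1loc.integral_potentialDeriv (hV : IsSofteningPotential K V) {z : ℝ → L2 Ω ℝ}
    (hz : IsH1loc z) {T : ℝ} (hT : 0 ≤ T) :
    IntervalIntegrable (fun t => inner ℝ (potentialDeriv hV (z t)) (deriv z t)) volume 0 T ∧
    ∫ t in (0 : ℝ)..T, inner ℝ (potentialDeriv hV (z t)) (deriv z t)
      = softeningEnergy V (z T) - softeningEnergy V (z 0) := by
  obtain ⟨L, hL⟩ := softeningEnergy_lipschitz (Ω := Ω) hV
  exact hz.integral_fderiv_comp (hasFDerivAt_softeningEnergy hV)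
    (fun _ => ⟨L, fun x y _ _ => hL x y⟩) hT

theorem IsH1loc.intervalIntegrable_norm_sq {X : Type} [NormedAddCommGroup X] [NormedSpace ℝ X]
    [CompleteSpace X] {f : ℝ → X} (hf : IsH1loc f) {T : ℝ} (hT : 0 ≤ T) :
    IntervalIntegrable (fun t => ‖deriv f t‖ ^ 2) volume 0 T := by
  rw [intervalIntegrable_iff_integrableOn_Icc_of_le hT]
  exact (hf.memLp_deriv T).integrable_norm_pow (by norm_num)

/-- The dissipation gap at one instant, integrated over `Ω`, for the strain `e`, the internal
variable `z` and the rates `p'`, `z'`. -/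
def gap (K : Set (StressSpace d)) (C : Msym d →L[ℝ] Msym d) (ε : ℝ) (hV : IsSofteningPotential K V)
    (e : L2 Ω (Msym d)) (z : L2 Ω ℝ) (p' : L2 Ω (MD d)) (z' : L2 Ω ℝ) : ℝ :=
  ∫ x in Ω, gapDensity K ε
    (WithLp.toLp 2 (devL Ω (stress C e) x, (-potentialDeriv hV z : L2 Ω ℝ) x))
    (WithLp.toLp 2 (p' x, z' x))

theorem gap_eq (hK : IsYieldSet K) (ε : ℝ) (hV : IsSofteningPotential K V)
    (e : L2 Ω (Msym d)) (z : L2 Ω ℝ) (p' : L2 Ω (MD d)) (z' : L2 Ω ℝ) :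
    gap K C ε hV e z p' z' = dissipation K p' z' + ε * ‖p'‖ ^ 2 + ε * ‖z'‖ ^ 2
      - inner ℝ (devL Ω (stress C e)) p' + inner ℝ (potentialDeriv hV z) z' := by
  rw [gap, (integral_gapDensity hK ε _ _ _ _).2, inner_neg_left, sub_neg_eq_add]

/-- Along an evolution whose stress obeys the power identity, the energy equality says that the
dissipation gap has zero integral over every time interval. -/
theorem energyEquality_iff (hK : IsYieldSet K) (hC : IsElasticityTensor C)
    (hV : IsSofteningPotential K V) (ε : ℝ) {w : ℝ → H1 Ω} (hw : IsH1loc w)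
    {e : ℝ → L2 Ω (Msym d)} {p : ℝ → L2 Ω (MD d)} {z : ℝ → L2 Ω ℝ}
    (he : IsH1loc e) (hp : IsH1loc p) (hz : IsH1loc z)
    (hpow : ∀ᵐ t ∂(volume.restrict (Ioi (0 : ℝ))), inner ℝ (stress C (e t)) (deriv e t) =
      inner ℝ (stress C (e t)) (strain (deriv w t))
        - inner ℝ (devL Ω (stress C (e t))) (deriv p t)) :
    (∀ T : ℝ, 0 ≤ T →
      IntervalIntegrable (fun t => gap K C ε hV (e t) (z t) (deriv p t) (deriv z t)) volume 0 T) ∧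
    (EnergyEquality K C V ε w (e 0) (z 0) e p z ↔ ∀ T : ℝ, 0 < T →
      ∫ t in (0 : ℝ)..T, gap K C ε hV (e t) (z t) (deriv p t) (deriv z t) = 0) := by
  have key : ∀ T : ℝ, 0 ≤ T →
      IntervalIntegrable (fun t => gap K C ε hV (e t) (z t) (deriv p t) (deriv z t)) volume 0 T ∧
      ∫ t in (0 : ℝ)..T, gap K C ε hV (e t) (z t) (deriv p t) (deriv z t) =
        (∫ t in (0 : ℝ)..T, dissipation K (deriv p t) (deriv z t))
        + ε * (∫ t in (0 : ℝ)..T, ‖deriv p t‖ ^ 2) + ε * (∫ t in (0 : ℝ)..T, ‖deriv z t‖ ^ 2)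
        + (elasticEnergy C (e T) - elasticEnergy C (e 0))
        - (∫ t in (0 : ℝ)..T, inner ℝ (stress C (e t)) (strain (deriv w t)))
        + (softeningEnergy V (z T) - softeningEnergy V (z 0)) := by
    intro T hT
    have i1 := intervalIntegrable_dissipation hK hT (hp.memLp_deriv T) (hz.memLp_deriv T)
    have i2 := (hp.intervalIntegrable_norm_sq hT).const_mul ε
    have i3 := (hz.intervalIntegrable_norm_sq hT).const_mul ε
    obtain ⟨i4, e4⟩ := he.integral_stress hC hT
    have i5 := intervalIntegrable_power C he hw hT
    obtain ⟨i6, e6⟩ := hz.integral_potentialDeriv hV hT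
    have hae : ∀ᵐ t ∂(volume.restrict (uIoc 0 T)),
        dissipation K (deriv p t) (deriv z t) + ε * ‖deriv p t‖ ^ 2 + ε * ‖deriv z t‖ ^ 2
          + inner ℝ (stress C (e t)) (deriv e t) - inner ℝ (stress C (e t)) (strain (deriv w t))
          + inner ℝ (potentialDeriv hV (z t)) (deriv z t)
        = gap K C ε hV (e t) (z t) (deriv p t) (deriv z t) := by
      rw [uIoc_of_le hT]
      filter_upwards [ae_restrict_of_ae_restrict_of_subset Ioc_subset_Ioi_self hpow] with t ht
      rw [gap_eq hK, ht]
      ring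
    refine ⟨(((((i1.add i2).add i3).add i4).sub i5).add i6).congr_ae hae, ?_⟩
    rw [← intervalIntegral.integral_congr_ae_restrict hae,
      intervalIntegral.integral_add (by exact (((i1.add i2).add i3).add i4).sub i5) i6,
      intervalIntegral.integral_sub (by exact ((i1.add i2).add i3).add i4) i5,
      intervalIntegral.integral_add (by exact (i1.add i2).add i3) i4,
      intervalIntegral.integral_add (by exact i1.add i2) i3,
      intervalIntegral.integral_add i1 i2, intervalIntegral.integral_const_mul,
      intervalIntegral.integral_const_mul, e4, e6]
  refine ⟨fun T hT => (key T hT).1, forall_congr' fun T => forall_congr' fun hT => ?_⟩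
  rw [(key T hT.le).2]
  constructor <;> intro h <;> linarith

/-- Pointwise form of the flow rule: almost everywhere in `Ω` it amounts to the stress constraint
together with a vanishing gap density. -/
theorem flow_iff (hK : IsYieldSet K) {ε : ℝ} (hε : 0 < ε) (hV : IsSofteningPotential K V)
    (e : L2 Ω (Msym d)) (z : L2 Ω ℝ) (p' : L2 Ω (MD d)) (z' : L2 Ω ℝ) :
    (∀ᵐ x ∂((volume : Measure (Pt d)).restrict Ω), (WithLp.toLp 2 (p' x, z' x) : StressSpace d) =
      flowN K ε (WithLp.toLp 2 (dev d (stress C e x), -deriv V (z x)))) ↔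
    ((fun x => dev d (stress C e x) - ε • p' x, fun x => -deriv V (z x) - ε * z' x) :
      (Pt d → MD d) × (Pt d → ℝ)) ∈ stressConstraintSet Ω K ∧
      gap K C ε hV e z p' z' = 0 := by
  have hq : ∀ᵐ x ∂((volume : Measure (Pt d)).restrict Ω),
      gapDensity K ε (WithLp.toLp 2 (devL Ω (stress C e) x, (-potentialDeriv hV z : L2 Ω ℝ) x))
        (WithLp.toLp 2 (p' x, z' x)) =
      gapDensity K ε (WithLp.toLp 2 (dev d (stress C e x), -deriv V (z x)))
        (WithLp.toLp 2 (p' x, z' x)) := by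
    filter_upwards [coeFn_devL (stress C e), ae_neg_potentialDeriv hV z] with x h1 h2
    rw [h1, h2]
  have hi := (integral_gapDensity hK ε (devL Ω (stress C e)) p' (-potentialDeriv hV z) z').1
  rw [mem_stressConstraintSet_iff hK hV]
  constructor
  · intro h
    refine ⟨?_, integral_eq_zero_of_ae ?_⟩
    · filter_upwards [h] with x hx using ((eq_flowN_iff hK hε).1 hx).1
    · filter_upwards [h, hq] with x hx hqx
      rw [hqx]
      exact ((eq_flowN_iff hK hε).1 hx).2
  · rintro ⟨h, h0⟩
    have hnn : 0 ≤ᵐ[volume.restrict Ω] fun x =>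
        gapDensity K ε (WithLp.toLp 2 (devL Ω (stress C e) x, (-potentialDeriv hV z : L2 Ω ℝ) x))
          (WithLp.toLp 2 (p' x, z' x)) := by
      filter_upwards [h, hq] with x hx hqx
      rw [hqx]
      exact dissipation_gap_nonneg hK hx
    filter_upwards [h, hq, (integral_eq_zero_iff_of_nonneg_ae hnn hi).1 h0] with x hx hqx h0x
    rw [hqx] at h0x
    exact (eq_flowN_iff hK hε).2 ⟨hx, h0x⟩

theorem gap_nonneg (hK : IsYieldSet K) {ε : ℝ} (hV : IsSofteningPotential K V)
    {e : L2 Ω (Msym d)} {z : L2 Ω ℝ} {p' : L2 Ω (MD d)} {z' : L2 Ω ℝ}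
    (h : ((fun x => dev d (stress C e x) - ε • p' x, fun x => -deriv V (z x) - ε * z' x) :
      (Pt d → MD d) × (Pt d → ℝ)) ∈ stressConstraintSet Ω K) :
    0 ≤ gap K C ε hV e z p' z' := by
  rw [mem_stressConstraintSet_iff hK hV] at h
  refine integral_nonneg_of_ae ?_
  filter_upwards [h, coeFn_devL (stress C e), ae_neg_potentialDeriv hV z] with x hx h1 h2
  rw [h1, h2]
  exact dissipation_gap_nonneg hK hx

/-- A nonnegative function on `(0, ∞)` all of whose integrals over `(0, T)` vanish is zero. -/
theorem ae_eq_zero_of_integral_eq_zero {f : ℝ → ℝ}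
    (hi : ∀ T : ℝ, 0 ≤ T → IntervalIntegrable f volume 0 T)
    (hf : ∀ᵐ t ∂(volume.restrict (Ioi (0 : ℝ))), 0 ≤ f t)
    (h : ∀ T : ℝ, 0 < T → ∫ t in (0 : ℝ)..T, f t = 0) :
    ∀ᵐ t ∂(volume.restrict (Ioi (0 : ℝ))), f t = 0 := by
  refine ae_Ioi_of_forall_Ioo fun T hT => ?_
  have h1 := h T hT
  rw [intervalIntegral.integral_of_le hT.le, integral_eq_zero_iff_of_nonneg_ae
    (ae_restrict_of_ae_restrict_of_subset Ioc_subset_Ioi_self hf)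
    ((intervalIntegrable_iff_integrableOn_Ioc_of_le hT.le).1 (hi T hT.le))] at h1
  filter_upwards [(ae_restrict_iff' measurableSet_Ioc).1 h1] with t ht htT
  exact ht ⟨htT.1, htT.2.le⟩

end Evolution

end Plasticity

end

open Plasticity

theorem mainTheorem4 {d : ℕ} [NeZero d] (c : BoundaryCase) (Ω Γ₀ : Set (Pt d))
    (hΩ : IsReferenceConfiguration c Ω Γ₀)
    (K : Set (StressSpace d)) (hK : IsYieldSet K)
    (C : Msym d →L[ℝ] Msym d) (hC : IsElasticityTensor C)
    (V : ℝ → ℝ) (hV : IsSofteningPotential K V)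
    (w : ℝ → H1 Ω) (hw : IsH1loc w)
    (hw_per : c = BoundaryCase.dirichletPeriodic → ∀ t : ℝ, 0 ≤ t → IsPeriodicRestriction (w t))
    (u₀ : H1 Ω) (e₀ : L2 Ω (Msym d)) (p₀ : L2 Ω (MD d)) (z₀ : L2 Ω ℝ)
    (hu₀_per : c = BoundaryCase.dirichletPeriodic → IsPeriodicRestriction u₀)
    (ε : ℝ) (hε : 0 < ε)
    (u : ℝ → H1 Ω) (e : ℝ → L2 Ω (Msym d)) (p : ℝ → L2 Ω (MD d)) (z : ℝ → L2 Ω ℝ)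
    (hu : IsH1loc u) (he : IsH1loc e) (hp : IsH1loc p) (hz : IsH1loc z) :
    IsRegularizedSolution c Γ₀ K C V ε w u₀ e₀ p₀ z₀ u e p z ↔
      (InitialCondition u₀ e₀ p₀ z₀ u e p z ∧
        KinematicAdmissibility c Γ₀ w u e p ∧
        EquilibriumCondition c Γ₀ C e ∧
        ModifiedStressConstraint K C V ε e p z ∧
        EnergyEquality K C V ε w e₀ z₀ e p z) := by
  have hfin := isFiniteMeasure_of_isReferenceConfiguration hΩ
  have main : InitialCondition u₀ e₀ p₀ z₀ u e p z → KinematicAdmissibility c Γ₀ w u e p →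
      EquilibriumCondition c Γ₀ C e →
      (RegularizedFlowRule K C V ε e p z ↔
        ModifiedStressConstraint K C V ε e p z ∧ EnergyEquality K C V ε w e₀ z₀ e p z) := by
    rintro ⟨-, rfl, -, rfl⟩ hkin heq
    obtain ⟨hint, hen⟩ := energyEquality_iff hK hC hV ε hw he hp hz
      (inner_stress_deriv hΩ hw hw_per hu he hp hkin heq)
    rw [hen]
    constructor
    · intro h
      refine ⟨?_, fun T hT => ?_⟩
      · filter_upwards [h] with t ht using ((flow_iff hK hε hV (e t) (z t) _ _).1 ht).1
      · refine intervalIntegral.integral_zero_ae ?_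
        filter_upwards [(ae_restrict_iff' measurableSet_Ioi).1 h] with t ht htT
        rw [uIoc_of_le hT.le] at htT
        exact ((flow_iff hK hε hV (e t) (z t) _ _).1 (ht htT.1)).2
    · rintro ⟨h1, h2⟩
      have h0 := ae_eq_zero_of_integral_eq_zero hint
        (by filter_upwards [h1] with t ht using gap_nonneg hK hV ht) h2
      filter_upwards [h1, h0] with t ht1 ht0
      exact (flow_iff hK hε hV (e t) (z t) _ _).2 ⟨ht1, ht0⟩
  constructor
  · intro h
    exact ⟨h.initial, h.kinematic, h.equilibrium,
      (main h.initial h.kinematic h.equilibrium).1 h.flow⟩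
  · rintro ⟨h0, h1, h2, h34⟩
    exact ⟨hu, he, hp, hz, h0, h1, h2, (main h0 h1 h2).2 h34⟩
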